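/- Let $\lambda>1$ and let $G_\lambda=\mathbb Z\ltimes_\lambda\mathbb R$ be the group $\mathbb Z\times\mathbb R$ with the law $(m,t)(n,s)=(m+n,\lambda^m s+t)$. Let $r\ge 2$ and let $\rho$ be a locally free $C^r$ action of $G_\lambda$ on $\mathbb T^2=\mathbb R^2/\mathbb Z^2$; that is, $\rho$ is an action by bijections, $(g,z)\mapsto\rho(g)z$ is of class $C^r$ on $G_\lambda\times\mathbb T^2$, and all stabilizers are discrete. Put $f=\rho(1,0)$ and $\phi_t=\rho(0,t)$, and let $\mathcal F^u$ be the foliation of $\mathbb T^2$ by the orbits $\{\phi_t(z):t\in\mathbb R\}$. Then the map $A=f_*\in \mathrm{GL}(2,\mathbb Z)$ induced by $f$ on $H_1(\mathbb T^2)=\mathbb Z^2$ is hyperbolic (it has no eigenvalue of modulus $1$), and for every lift $F:\mathbb R^2\to\mathbb R^2$ of $f$ the following holds. 1. There is a Franks semiconjugacy from $F$ to $A$, i.e. a continuous surjective map $H:\mathbb R^2\to\mathbb R^2$ such that $H(x+m)=H(x)+m$ for all $x\in\mathbb R^2$, $m\in\mathbb Z^2$; $\|H-\mathrm{Id}\|_{C^0}<K$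 for some constant $K$; and $H\circ F=A\circ H$. 2. For every such $H$, the map $h:\mathbb T^2\to\mathbb T^2$ induced by $H$ is a homeomorphism and satisfies $h\circ f=A\circ h$, so that $f$ is topologically conjugate to the automorphism $A$ of $\mathbb T^2$. Moreover $h(\mathcal F^u)=L^u$, where $L^u$ is the linear expanding foliation of $A$, whose leaves are the projections to $\mathbb T^2$ of the lines in $\mathbb R^2$ parallel to the eigenspace of $A$ for its eigenvalue of modulus $>1$: for every $z\in\mathbb T^2$, $h$ maps the orbit of $z$ under $\phi$ onto the leaf of $L^u$ through $h(z)$. -/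

import Mathlib

open Set Filter Topology

noncomputable section

/-- The set `ℤ × ℝ` underlying the group `ℤ ⋉_l ℝ`. -/
@[ext] structure AbelByCyclic (l : ℝ) where
  m : ℤ
  t : ℝ

namespace AbelByCyclic

variable {l : ℝ}

/-- The group law `(m, t) ∘ (n, s) = (m + n, l ^ m * s + t)`. -/
instance : Mul (AbelByCyclic l) := ⟨fun g k => ⟨g.m + k.m, l ^ g.m * k.t + g.t⟩⟩
instance : One (AbelByCyclic l) := ⟨⟨0, 0⟩⟩
instance : Inv (AbelByCyclic l) := ⟨fun g => ⟨-g.m, -(l ^ (-g.m) * g.t)⟩⟩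

theorem mul_def (g k : AbelByCyclic l) : g * k = ⟨g.m + k.m, l ^ g.m * k.t + g.t⟩ := rfl
theorem one_def : (1 : AbelByCyclic l) = ⟨0, 0⟩ := rfl
theorem inv_def (g : AbelByCyclic l) : g⁻¹ = ⟨-g.m, -(l ^ (-g.m) * g.t)⟩ := rfl

instance [hl : Fact (1 < l)] : Group (AbelByCyclic l) :=
  Group.ofLeftAxioms
    (fun a b c => by
      have h0 : l ≠ 0 := (zero_lt_one.trans hl.out).ne'
      ext
      · simp [mul_def, add_assoc]
      · simp only [mul_def, zpow_add₀ h0]; ring)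
    (fun a => by ext <;> simp [mul_def, one_def])
    (fun a => by ext <;> simp [mul_def, one_def, inv_def])

/-- The topology of `ℤ × ℝ` (discrete times usual). -/
instance : TopologicalSpace (AbelByCyclic l) :=
  TopologicalSpace.induced (fun g => (g.m, g.t)) inferInstance

end AbelByCyclic

/-- The torus `𝕋² = ℝ² / ℤ²`. -/
abbrev Torus2 : Type := UnitAddTorus (Fin 2)

/-- The projection `ℝ² → 𝕋²`. -/
def torusProj (x : Fin 2 → ℝ) : Torus2 := fun i => (x i : UnitAddCircle)

/-- The vector of `ℝ²` with the given integer coordinates. -/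
def intVec (m : Fin 2 → ℤ) : Fin 2 → ℝ := fun i => (m i : ℝ)

/-- `Φ : ℝ × 𝕋² → 𝕋²` is of class `C^r`: near every point of `ℝ × ℝ²` it lifts to a
`C^r` map into `ℝ²`. (Local inverses of the projection are the charts of the torus.) -/
def IsTorusContDiff (r : WithTop ℕ∞) (Φ : ℝ × Torus2 → Torus2) : Prop :=
  ∀ p : ℝ × (Fin 2 → ℝ), ∃ G : ℝ × (Fin 2 → ℝ) → (Fin 2 → ℝ),
    ContDiffAt ℝ r G p ∧ ∀ᶠ q in 𝓝 p, torusProj (G q) = Φ (q.1, torusProj q.2)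

/-- An action of `ℤ ⋉_l ℝ` on the torus is of class `C^r` if `(g, z) ↦ ρ g z` is `C^r` on each
of the components `{m} × ℝ × 𝕋²`. -/
def IsContDiffAction (r : WithTop ℕ∞) {l : ℝ} [Fact (1 < l)]
    (ρ : AbelByCyclic l →* Equiv.Perm Torus2) : Prop :=
  ∀ m : ℤ, IsTorusContDiff r (fun p => ρ ⟨m, p.1⟩ p.2)

/-- An action is locally free if all its stabilizers are discrete. -/
def IsLocallyFree {l : ℝ} [Fact (1 < l)] (ρ : AbelByCyclic l →* Equiv.Perm Torus2) : Prop :=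
  ∀ z : Torus2, DiscreteTopology {g : AbelByCyclic l | ρ g z = z}

/-- The leaf through `z` of the orbit foliation of the flow `t ↦ ρ (0, t)`. -/
def flowOrbit {l : ℝ} [Fact (1 < l)] (ρ : AbelByCyclic l →* Equiv.Perm Torus2)
    (z : Torus2) : Set Torus2 :=
  range fun t : ℝ => ρ ⟨0, t⟩ z

/-- `F : ℝ² → ℝ²` is a (continuous) lift of `f : 𝕋² → 𝕋²`. -/
def IsTorusLift (f : Torus2 → Torus2) (F : (Fin 2 → ℝ) → (Fin 2 → ℝ)) : Prop :=
  Continuous F ∧ ∀ x, torusProj (F x) = f (torusProj x)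

/-- The integer matrix `A` acting on `ℝ²`. -/
def linAct (A : Matrix (Fin 2) (Fin 2) ℤ) (x : Fin 2 → ℝ) : Fin 2 → ℝ :=
  (A.map (Int.cast : ℤ → ℝ)).mulVec x

/-- The endomorphism of the torus induced by the integer matrix `A`. -/
def torusLin (A : Matrix (Fin 2) (Fin 2) ℤ) (z : Torus2) : Torus2 :=
  fun i => ∑ j, A i j • z j

/-- `A` is the matrix of `f_*` on `H₁(𝕋²) = ℤ²`, where `m ∈ ℤ²` is the class of the projection of
any path from `x` to `x + m`: a lift of `f` sends such a path to a path
from `F x` to `F x + A m`. -/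
def IsHomologyMatrix (f : Torus2 → Torus2) (A : Matrix (Fin 2) (Fin 2) ℤ) : Prop :=
  ∃ F, IsTorusLift f F ∧ ∀ x m, F (x + intVec m) = F x + intVec (A.mulVec m)

/-- No complex eigenvalue lies on the unit circle. -/
def IsHyperbolicMatrix (A : Matrix (Fin 2) (Fin 2) ℤ) : Prop :=
  ∀ μ ∈ spectrum ℂ (A.map (Int.cast : ℤ → ℂ)), ‖μ‖ ≠ 1

/-- The expanding subspace of `A` in `ℝ²`: the span of the eigenvectors whose eigenvalue has
modulus larger than one. (For a hyperbolic `A ∈ GL(2, ℤ)` both eigenvalues are real and exactly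
one of them is expanding, so this is the expanding eigenline.) -/
def expandingSubspace (A : Matrix (Fin 2) (Fin 2) ℤ) : Submodule ℝ (Fin 2 → ℝ) :=
  ⨆ μ ∈ {μ : ℝ | 1 < |μ|},
    Module.End.eigenspace (Matrix.toLin' (A.map (Int.cast : ℤ → ℝ))) μ

/-- The leaf through `z` of the linear expanding foliation of `A` on the torus. -/
def expandingLeaf (A : Matrix (Fin 2) (Fin 2) ℤ) (z : Torus2) : Set Torus2 :=
  (fun v => z + torusProj v) '' (expandingSubspace A : Set (Fin 2 → ℝ))

/-- `H` is a Franks semiconjugacy, on the universal cover, from `F` to `A`. -/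
structure IsFranksSemiconj (F : (Fin 2 → ℝ) → (Fin 2 → ℝ)) (A : Matrix (Fin 2) (Fin 2) ℤ)
    (H : (Fin 2 → ℝ) → (Fin 2 → ℝ)) : Prop where
  continuous : Continuous H
  surjective : Function.Surjective H
  equivariant : ∀ x m, H (x + intVec m) = H x + intVec m
  bounded : ∃ K : ℝ, ∀ x, ‖H x - x‖ < K
  semiconj : ∀ x, H (F x) = linAct A (H x)

end

noncomputable section

/-! On the universal cover, `φ` is a C² flow without stationary points that commutes with integer
translations, and `F (φ t x) = φ (l * t) (F x)`. Pulling a periodic orbit back by `F` divides its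
period by `l`, while periods are bounded below, so `φ` is free. A turning-angle argument in the
plane (`not_first_return`) shows that orbits of a free periodic flow do not come back close to where
they were. Hence the time that an orbit arc spends in a box is bounded by the size of the box
(`exists_packing_bound`).

This makes `A` hyperbolic. Otherwise `A ^ 12` is unipotent, the images of a short orbit arc under
`F^[12 * n]` have diameter polynomial in `n`, and yet their duration grows like `l ^ (12 * n)`
(`IsScaledFlow.exists_isSpectralPair`).

In eigencoordinates a Franks semiconjugacy is a pair `Hu`, `Hs`, obtained from two geometric series.
`Hs` is constant on orbits because `F` contracts its variation. Comparing packing with linear growth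
gives `|μ| = l`. Thus `F^[2]` rescales time and increments of `Hu` by the same factor, and
maximizing the mean speed of `Hu` yields an orbit on which `Hu` has constant speed `a ≠ 0`. Such an
orbit separates the plane into higher and lower values of `Hs` (`exists_flow_eq_of_lt`). The levels
of its lattice translates are dense, so every point at which `Hs` is not locally constant also moves
with speed `a`.

The remaining obstacle is a level set of `Hs` with nonempty interior `W`, and it is excluded by an
argument of Denjoy type. `W` is invariant under the flow and disjoint from its integer translates,
so it has finite area, and the sum of the Jacobians along forward orbits is integrable on bounded
parts of `W`. If that sum at `x` were small compared with the inverse distance from `x` to the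
complement of `W`, a ball around `x` reaching past the boundary would be contracted along the orbit.
Recurrence of a boundary point modulo the lattice would then bring it back into itself with `Hs`
shifted by a nonzero constant, which is impossible on a compact ball (`exists_lt_infDist_mul`). So
the sum is at least a constant over the distance to the boundary, and this is not integrable along
lines (`interior_level_eq_empty`).

Now every orbit has constant speed, and a limit argument gives injectivity of `(Hu, Hs)`. The
induced torus map is a homeomorphism, and it carries each orbit onto a translate of the expanding
line. -/

theorem exists_continuous_log {Y : Type*} [TopologicalSpace Y] [SimplyConnectedSpace Y]
    [LocallyPathConnectedSpace Y] {f : Y → ℂ} (hf : Continuous f) (h0 : ∀ y, f y ≠ 0) :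
    ∃ L : Y → ℂ, Continuous L ∧ ∀ y, Complex.exp (L y) = f y := by
  obtain ⟨y₀⟩ : Nonempty Y := inferInstance
  obtain ⟨F, ⟨-, hF⟩, -⟩ := Complex.isCoveringMap_exp.existsUnique_continuousMap_lifts
    (⟨fun y => ⟨f y, h0 y⟩, by fun_prop⟩ : C(Y, {z : ℂ // z ≠ 0})) y₀ (Complex.log (f y₀))
    (Subtype.ext (Complex.exp_log (h0 y₀)))
  exact ⟨F, F.continuous, fun y => congrArg Subtype.val (congrFun hF y)⟩

/-! ### Integer translations and periodic functions. -/

theorem intVec_add (m n : Fin 2 → ℤ) : intVec (m + n) = intVec m + intVec n := by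
  ext i; simp [intVec]

theorem intVec_injective : Function.Injective intVec := fun m n h => by
  ext i; simpa [intVec] using congrFun h i

theorem one_le_norm_intVec {m : Fin 2 → ℤ} (hm : m ≠ 0) : 1 ≤ ‖intVec m‖ := by
  obtain ⟨i, hi⟩ := Function.ne_iff.1 hm
  refine le_trans ?_ (norm_le_pi_norm _ i)
  rw [intVec, Real.norm_eq_abs]
  exact_mod_cast Int.one_le_abs hi

theorem exists_mem_Icc_add_intVec (x : Fin 2 → ℝ) :
    ∃ y ∈ Icc (0 : Fin 2 → ℝ) 1, ∃ m, x = y + intVec m := by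
  refine ⟨fun i => Int.fract (x i), ⟨fun i => Int.fract_nonneg _, fun i => (Int.fract_lt_one _).le⟩,
    fun i => ⌊x i⌋, ?_⟩
  ext i; simp [intVec, Int.fract_add_floor]

/-- A continuous function on `T × ℝ²`, `T` compact, periodic in the second variable, attains its
maximum. -/
theorem exists_forall_le_of_periodic {T : Set ℝ} (hT : IsCompact T) (hne : T.Nonempty)
    {g : ℝ → (Fin 2 → ℝ) → ℝ} (hg : ContinuousOn (fun p : ℝ × (Fin 2 → ℝ) => g p.1 p.2) (T ×ˢ univ))
    (hper : ∀ t x m, g t (x + intVec m) = g t x) :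
    ∃ t₀ ∈ T, ∃ x₀, ∀ t ∈ T, ∀ x, g t x ≤ g t₀ x₀ := by
  obtain ⟨⟨t₀, x₀⟩, h0, hmax⟩ := (hT.prod (isCompact_Icc (a := (0 : Fin 2 → ℝ)) (b := 1))).exists_isMaxOn
    (hne.prod (nonempty_Icc.2 zero_le_one)) (hg.mono (prod_mono_right (subset_univ _)))
  refine ⟨t₀, h0.1, x₀, fun t ht x => ?_⟩
  obtain ⟨y, hy, m, rfl⟩ := exists_mem_Icc_add_intVec x
  rw [hper]
  exact hmax (show (t, y) ∈ _ from ⟨ht, hy⟩)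

theorem exists_forall_le_of_periodic' {g : (Fin 2 → ℝ) → ℝ} (hg : Continuous g)
    (hper : ∀ x m, g (x + intVec m) = g x) : ∃ x₀, ∀ x, g x ≤ g x₀ := by
  obtain ⟨-, -, x₀, h⟩ := exists_forall_le_of_periodic (T := {0}) isCompact_singleton
    (singleton_nonempty 0) (g := fun _ => g) (by fun_prop) (fun _ => hper)
  exact ⟨x₀, h 0 rfl⟩

theorem exists_norm_le_of_periodic {V : Type*} [NormedAddCommGroup V] {T : Set ℝ} (hT : IsCompact T)
    {g : ℝ → (Fin 2 → ℝ) → V} (hg : Continuous (fun p : ℝ × (Fin 2 → ℝ) => g p.1 p.2))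
    (hper : ∀ t x m, g t (x + intVec m) = g t x) :
    ∃ C, 0 < C ∧ ∀ t ∈ T, ∀ x, ‖g t x‖ ≤ C := by
  rcases T.eq_empty_or_nonempty with rfl | hne
  · exact ⟨1, one_pos, by simp⟩
  obtain ⟨t₀, -, x₀, h⟩ := exists_forall_le_of_periodic hT hne (g := fun t x => ‖g t x‖)
    (by fun_prop) (fun t x m => by simp only [hper])
  exact ⟨‖g t₀ x₀‖ + 1, by positivity, fun t ht x => (h t ht x).trans (by linarith)⟩

theorem exists_pos_forall_pos_of_periodic {g : ℝ → (Fin 2 → ℝ) → ℝ}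
    (hg : Continuous (fun p : ℝ × (Fin 2 → ℝ) => g p.1 p.2))
    (hper : ∀ t x m, g t (x + intVec m) = g t x) (h0 : ∀ x, 0 < g 0 x) :
    ∃ a > 0, ∀ t, |t| ≤ a → ∀ x, 0 < g t x := by
  have hK : IsCompact (Icc (0 : Fin 2 → ℝ) 1) := isCompact_Icc
  have hev : ∀ᶠ t in 𝓝 (0 : ℝ), ∀ x ∈ Icc (0 : Fin 2 → ℝ) 1, 0 < g t x :=
    hK.eventually_forall_of_forall_eventually fun x _ =>
      (hg.continuousAt (x := (0, x))).eventually (lt_mem_nhds (h0 x))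
  obtain ⟨a, ha, h⟩ := Metric.eventually_nhds_iff.1 hev
  refine ⟨a / 2, by positivity, fun t ht x => ?_⟩
  obtain ⟨y, hy, m, rfl⟩ := exists_mem_Icc_add_intVec x
  rw [hper]
  exact h (by rw [Real.dist_eq, sub_zero]; linarith) y hy

/-! ### Continuous arguments and crossing paths. -/

/-- An angle that avoids a direction along a connected set stays in one interval of
length `2π`. -/
theorem exists_int_forall_mem_Ioo {Y : Type*} [TopologicalSpace Y] {S : Set Y}
    (hS : IsPreconnected S) {θ : Y → ℝ} (hθ : ContinuousOn θ S) (α : ℝ)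
    (h : ∀ y ∈ S, ∀ n : ℤ, θ y ≠ α + 2 * Real.pi * n) :
    ∃ j : ℤ, ∀ y ∈ S, θ y ∈ Ioo (α + 2 * Real.pi * j) (α + 2 * Real.pi * (j + 1)) := by
  have hpi := Real.pi_pos
  rcases S.eq_empty_or_nonempty with rfl | ⟨y₀, hy₀⟩
  · exact ⟨0, by simp⟩
  have hoc := (hS.image θ hθ).ordConnected
  set j := ⌊(θ y₀ - α) / (2 * Real.pi)⌋
  have h1 : α + 2 * Real.pi * j ≤ θ y₀ := by
    have := Int.floor_le ((θ y₀ - α) / (2 * Real.pi))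
    rw [le_div_iff₀ (by positivity)] at this
    linarith
  have h2 : θ y₀ < α + 2 * Real.pi * (j + 1) := by
    have := Int.lt_floor_add_one ((θ y₀ - α) / (2 * Real.pi))
    rw [div_lt_iff₀ (by positivity)] at this
    linarith
  refine ⟨j, fun y hy => ⟨?_, ?_⟩⟩
  · by_contra! hlt
    obtain ⟨z, hz, hzj⟩ := hoc.out (mem_image_of_mem θ hy) (mem_image_of_mem θ hy₀) ⟨hlt, h1⟩
    exact h z hz j hzj
  · by_contra! hlt
    obtain ⟨z, hz, hzj⟩ := hoc.out (mem_image_of_mem θ hy₀) (mem_image_of_mem θ hy) ⟨h2.le, hlt⟩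
    exact h z hz (j + 1) (by rw [hzj]; push_cast; ring)

/-- A positive cosine forbids the direction opposite to `α`, so connectedness confines the angle to
one period; the sign of the cosine then leaves only its middle half. -/
theorem exists_int_forall_mem_Ioo_of_cos_pos {Y : Type*} [TopologicalSpace Y] {S : Set Y}
    (hS : IsPreconnected S) {θ : Y → ℝ} (hθ : ContinuousOn θ S) (α : ℝ)
    (h : ∀ y ∈ S, 0 < Real.cos (θ y - α)) :
    ∃ j : ℤ, ∀ y ∈ S, θ y ∈ Ioo (α + 2 * Real.pi * j - Real.pi / 2)
      (α + 2 * Real.pi * j + Real.pi / 2) := by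
  obtain ⟨j, hj⟩ := exists_int_forall_mem_Ioo hS hθ (α + Real.pi) (fun y hy n hn => by
    have h1 := h y hy
    rw [show θ y - α = Real.pi + n * (2 * Real.pi) by rw [hn]; ring, Real.cos_add_int_mul_two_pi,
      Real.cos_pi] at h1
    linarith)
  refine ⟨j + 1, fun y hy => ?_⟩
  obtain ⟨h1, h2⟩ := hj y hy
  have hc := h y hy
  have hp : 0 < Real.cos (θ y - α - (j + 1 : ℤ) * (2 * Real.pi)) := by
    rwa [Real.cos_sub_int_mul_two_pi]
  push_cast at hp ⊢
  set β := θ y - α - (j + 1) * (2 * Real.pi) with hβ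
  have hb : -(Real.pi / 2) < β ∧ β < Real.pi / 2 := by
    constructor
    · by_contra! hlt
      have := Real.cos_nonpos_of_pi_div_two_le_of_le (x := -β) (by linarith)
        (by linarith)
      rw [Real.cos_neg] at this
      linarith
    · by_contra! hlt
      have := Real.cos_nonpos_of_pi_div_two_le_of_le (x := β) (by linarith)
        (by linarith)
      linarith
  constructor <;> linarith [hb.1, hb.2]

/-- A path from left to right and a path from bottom to top intersect. The coordinates are two
functions `u`, `s`. -/
theorem exists_crossing {E : Type*} [TopologicalSpace E] {u s : E → ℝ} (hu : Continuous u)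
    (hs : Continuous s) (hinj : ∀ x y, u x = u y → s x = s y → x = y)
    {P C : ℝ → E} (hP : Continuous P) (hC : Continuous C)
    (hlo : ∀ t, s (C 0) < s (P t)) (hhi : ∀ t, s (P t) < s (C 1))
    (htop : Tendsto (fun t => u (P t)) atTop atTop)
    (hbot : Tendsto (fun t => u (P t)) atBot atBot) :
    ∃ t, ∃ τ ∈ Icc (0 : ℝ) 1, P t = C τ := by
  by_contra! hne
  let pr : ℝ → ℝ := fun τ => (projIcc (0 : ℝ) 1 zero_le_one τ : ℝ)
  have hpr : Continuous pr := by fun_prop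
  have hprm : ∀ τ, pr τ ∈ Icc (0 : ℝ) 1 := fun τ => (projIcc (0 : ℝ) 1 zero_le_one τ).2
  have hpr0 : pr 0 = 0 := by simp [pr, projIcc_left]
  have hpr1 : pr 1 = 1 := by simp [pr, projIcc_right]
  -- Without a crossing `Δ` has no zero, so it has a continuous logarithm. The clamp `pr` extends
  -- the second parameter from `[0, 1]` to `ℝ`, which makes the domain a simply connected plane.
  let Δ : ℝ × ℝ → ℂ := fun q => ⟨u (P q.1) - u (C (pr q.2)), s (P q.1) - s (C (pr q.2))⟩
  have hΔ : Continuous Δ := by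
    have : Δ = fun q => ((u (P q.1) - u (C (pr q.2)) : ℝ) : ℂ)
        + ((s (P q.1) - s (C (pr q.2)) : ℝ) : ℂ) * Complex.I := by
      funext q; exact Complex.mk_eq_add_mul_I _ _
    rw [this]; fun_prop
  have hΔ0 : ∀ q, Δ q ≠ 0 := fun q h => by
    have h1 := congrArg Complex.re h
    have h2 := congrArg Complex.im h
    simp only [Δ, Complex.zero_re, Complex.zero_im] at h1 h2
    exact hne q.1 _ (hprm q.2) (hinj _ _ (by linarith) (by linarith))
  obtain ⟨L, hL, hexp⟩ := exists_continuous_log hΔ hΔ0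
  obtain ⟨B, hB⟩ := (isCompact_Icc (a := (0 : ℝ)) (b := 1)).exists_bound_of_continuousOn
    (hu.comp hC).continuousOn
  have hB' : ∀ τ, |u (C (pr τ))| ≤ B := fun τ => hB _ (hprm τ)
  obtain ⟨T, hT⟩ := (htop.eventually (eventually_gt_atTop B)).exists
  obtain ⟨T', hT'⟩ := (hbot.eventually (eventually_lt_atBot (-B))).exists
  have hcos : ∀ q, (Δ q).re = Real.exp (L q).re * Real.cos (L q).im := fun q => by
    rw [← hexp, Complex.exp_re]
  have hsin : ∀ q, (Δ q).im = Real.exp (L q).re * Real.sin (L q).im := fun q => by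
    rw [← hexp, Complex.exp_im]
  have hpos : ∀ {a b : ℝ}, 0 < Real.exp a * b → 0 < b := fun {a b} h =>
    (pos_iff_pos_of_mul_pos h).1 (Real.exp_pos a)
  have hneg : ∀ {a b : ℝ}, Real.exp a * b < 0 → 0 < -b := fun {a b} h =>
    hpos (a := a) (by linarith)
  have hpi := Real.pi_pos
  obtain ⟨j1, h1⟩ := exists_int_forall_mem_Ioo_of_cos_pos (S := univ) isPreconnected_univ
    (θ := fun t => (L (t, 0)).im) (by fun_prop) (Real.pi / 2) (fun t _ => by
      rw [Real.cos_sub_pi_div_two]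
      refine hpos (a := (L (t, 0)).re) ?_
      rw [← hsin]; simp only [Δ, hpr0]; linarith [hlo t])
  obtain ⟨j2, h2⟩ := exists_int_forall_mem_Ioo_of_cos_pos (S := univ) isPreconnected_univ
    (θ := fun τ => (L (T, τ)).im) (by fun_prop) 0 (fun t _ => by
      rw [sub_zero]
      refine hpos (a := (L (T, t)).re) ?_
      rw [← hcos]; simp only [Δ]; linarith [(abs_le.1 (hB' t)).2])
  obtain ⟨j3, h3⟩ := exists_int_forall_mem_Ioo_of_cos_pos (S := univ) isPreconnected_univ
    (θ := fun t => (L (t, 1)).im) (by fun_prop) (-(Real.pi / 2)) (fun t _ => by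
      rw [sub_neg_eq_add, Real.cos_add_pi_div_two]
      refine hneg (a := (L (t, 1)).re) ?_
      rw [← hsin]; simp only [Δ, hpr1]; linarith [hhi t])
  obtain ⟨j4, h4⟩ := exists_int_forall_mem_Ioo_of_cos_pos (S := univ) isPreconnected_univ
    (θ := fun τ => (L (T', τ)).im) (by fun_prop) Real.pi (fun t _ => by
      rw [Real.cos_sub_pi]
      refine hneg (a := (L (T', t)).re) ?_
      rw [← hcos]; simp only [Δ]; linarith [(abs_le.1 (hB' t)).1])
  have key : ∀ (i j : ℤ) (c : ℝ), |c| ≤ Real.pi / 2 → |2 * Real.pi * ((i : ℝ) - j) + c| < Real.pi → i = j := by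
    intro i j c hc h
    have a1 : 2 * Real.pi * ((i : ℝ) - j) < 2 * Real.pi * 1 := by
      linarith [(abs_lt.1 h).2, (abs_le.1 hc).1]
    have a2 : 2 * Real.pi * (-1) < 2 * Real.pi * ((i : ℝ) - j) := by
      linarith [(abs_lt.1 h).1, (abs_le.1 hc).2]
    have b1 := lt_of_mul_lt_mul_left a1 (by positivity)
    have b2 := lt_of_mul_lt_mul_left a2 (by positivity)
    have c1 : i - j < 1 := by exact_mod_cast b1
    have c2 : -1 < i - j := by exact_mod_cast b2
    omega
  -- On the four sides of the rectangle the argument stays within `π / 2` of `π / 2`, `0`, `-π / 2`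
  -- and `π`, up to multiples of `2π`. Three corners force these multiples to agree; at the fourth
  -- corner the centres `-π / 2` and `π` are then too far apart.
  have e12 : j1 = j2 := by
    obtain ⟨a, b⟩ := h1 T trivial
    obtain ⟨c, d⟩ := h2 0 trivial
    exact key j1 j2 (Real.pi / 2) (by rw [abs_of_pos] <;> linarith)
      (abs_lt.2 ⟨by linarith, by linarith⟩)
  have e32 : j3 = j2 := by
    obtain ⟨a, b⟩ := h3 T trivial
    obtain ⟨c, d⟩ := h2 1 trivial
    exact key j3 j2 (-(Real.pi / 2)) (by rw [abs_neg, abs_of_pos] <;> linarith)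
      (abs_lt.2 ⟨by linarith, by linarith⟩)
  have e41 : j4 = j1 := by
    obtain ⟨a, b⟩ := h1 T' trivial
    obtain ⟨c, d⟩ := h4 0 trivial
    exact key j4 j1 (Real.pi / 2) (by rw [abs_of_pos] <;> linarith)
      (abs_lt.2 ⟨by linarith, by linarith⟩)
  obtain ⟨a, b⟩ := h3 T' trivial
  obtain ⟨c, d⟩ := h4 1 trivial
  subst e12; subst e32; subst e41
  linarith

/-! ### Plane flows commuting with integer translations. -/

/-- The dot product of the plane. -/
def dot2 (v w : Fin 2 → ℝ) : ℝ := v 0 * w 0 + v 1 * w 1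

theorem dot2_self_pos {v : Fin 2 → ℝ} (hv : v ≠ 0) : 0 < dot2 v v := by
  unfold dot2
  by_contra! h
  apply hv
  have h0 : v 0 = 0 := by nlinarith [mul_self_nonneg (v 0), mul_self_nonneg (v 1)]
  have h1 : v 1 = 0 := by nlinarith [mul_self_nonneg (v 0), mul_self_nonneg (v 1)]
  ext i; fin_cases i <;> simpa

theorem dot2_self_le (v : Fin 2 → ℝ) : dot2 v v ≤ 2 * ‖v‖ ^ 2 := by
  unfold dot2
  have h0 := norm_le_pi_norm v 0
  have h1 := norm_le_pi_norm v 1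
  rw [Real.norm_eq_abs] at h0 h1
  nlinarith [abs_mul_abs_self (v 0), abs_mul_abs_self (v 1), abs_nonneg (v 0), abs_nonneg (v 1)]

theorem norm_sq_le_dot2 (v : Fin 2 → ℝ) : ‖v‖ ^ 2 ≤ dot2 v v := by
  have h : ‖v‖ ≤ Real.sqrt (dot2 v v) := by
    refine (pi_norm_le_iff_of_nonneg (Real.sqrt_nonneg _)).2 fun i => Real.abs_le_sqrt ?_
    unfold dot2
    fin_cases i <;> simp <;> nlinarith [mul_self_nonneg (v 0), mul_self_nonneg (v 1)]
  calc ‖v‖ ^ 2 ≤ Real.sqrt (dot2 v v) ^ 2 := by gcongr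
    _ = dot2 v v := Real.sq_sqrt (by unfold dot2; nlinarith [mul_self_nonneg (v 0), mul_self_nonneg (v 1)])

theorem abs_dot2_le (v w : Fin 2 → ℝ) : |dot2 v w| ≤ 2 * ‖v‖ * ‖w‖ := by
  have h : ∀ i, |v i * w i| ≤ ‖v‖ * ‖w‖ := fun i => by
    rw [abs_mul]
    exact mul_le_mul (norm_le_pi_norm v i) (norm_le_pi_norm w i) (abs_nonneg _) (norm_nonneg _)
  have := abs_add_le (v 0 * w 0) (v 1 * w 1)
  unfold dot2
  linarith [h 0, h 1]

theorem Continuous.dot2 {Y : Type*} [TopologicalSpace Y] {f g : Y → Fin 2 → ℝ} (hf : Continuous f)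
    (hg : Continuous g) : Continuous fun y => dot2 (f y) (g y) := by
  unfold _root_.dot2; fun_prop

theorem HasDerivAt.dot2 {f g : ℝ → Fin 2 → ℝ} {f' g' : Fin 2 → ℝ} {t : ℝ} (hf : HasDerivAt f f' t)
    (hg : HasDerivAt g g' t) :
    HasDerivAt (fun s => dot2 (f s) (g s)) (dot2 f' (g t) + dot2 (f t) g') t := by
  have h := ((hasDerivAt_pi.1 hf 0).mul (hasDerivAt_pi.1 hg 0)).add
    ((hasDerivAt_pi.1 hf 1).mul (hasDerivAt_pi.1 hg 1))
  unfold _root_.dot2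
  refine h.congr_deriv ?_
  ring

/-- A `C²` flow of the plane without fixed points that commutes with integer translations. -/
structure IsPlaneFlow (φ : ℝ → (Fin 2 → ℝ) → (Fin 2 → ℝ)) : Prop where
  contDiff : ContDiff ℝ 2 fun p : ℝ × (Fin 2 → ℝ) => φ p.1 p.2
  map_zero : ∀ x, φ 0 x = x
  map_add : ∀ s t x, φ (s + t) x = φ s (φ t x)
  equivariant : ∀ t x m, φ t (x + intVec m) = φ t x + intVec m
  deriv_ne_zero : ∀ x, deriv (fun t => φ t x) 0 ≠ 0

/-- The generating vector field. -/
def velocity (φ : ℝ → (Fin 2 → ℝ) → (Fin 2 → ℝ)) (x : Fin 2 → ℝ) : Fin 2 → ℝ :=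
  deriv (fun t => φ t x) 0

/-- A periodic `C¹` map is Lipschitz. -/
theorem exists_lipschitz_of_periodic {V : Type*} [NormedAddCommGroup V] [NormedSpace ℝ V]
    {g : (Fin 2 → ℝ) → V} (hg : ContDiff ℝ 1 g)
    (hper : ∀ m, ∃ v, ∀ x, g (x + intVec m) = g x + v) :
    ∃ C, 0 < C ∧ ∀ x y, ‖g x - g y‖ ≤ C * ‖x - y‖ := by
  obtain ⟨C, hC, h⟩ := exists_norm_le_of_periodic (T := {0}) isCompact_singleton
    (g := fun _ x => fderiv ℝ g x)
    ((hg.continuous_fderiv one_ne_zero).comp continuous_snd) (fun _ x m => by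
      obtain ⟨v, hv⟩ := hper m
      rw [← fderiv_comp_add_right, show (fun x => g (x + intVec m)) = fun x => g x + v from funext hv,
        fderiv_add_const])
  refine ⟨C, hC, fun x y => ?_⟩
  exact convex_univ.norm_image_sub_le_of_norm_fderiv_le
    (fun x _ => (hg.differentiable one_ne_zero) x) (fun x _ => h 0 rfl x) (mem_univ y) (mem_univ x)

namespace IsPlaneFlow

variable {φ : ℝ → (Fin 2 → ℝ) → (Fin 2 → ℝ)}

theorem continuous (hφ : IsPlaneFlow φ) : Continuous fun p : ℝ × (Fin 2 → ℝ) => φ p.1 p.2 :=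
  hφ.contDiff.continuous

theorem continuous_comp (hφ : IsPlaneFlow φ) {Y : Type*} [TopologicalSpace Y] {t : Y → ℝ}
    {x : Y → Fin 2 → ℝ} (ht : Continuous t) (hx : Continuous x) :
    Continuous fun y => φ (t y) (x y) :=
  hφ.continuous.comp (ht.prodMk hx)

theorem neg_apply (hφ : IsPlaneFlow φ) (t : ℝ) (x : Fin 2 → ℝ) : φ (-t) (φ t x) = x := by
  rw [← hφ.map_add, neg_add_cancel, hφ.map_zero]

theorem injective (hφ : IsPlaneFlow φ) (t : ℝ) : Function.Injective (φ t) := fun x y h => by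
  rw [← hφ.neg_apply t x, h, hφ.neg_apply]

theorem hasDerivAt_zero (hφ : IsPlaneFlow φ) (x : Fin 2 → ℝ) :
    HasDerivAt (fun t => φ t x) (velocity φ x) 0 := by
  have h : Differentiable ℝ fun t => φ t x :=
    (hφ.contDiff.comp (contDiff_id.prodMk contDiff_const)).differentiable two_ne_zero
  exact (h 0).hasDerivAt

theorem hasDerivAt (hφ : IsPlaneFlow φ) (x : Fin 2 → ℝ) (t : ℝ) :
    HasDerivAt (fun t => φ t x) (velocity φ (φ t x)) t := by
  have h := (hφ.hasDerivAt_zero (φ t x))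
  have h2 := HasDerivAt.comp_sub_const t t (f := fun s => φ s (φ t x)) (by simpa using h)
  refine h2.congr_of_eventuallyEq (Eventually.of_forall fun s => ?_)
  simp only [← hφ.map_add, sub_add_cancel]

theorem velocity_add (hφ : IsPlaneFlow φ) (x : Fin 2 → ℝ) (m : Fin 2 → ℤ) :
    velocity φ (x + intVec m) = velocity φ x := by
  unfold velocity
  simp only [hφ.equivariant, deriv_add_const]

theorem velocity_eq (hφ : IsPlaneFlow φ) (x : Fin 2 → ℝ) :
    velocity φ x = fderiv ℝ (fun p : ℝ × (Fin 2 → ℝ) => φ p.1 p.2) (0, x) (1, 0) := by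
  have h1 : HasFDerivAt (fun p : ℝ × (Fin 2 → ℝ) => φ p.1 p.2) _ (0, x) :=
    ((hφ.contDiff.differentiable two_ne_zero) (0, x)).hasFDerivAt
  have h2 : HasDerivAt (fun t : ℝ => (t, x)) (1, 0) 0 :=
    (hasDerivAt_id 0).prodMk (hasDerivAt_const 0 x)
  have h3 := h1.comp_hasDerivAt (0 : ℝ) h2
  exact (hφ.hasDerivAt_zero x).unique h3

theorem contDiff_velocity (hφ : IsPlaneFlow φ) : ContDiff ℝ 1 (velocity φ) := by
  rw [funext hφ.velocity_eq]
  exact ((hφ.contDiff.fderiv_right (m := 1) (by norm_num)).comp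
    (contDiff_const.prodMk contDiff_id)).clm_apply contDiff_const

theorem continuous_velocity (hφ : IsPlaneFlow φ) : Continuous (velocity φ) :=
  hφ.contDiff_velocity.continuous

theorem velocity_ne_zero (hφ : IsPlaneFlow φ) (x : Fin 2 → ℝ) : velocity φ x ≠ 0 :=
  hφ.deriv_ne_zero x

theorem exists_velocity_bound (hφ : IsPlaneFlow φ) : ∃ V, 0 < V ∧ ∀ x, ‖velocity φ x‖ ≤ V := by
  obtain ⟨V, hV, h⟩ := exists_norm_le_of_periodic (T := {0}) isCompact_singleton
    (g := fun _ x => velocity φ x) (hφ.continuous_velocity.comp continuous_snd)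
    (fun _ => hφ.velocity_add)
  exact ⟨V, hV, h 0 rfl⟩

theorem norm_sub_le (hφ : IsPlaneFlow φ) {V : ℝ} (hV : ∀ x, ‖velocity φ x‖ ≤ V) (s t : ℝ)
    (x : Fin 2 → ℝ) : ‖φ t x - φ s x‖ ≤ V * |t - s| := by
  have := convex_univ.norm_image_sub_le_of_norm_hasDerivWithin_le (f := fun t => φ t x)
    (fun t _ => (hφ.hasDerivAt x t).hasDerivWithinAt) (fun t _ => hV (φ t x)) (mem_univ s)
    (mem_univ t)
  simpa using this

/-- For short times the velocity makes an acute angle with the initial velocity, uniformly in `x` by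
periodicity. The bound `a` therefore excludes returns within short times. -/
theorem exists_strictMonoOn (hφ : IsPlaneFlow φ) {b : ℝ} (hb : 0 < b) : ∃ a > 0, a ≤ b ∧ ∀ x,
    StrictMonoOn (fun t => dot2 (φ t x) (velocity φ x)) (Icc (-a) a) := by
  obtain ⟨a, ha, h⟩ := exists_pos_forall_pos_of_periodic
    (g := fun t x => dot2 (velocity φ (φ t x)) (velocity φ x))
    ((hφ.continuous_velocity.comp hφ.continuous).dot2 (hφ.continuous_velocity.comp continuous_snd))
    (fun t x m => by simp only [hφ.equivariant, hφ.velocity_add])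
    (fun x => by rw [hφ.map_zero]; exact dot2_self_pos (hφ.velocity_ne_zero x))
  refine ⟨min a b, lt_min ha hb, min_le_right _ _, fun x => ?_⟩
  have hd : ∀ t, HasDerivAt (fun t => dot2 (φ t x) (velocity φ x))
      (dot2 (velocity φ (φ t x)) (velocity φ x)) t := fun t =>
    ((hφ.hasDerivAt x t).dot2 (hasDerivAt_const t (velocity φ x))).congr_deriv (by simp [dot2])
  refine strictMonoOn_of_deriv_pos (convex_Icc _ _)
    (fun t _ => (hd t).continuousAt.continuousWithinAt) fun t ht => ?_
  rw [(hd t).deriv]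
  rw [interior_Icc] at ht
  exact h t (abs_le.2 ⟨by linarith [ht.1, min_le_left a b], by linarith [ht.2, min_le_left a b]⟩) x

/-- The mean velocity along an orbit segment. -/
def secant (φ : ℝ → (Fin 2 → ℝ) → (Fin 2 → ℝ)) (t : ℝ) (x : Fin 2 → ℝ) : Fin 2 → ℝ :=
  ∫ r in (0 : ℝ)..1, velocity φ (φ (r * t) x)

theorem secant_zero (hφ : IsPlaneFlow φ) (x : Fin 2 → ℝ) : secant φ 0 x = velocity φ x := by
  simp [secant, hφ.map_zero]

theorem smul_secant (hφ : IsPlaneFlow φ) (t : ℝ) (x : Fin 2 → ℝ) :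
    t • secant φ t x = φ t x - x := by
  have hd : ∀ r ∈ uIcc (0 : ℝ) 1, HasDerivAt (fun r => φ (r * t) x) (t • velocity φ (φ (r * t) x)) r :=
    fun r _ => HasDerivAt.scomp (g₁ := fun t => φ t x) r (hφ.hasDerivAt x (r * t))
      (hasDerivAt_mul_const t)
  have hc : Continuous fun r : ℝ => t • velocity φ (φ (r * t) x) :=
    (hφ.continuous_velocity.comp (hφ.continuous_comp (by fun_prop) continuous_const)).const_smul t
  have := intervalIntegral.integral_eq_sub_of_hasDerivAt hd (hc.intervalIntegrable 0 1)
  rw [intervalIntegral.integral_smul, one_mul, zero_mul, hφ.map_zero] at this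
  exact this

theorem continuous_secant (hφ : IsPlaneFlow φ) :
    Continuous fun p : ℝ × (Fin 2 → ℝ) => secant φ p.1 p.2 := by
  refine intervalIntegral.continuous_parametric_intervalIntegral_of_continuous'
    (f := fun (p : ℝ × (Fin 2 → ℝ)) r => velocity φ (φ (r * p.1) p.2)) ?_ 0 1
  exact hφ.continuous_velocity.comp (hφ.continuous_comp (by fun_prop) (by fun_prop))

/-- For a free flow the chord directions, completed by the velocity at `t = 0`, form a zero-free
field on the simply connected space `ℝ × ℝ²`. This is what provides a global branch of their
argument. -/
theorem secant_ne_zero (hφ : IsPlaneFlow φ) (hfree : ∀ x t, φ t x = x → t = 0) (t : ℝ)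
    (x : Fin 2 → ℝ) : secant φ t x ≠ 0 := fun h => by
  rcases eq_or_ne t 0 with rfl | ht
  · rw [hφ.secant_zero] at h
    exact hφ.velocity_ne_zero x h
  · have := hφ.smul_secant t x
    rw [h, smul_zero] at this
    exact ht (hfree x t (sub_eq_zero.1 this.symm))

end IsPlaneFlow

/-! ### Turning angles and the absence of close returns. -/

/-- The plane as `ℂ`. -/
def planeToComplex (v : Fin 2 → ℝ) : ℂ := ⟨v 0, v 1⟩

theorem planeToComplex_ne_zero {v : Fin 2 → ℝ} (hv : v ≠ 0) : planeToComplex v ≠ 0 := fun h => by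
  apply hv
  have h0 := congrArg Complex.re h
  have h1 := congrArg Complex.im h
  ext i; fin_cases i
  · exact h0
  · exact h1

theorem continuous_planeToComplex : Continuous planeToComplex := by
  have : planeToComplex = fun v => ((v 0 : ℝ) : ℂ) + ((v 1 : ℝ) : ℂ) * Complex.I := by
    funext q; exact Complex.mk_eq_add_mul_I _ _
  rw [this]; fun_prop

theorem dot2_eq_of_exp {v w : Fin 2 → ℝ} {z₁ z₂ : ℂ} (h₁ : Complex.exp z₁ = planeToComplex v)
    (h₂ : Complex.exp z₂ = planeToComplex w) :
    dot2 v w = Real.exp (z₁.re + z₂.re) * Real.cos (z₁.im - z₂.im) := by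
  have a1 := congrArg Complex.re h₁
  have a2 := congrArg Complex.im h₁
  have b1 := congrArg Complex.re h₂
  have b2 := congrArg Complex.im h₂
  simp only [planeToComplex, Complex.exp_re, Complex.exp_im] at a1 a2 b1 b2
  rw [dot2, ← a1, ← a2, ← b1, ← b2, Real.exp_add, Real.cos_sub]
  ring

theorem eq_smul_of_exp {v w : Fin 2 → ℝ} {z₁ z₂ : ℂ} (h₁ : Complex.exp z₁ = planeToComplex v)
    (h₂ : Complex.exp z₂ = planeToComplex w) {n : ℤ} (h : z₁.im - z₂.im = 2 * Real.pi * n) :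
    ∃ c : ℝ, 0 < c ∧ v = c • w := by
  have a1 := congrArg Complex.re h₁
  have a2 := congrArg Complex.im h₁
  have b1 := congrArg Complex.re h₂
  have b2 := congrArg Complex.im h₂
  simp only [planeToComplex, Complex.exp_re, Complex.exp_im] at a1 a2 b1 b2
  have him : z₁.im = z₂.im + n * (2 * Real.pi) := by linarith
  rw [him, Real.cos_add_int_mul_two_pi] at a1
  rw [him, Real.sin_add_int_mul_two_pi] at a2
  refine ⟨Real.exp (z₁.re - z₂.re), Real.exp_pos _, ?_⟩
  have he : Real.exp (z₁.re - z₂.re) * Real.exp z₂.re = Real.exp z₁.re := by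
    rw [← Real.exp_add, sub_add_cancel]
  ext i; fin_cases i
  · simp only [Fin.zero_eta, Pi.smul_apply, smul_eq_mul, ← a1, ← b1, ← mul_assoc, he]
  · simp only [Fin.mk_one, Pi.smul_apply, smul_eq_mul, ← a2, ← b2, ← mul_assoc, he]

theorem mem_Icc_of_cos_nonpos {θ : ℝ} {j : ℤ} (hc : Real.cos θ ≤ 0)
    (h : θ ∈ Ioo (0 + 2 * Real.pi * j) (0 + 2 * Real.pi * (j + 1))) :
    θ ∈ Icc (2 * Real.pi * j + Real.pi / 2) (2 * Real.pi * j + 3 * Real.pi / 2) := by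
  have hpi := Real.pi_pos
  have hc' : Real.cos (θ - j * (2 * Real.pi)) ≤ 0 := by rwa [Real.cos_sub_int_mul_two_pi]
  obtain ⟨h1, h2⟩ := h
  constructor
  · by_contra! hlt
    have := Real.cos_pos_of_mem_Ioo (x := θ - j * (2 * Real.pi)) ⟨by linarith, by linarith⟩
    linarith
  · by_contra! hlt
    have := Real.cos_pos_of_mem_Ioo (x := θ - j * (2 * Real.pi) - 2 * Real.pi)
      ⟨by linarith, by linarith⟩
    rw [Real.cos_sub_two_pi] at this
    linarith

theorem HasDerivAt.nonpos_of_left {f : ℝ → ℝ} {d T : ℝ} (h : HasDerivAt f d T)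
    (hle : ∀ᶠ t in 𝓝[<] T, f T ≤ f t) : d ≤ 0 := by
  have h1 := (hasDerivWithinAt_iff_tendsto_slope' (s := Iio T) (by simp)).1 h.hasDerivWithinAt
  refine le_of_tendsto h1 ?_
  filter_upwards [hle, self_mem_nhdsWithin] with t ht hlt
  rw [slope_def_field]
  exact div_nonpos_of_nonneg_of_nonpos (sub_nonneg.2 ht) (sub_nonpos.2 (le_of_lt hlt))

namespace IsPlaneFlow

variable {φ : ℝ → (Fin 2 → ℝ) → (Fin 2 → ℝ)}

/-- A version of Hopf's turning-angle argument. The angle `θ s` between the chord from `x` to `φ s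
x` and the chord from `φ s x` to `φ T x` never vanishes modulo `2π`, while `h1` and `h2` make its
cosine nonpositive at both ends. So `θ 0 + θ T` is at distance at least `π` from `0`. But it equals
the difference of the arguments of the velocities at `x` and `φ T x`, which `hang` bounds by less
than `π`. -/
theorem not_first_return (hφ : IsPlaneFlow φ) (hfree : ∀ x t, φ t x = x → t = 0) {a T : ℝ}
    {x : Fin 2 → ℝ} (ha : 0 < a) (haT : a < T)
    (hmono : StrictMonoOn (fun t => dot2 (φ t x) (velocity φ x)) (Icc (-a) a))
    {L : ℝ × (Fin 2 → ℝ) → ℂ} (hL : Continuous L)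
    (hexp : ∀ p, Complex.exp (L p) = planeToComplex (secant φ p.1 p.2))
    (h1 : dot2 (φ T x - x) (velocity φ x) ≤ 0) (h2 : dot2 (φ T x - x) (velocity φ (φ T x)) ≤ 0)
    (hmid : ∀ s, a ≤ s → s < T → dot2 (φ T x - x) (φ T x - x) ≤ dot2 (φ s x - x) (φ s x - x))
    (hang : |(L (0, x)).im - (L (0, φ T x)).im| < Real.pi) : False := by
  have hT : 0 < T := ha.trans haT
  set e := φ T x - x with he
  have he0 : e ≠ 0 := fun h => hT.ne' (hfree x T (sub_eq_zero.1 h))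
  have hee := dot2_self_pos he0
  let θ : ℝ → ℝ := fun s => (L (s, x)).im - (L (T - s, φ s x)).im
  have hθ : Continuous θ := by
    have : Continuous fun s => φ s x := hφ.continuous_comp continuous_id continuous_const
    fun_prop
  have hTx : secant φ T x = T⁻¹ • e := by
    rw [he, ← hφ.smul_secant, smul_smul, inv_mul_cancel₀ hT.ne', one_smul]
  have hTy : ∀ s, (T - s) • secant φ (T - s) (φ s x) = φ T x - φ s x := fun s => by
    rw [hφ.smul_secant, ← hφ.map_add, sub_add_cancel]
  -- At an interior time, a zero of `θ` modulo `2π` places `φ s x` strictly between `x` and `φ T x`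
  -- on a line. For `s < a` this contradicts `hmono` and `h1`; for `s ≥ a` it contradicts `hmid`.
  -- The end times are excluded by `h1` and `h2`.
  obtain ⟨j, hj⟩ := exists_int_forall_mem_Ioo (isPreconnected_Icc (a := (0 : ℝ)) (b := T))
    hθ.continuousOn 0 (fun s hs n hn => by
      rw [zero_add] at hn
      obtain ⟨c, hc, hvw⟩ := eq_smul_of_exp (hexp (s, x)) (hexp (T - s, φ s x)) hn
      simp only at hvw
      rcases hs.1.eq_or_lt with rfl | hs0
      · rw [sub_zero, hφ.map_zero, hφ.secant_zero, hTx] at hvw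
        have hp := dot2_self_pos (hφ.velocity_ne_zero x)
        nth_rw 1 [hvw] at hp
        have : dot2 (c • T⁻¹ • e) (velocity φ x) = c * T⁻¹ * dot2 e (velocity φ x) := by
          simp [dot2]; ring
        rw [this] at hp
        have : c * T⁻¹ * dot2 e (velocity φ x) ≤ 0 :=
          mul_nonpos_of_nonneg_of_nonpos (by positivity) h1
        linarith
      rcases hs.2.eq_or_lt with rfl | hsT
      · rw [sub_self, hφ.secant_zero, hTx] at hvw
        have hp := dot2_self_pos (hφ.velocity_ne_zero (φ s x))
        have h3 : dot2 (s⁻¹ • e) (velocity φ (φ s x)) = s⁻¹ * dot2 e (velocity φ (φ s x)) := by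
          simp [dot2]; ring
        have h4 : dot2 (c • velocity φ (φ s x)) (velocity φ (φ s x))
            = c * dot2 (velocity φ (φ s x)) (velocity φ (φ s x)) := by
          simp [dot2]; ring
        rw [hvw, h4] at h3
        have : s⁻¹ * dot2 e (velocity φ (φ s x)) ≤ 0 :=
          mul_nonpos_of_nonneg_of_nonpos (by positivity) h2
        have : 0 < c * dot2 (velocity φ (φ s x)) (velocity φ (φ s x)) := by positivity
        linarith
      have hTs : 0 < T - s := by linarith
      set c' := s * c / (T - s) with hc'
      have hc'0 : 0 < c' := by positivity
      have hseg : φ s x - x = c' • (φ T x - φ s x) := by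
        rw [← hφ.smul_secant s x, hvw, ← hTy s, smul_smul, smul_smul, hc']
        congr 1; field_simp
      have hseg2 : φ s x - x = (c' / (1 + c')) • e := by
        have h5 : (1 + c') • (φ s x - x) = c' • e := by
          rw [add_smul, one_smul]; nth_rw 1 [hseg]; rw [← smul_add, he]; congr 1; abel
        rw [div_eq_inv_mul, ← smul_smul, ← h5, smul_smul, inv_mul_cancel₀ (by positivity), one_smul]
      set κ := c' / (1 + c') with hκ
      have hκ0 : 0 < κ := by positivity
      have hκ1 : κ < 1 := by rw [hκ, div_lt_one (by positivity)]; linarith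
      rcases le_or_gt a s with has | hsa
      · have h6 := hmid s has hsT
        rw [hseg2] at h6
        have h7 : dot2 (κ • e) (κ • e) = κ ^ 2 * dot2 e e := by simp [dot2]; ring
        rw [h7] at h6
        have : κ ^ 2 < 1 := by nlinarith
        nlinarith
      · have h6 := hmono ⟨by linarith, ha.le⟩ ⟨by linarith, hsa.le⟩ hs0
        have h7 : dot2 (φ s x - x) (velocity φ x) = κ * dot2 e (velocity φ x) := by
          rw [hseg2]; simp [dot2]; ring
        have h8 : κ * dot2 e (velocity φ x) ≤ 0 := mul_nonpos_of_nonneg_of_nonpos hκ0.le h1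
        have h9 : dot2 (φ s x - x) (velocity φ x)
            = dot2 (φ s x) (velocity φ x) - dot2 (φ 0 x) (velocity φ x) := by
          rw [hφ.map_zero]; simp [dot2]; ring
        simp only at h6
        linarith)
  have hpi := Real.pi_pos
  have c0 : Real.cos (θ 0) ≤ 0 := by
    have h3 := dot2_eq_of_exp (hexp (0, x)) (hexp (T, x))
    simp only at h3
    rw [hφ.secant_zero, hTx] at h3
    have h4 : dot2 (velocity φ x) (T⁻¹ • e) = T⁻¹ * dot2 e (velocity φ x) := by
      simp [dot2]; ring
    rw [h4] at h3
    have h5 : T⁻¹ * dot2 e (velocity φ x) ≤ 0 :=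
      mul_nonpos_of_nonneg_of_nonpos (by positivity) h1
    rw [h3] at h5
    simp only [θ, sub_zero, hφ.map_zero]
    exact nonpos_of_mul_nonpos_right h5 (Real.exp_pos _)
  have cT : Real.cos (θ T) ≤ 0 := by
    have h3 := dot2_eq_of_exp (hexp (T, x)) (hexp (0, φ T x))
    simp only at h3
    rw [hφ.secant_zero, hTx] at h3
    have h4 : dot2 (T⁻¹ • e) (velocity φ (φ T x)) = T⁻¹ * dot2 e (velocity φ (φ T x)) := by
      simp [dot2]; ring
    rw [h4] at h3
    have h5 : T⁻¹ * dot2 e (velocity φ (φ T x)) ≤ 0 :=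
      mul_nonpos_of_nonneg_of_nonpos (by positivity) h2
    rw [h3] at h5
    simp only [θ, sub_self]
    exact nonpos_of_mul_nonpos_right h5 (Real.exp_pos _)
  have i0 := mem_Icc_of_cos_nonpos c0 (hj 0 ⟨le_rfl, hT.le⟩)
  have iT := mem_Icc_of_cos_nonpos cT (hj T ⟨hT.le, le_rfl⟩)
  -- The argument of the long chord `secant φ T x` enters both terms and cancels.
  have hsum : θ 0 + θ T = (L (0, x)).im - (L (0, φ T x)).im := by
    simp only [θ, sub_zero, sub_self, hφ.map_zero]; ring
  rw [← hsum] at hang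
  obtain ⟨b1, b2⟩ := abs_lt.1 hang
  obtain ⟨p1, p2⟩ := i0
  obtain ⟨q1, q2⟩ := iT
  have r1 : Real.pi * (4 * j) < Real.pi * 0 := by linarith
  have r2 : Real.pi * (-4) < Real.pi * (4 * j) := by linarith
  have r1' := lt_of_mul_lt_mul_left r1 hpi.le
  have r2' := lt_of_mul_lt_mul_left r2 hpi.le
  have s1 : 4 * j < 0 := by exact_mod_cast r1'
  have s2 : -4 < 4 * j := by exact_mod_cast r2'
  omega

theorem exists_dot2_velocity_pos (hφ : IsPlaneFlow φ) : ∃ δ > 0, ∀ x y, ‖x - y‖ ≤ δ →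
    0 < dot2 (velocity φ x) (velocity φ y) := by
  obtain ⟨V, hV, hVb⟩ := hφ.exists_velocity_bound
  obtain ⟨C, hC, hLip⟩ := exists_lipschitz_of_periodic hφ.contDiff_velocity
    (fun m => ⟨0, fun x => by rw [hφ.velocity_add, add_zero]⟩)
  obtain ⟨x₀, hx₀⟩ := exists_forall_le_of_periodic'
    (g := fun x => -dot2 (velocity φ x) (velocity φ x))
    (hφ.continuous_velocity.dot2 hφ.continuous_velocity).neg
    (fun x m => by simp only [hφ.velocity_add])
  set μ := dot2 (velocity φ x₀) (velocity φ x₀)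
  have hμ : 0 < μ := dot2_self_pos (hφ.velocity_ne_zero x₀)
  refine ⟨μ / (4 * V * C), by positivity, fun x y hxy => ?_⟩
  have h1 : dot2 (velocity φ x) (velocity φ y) = dot2 (velocity φ x) (velocity φ x)
      - dot2 (velocity φ x) (velocity φ x - velocity φ y) := by simp [dot2]; ring
  have h2 := abs_dot2_le (velocity φ x) (velocity φ x - velocity φ y)
  have h3 : 2 * ‖velocity φ x‖ * ‖velocity φ x - velocity φ y‖ ≤ 2 * V * (C * (μ / (4 * V * C))) := by
    have := hVb x
    have := (hLip x y).trans (mul_le_mul_of_nonneg_left hxy hC.le)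
    gcongr
  have h4 : 2 * V * (C * (μ / (4 * V * C))) = μ / 2 := by field_simp; ring
  have h5 := neg_le_neg_iff.1 (hx₀ x)
  have h6 := le_abs_self (dot2 (velocity φ x) (velocity φ x - velocity φ y))
  rw [h1]
  linarith

/-- In the plane the orbits of a free periodic flow do not come back close to where they were. -/
theorem exists_pos_le_norm_sub (hφ : IsPlaneFlow φ) (hfree : ∀ x t, φ t x = x → t = 0) {η : ℝ}
    (hη : 0 < η) : ∃ ε > 0, ∀ x t, η ≤ |t| → ε ≤ ‖φ t x - x‖ := by
  obtain ⟨a, ha, haη, hmono⟩ := hφ.exists_strictMonoOn hη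
  obtain ⟨δ, hδ, hδv⟩ := hφ.exists_dot2_velocity_pos
  obtain ⟨L, hL, hexp⟩ := exists_continuous_log
    (continuous_planeToComplex.comp hφ.continuous_secant)
    (fun p => planeToComplex_ne_zero (hφ.secant_ne_zero hfree p.1 p.2))
  simp only [Function.comp_apply] at hexp
  let q : ℝ → (Fin 2 → ℝ) → ℝ := fun t x => dot2 (φ t x - x) (φ t x - x)
  have hqc : Continuous fun p : ℝ × (Fin 2 → ℝ) => q p.1 p.2 :=
    (hφ.continuous.sub continuous_snd).dot2 (hφ.continuous.sub continuous_snd)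
  have hqp : ∀ t x m, q t (x + intVec m) = q t x := fun t x m => by
    simp only [q, hφ.equivariant, add_sub_add_right_eq_sub]
  obtain ⟨x₀, hx₀⟩ := exists_forall_le_of_periodic' (g := fun x => -q a x)
    (hqc.comp (continuous_const.prodMk continuous_id)).neg (fun x m => by simp only [hqp])
  have hqa : 0 < q a x₀ := dot2_self_pos fun h => ha.ne' (hfree x₀ a (sub_eq_zero.1 h))
  -- The first bound prevents a return exactly at time `a`; the second puts the endpoints of a
  -- return within `δ`, where velocities make acute angles.
  set ε := min (q a x₀ / 2) (δ ^ 2)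
  have hε : 0 < ε := lt_min (by linarith) (by positivity)
  have key : ∀ t, a ≤ t → ∀ x, ε < q t x := by
    by_contra! hcon
    obtain ⟨T₁, hT₁, x₁, hx₁⟩ := hcon
    have hcomp : IsCompact ((Icc a T₁ ×ˢ Icc (0 : Fin 2 → ℝ) 1) ∩ {p | q p.1 p.2 ≤ ε}) :=
      (isCompact_Icc.prod isCompact_Icc).inter_right (isClosed_le hqc continuous_const)
    obtain ⟨y₁, hy₁, m₁, rfl⟩ := exists_mem_Icc_add_intVec x₁
    rw [hqp] at hx₁
    -- Among all returns choose one of least duration `T`. Periodicity restricts the base point to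
    -- the unit square, so the minimum is attained.
    obtain ⟨⟨T, x⟩, ⟨⟨hTm, -⟩, hqT⟩, hmin⟩ := hcomp.exists_isMinOn
      ⟨(T₁, y₁), ⟨⟨hT₁, le_rfl⟩, hy₁⟩, hx₁⟩ (f := Prod.fst) continuous_fst.continuousOn
    simp only [mem_ofPred_eq] at hqT hTm
    have hlt : ∀ t, a ≤ t → t < T → ∀ x, ε < q t x := by
      intro t hat htT x'
      by_contra! hle
      obtain ⟨y, hy, m, rfl⟩ := exists_mem_Icc_add_intVec x'
      rw [hqp] at hle
      have : T ≤ t := hmin (a := (t, y)) ⟨⟨⟨hat, htT.le.trans hTm.2⟩, hy⟩, hle⟩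
      linarith
    have haT : a < T := by
      rcases hTm.1.eq_or_lt with h | h
      · rw [← h] at hqT
        have := hx₀ x
        linarith [min_le_left (q a x₀ / 2) (δ ^ 2)]
      · exact h
    have hyx : ‖φ T x - x‖ ≤ δ := by
      have := norm_sq_le_dot2 (φ T x - x)
      have h3 : ‖φ T x - x‖ ^ 2 ≤ δ ^ 2 := this.trans (hqT.trans (min_le_right _ _))
      exact (sq_le_sq₀ (norm_nonneg _) hδ.le).1 h3
    refine hφ.not_first_return hfree ha haT (hmono x) hL hexp ?_ ?_
      (fun s h1 h2 => hqT.trans (hlt s h1 h2 x).le) ?_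
    -- Moving the starting point forward along the orbit, with the endpoint fixed, shortens the
    -- duration. By minimality of `T` the squared distance is then larger than `ε`, and its
    -- one-sided derivative has a sign.
    · have hd : HasDerivAt (fun r => φ (-r) x) (-velocity φ x) 0 := by
        have := HasDerivAt.scomp (g₁ := fun t => φ t x) (0 : ℝ) (hφ.hasDerivAt x (-0))
          (hasDerivAt_neg (0 : ℝ))
        simpa [hφ.map_zero, Function.comp_def] using this
      have hd2 := ((hasDerivAt_const (0 : ℝ) (φ T x)).sub hd).dot2
        ((hasDerivAt_const (0 : ℝ) (φ T x)).sub hd)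
      have := hd2.nonpos_of_left (by
        have hev : ∀ᶠ r in 𝓝[<] (0 : ℝ), a - T < r :=
          nhdsWithin_le_nhds (lt_mem_nhds (by linarith))
        filter_upwards [hev, self_mem_nhdsWithin] with r hr hr0
        have h4 := hlt (T + r) (by linarith) (by linarith [mem_Iio.1 hr0]) (φ (-r) x)
        simp only [q, ← hφ.map_add, add_neg_cancel_right] at h4
        simp only [Pi.sub_apply, neg_zero, hφ.map_zero]
        exact hqT.trans h4.le)
      simp only [Pi.sub_apply, neg_zero, hφ.map_zero] at this
      have h5 : dot2 (0 - -velocity φ x) (φ T x - x) + dot2 (φ T x - x) (0 - -velocity φ x)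
        = 2 * dot2 (φ T x - x) (velocity φ x) := by simp [dot2]; ring
      rw [h5] at this
      linarith
    -- The same comparison with the starting point fixed and the endpoint moved backward.
    · have hd2 := ((hφ.hasDerivAt x T).sub_const x).dot2 ((hφ.hasDerivAt x T).sub_const x)
      have := hd2.nonpos_of_left (by
        have hev : ∀ᶠ r in 𝓝[<] T, a < r := nhdsWithin_le_nhds (lt_mem_nhds haT)
        filter_upwards [hev, self_mem_nhdsWithin] with r hr hr0
        exact hqT.trans (hlt r hr.le hr0 x).le)
      have h5 : dot2 (velocity φ (φ T x)) (φ T x - x) + dot2 (φ T x - x) (velocity φ (φ T x))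
        = 2 * dot2 (φ T x - x) (velocity φ (φ T x)) := by simp [dot2]; ring
      rw [h5] at this
      linarith
    -- The branch `L` is global, so the angle between the velocities at `x` and `y` may be followed
    -- along the straight segment instead of the orbit. On the segment it stays below `π / 2`.
    · set y := φ T x
      have hpi := Real.pi_pos
      obtain ⟨j, hj⟩ := exists_int_forall_mem_Ioo_of_cos_pos
        (isPreconnected_Icc (a := (0 : ℝ)) (b := 1))
        (θ := fun τ => (L (0, x + τ • (y - x))).im) (by fun_prop) ((L (0, x)).im) (fun τ hτ => by
          have h3 := dot2_eq_of_exp (hexp (0, x + τ • (y - x))) (hexp (0, x))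
          simp only [hφ.secant_zero] at h3
          have h4 := hδv (x + τ • (y - x)) x (by
            rw [add_sub_cancel_left, norm_smul, Real.norm_of_nonneg hτ.1]
            nlinarith [hτ.2, norm_nonneg (y - x)])
          rw [h3] at h4
          exact (pos_iff_pos_of_mul_pos h4).1 (Real.exp_pos _))
      obtain ⟨a1, a2⟩ := hj 0 ⟨le_rfl, zero_le_one⟩
      obtain ⟨b1, b2⟩ := hj 1 ⟨zero_le_one, le_rfl⟩
      simp only [zero_smul, add_zero, one_smul, add_sub_cancel] at a1 a2 b1 b2
      exact abs_lt.2 ⟨by linarith, by linarith⟩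
  have key2 : ∀ t, a ≤ t → ∀ x, Real.sqrt (ε / 2) ≤ ‖φ t x - x‖ := fun t ht x => by
    have h1 := (key t ht x).le.trans (dot2_self_le _)
    rw [← Real.sqrt_sq (norm_nonneg (φ t x - x))]
    exact Real.sqrt_le_sqrt (by linarith)
  refine ⟨Real.sqrt (ε / 2), Real.sqrt_pos.2 (by positivity), fun x t ht => ?_⟩
  rcases abs_cases t with ⟨h, -⟩ | ⟨h, -⟩
  · exact key2 t (by linarith) x
  · have := key2 (-t) (by linarith) (φ t x)
    rwa [hφ.neg_apply, norm_sub_rev] at this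

end IsPlaneFlow

/-! ### Packing of orbits in bounded regions. -/

theorem exists_eq_of_pair_injective {u s : (Fin 2 → ℝ) →L[ℝ] ℝ}
    (hinj : ∀ x y, u x = u y → s x = s y → x = y) (α β : ℝ) : ∃ v, u v = α ∧ s v = β := by
  let f : (Fin 2 → ℝ) →ₗ[ℝ] ℝ × ℝ := (u.prod s).toLinearMap
  have hf : Function.Injective f := fun x y h =>
    hinj x y (congrArg Prod.fst h) (congrArg Prod.snd h)
  have hsurj := (LinearMap.injective_iff_surjective_of_finrank_eq_finrank (f := f) (by simp)).1 hf
  obtain ⟨v, hv⟩ := hsurj (α, β)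
  exact ⟨v, congrArg Prod.fst hv, congrArg Prod.snd hv⟩

theorem exists_norm_le_of_pair_injective {u s : (Fin 2 → ℝ) →L[ℝ] ℝ}
    (hinj : ∀ x y, u x = u y → s x = s y → x = y) :
    ∃ C > 0, ∀ x e, |u x| ≤ e → |s x| ≤ e → ‖x‖ ≤ C * e := by
  obtain ⟨v, hv1, hv2⟩ := exists_eq_of_pair_injective hinj 1 0
  obtain ⟨w, hw1, hw2⟩ := exists_eq_of_pair_injective hinj 0 1
  refine ⟨‖v‖ + ‖w‖ + 1, by positivity, fun x e hu hs => ?_⟩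
  have hx : x = u x • v + s x • w := hinj _ _ (by simp [hv1, hw1]) (by simp [hv2, hw2])
  have he : 0 ≤ e := (abs_nonneg _).trans hu
  calc ‖x‖ ≤ ‖u x • v‖ + ‖s x • w‖ := by nth_rw 1 [hx]; exact norm_add_le _ _
    _ = |u x| * ‖v‖ + |s x| * ‖w‖ := by simp [norm_smul]
    _ ≤ e * ‖v‖ + e * ‖w‖ := by gcongr
    _ ≤ (‖v‖ + ‖w‖ + 1) * e := by nlinarith

theorem floor_mem_Icc_of_abs_le {y r : ℝ} (h : |y| ≤ r) : ⌊y⌋ ∈ Finset.Icc (-⌈r⌉) ⌈r⌉ := by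
  obtain ⟨h1, h2⟩ := abs_le.1 h
  rw [Finset.mem_Icc]
  constructor
  · rw [Int.le_floor]; push_cast; linarith [Int.le_ceil r]
  · exact_mod_cast (Int.floor_le y).trans (h2.trans (Int.le_ceil r))

theorem card_Icc_ceil_le {r : ℝ} (hr : 0 ≤ r) :
    ((Finset.Icc (-⌈r⌉) ⌈r⌉).card : ℝ) ≤ 2 * r + 3 := by
  have h0 : 0 ≤ ⌈r⌉ := Int.ceil_nonneg hr
  have h1 : (((Finset.Icc (-⌈r⌉) ⌈r⌉).card : ℤ) : ℝ) = ((2 * ⌈r⌉ + 1 : ℤ) : ℝ) := by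
    rw [Int.card_Icc, Int.toNat_of_nonneg (by omega)]; congr 1; ring
  rw [Int.cast_natCast] at h1
  rw [h1]; push_cast
  linarith [Int.ceil_lt_add_one r]

/-- An orbit of a free periodic flow of the plane cannot stay in a small region for long. -/
theorem IsPlaneFlow.exists_packing_bound {φ : ℝ → (Fin 2 → ℝ) → (Fin 2 → ℝ)} (hφ : IsPlaneFlow φ)
    (hfree : ∀ x t, φ t x = x → t = 0) {u s : (Fin 2 → ℝ) →L[ℝ] ℝ}
    (hinj : ∀ x y, u x = u y → s x = s y → x = y) :
    ∃ B > 0, ∀ (x : Fin 2 → ℝ) (M : ℕ) (R₁ R₂ : ℝ), 0 ≤ R₁ → 0 ≤ R₂ →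
      (∀ j : ℕ, j ≤ M → |u (φ j x) - u x| ≤ R₁) → (∀ j : ℕ, j ≤ M → |s (φ j x) - s x| ≤ R₂) →
      (M : ℝ) ≤ B * (R₁ + 1) * (R₂ + 1) := by
  obtain ⟨ε, hε, hsep⟩ := hφ.exists_pos_le_norm_sub hfree one_pos
  obtain ⟨C, hC, hCn⟩ := exists_norm_le_of_pair_injective hinj
  -- Two points in one cell of side `e` are at distance at most `ε / 2`, so different integer times
  -- occupy different cells.
  set e := ε / (2 * C) with he
  have he0 : 0 < e := by positivity
  refine ⟨(2 / e + 3) ^ 2, by positivity, fun x M R₁ R₂ hR₁ hR₂ h1 h2 => ?_⟩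
  let cell : ℕ → ℤ × ℤ := fun j => (⌊(u (φ j x) - u x) / e⌋, ⌊(s (φ j x) - s x) / e⌋)
  have hmaps : ∀ j ∈ Finset.range (M + 1), cell j ∈
      Finset.Icc (-⌈R₁ / e⌉) ⌈R₁ / e⌉ ×ˢ Finset.Icc (-⌈R₂ / e⌉) ⌈R₂ / e⌉ := fun j hj => by
    have hj' : j ≤ M := by simpa [Nat.lt_succ_iff] using hj
    rw [Finset.mem_product]
    constructor
    · apply floor_mem_Icc_of_abs_le
      rw [abs_div, abs_of_pos he0]
      exact div_le_div_of_nonneg_right (h1 j hj') he0.le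
    · apply floor_mem_Icc_of_abs_le
      rw [abs_div, abs_of_pos he0]
      exact div_le_div_of_nonneg_right (h2 j hj') he0.le
  have hinjOn : Set.InjOn cell (Finset.range (M + 1)) := fun i _ j _ hij => by
    by_contra hne
    have a1 := Int.abs_sub_lt_one_of_floor_eq_floor (congrArg Prod.fst hij)
    have a2 := Int.abs_sub_lt_one_of_floor_eq_floor (congrArg Prod.snd hij)
    rw [← sub_div, abs_div, abs_of_pos he0, div_lt_one he0, sub_sub_sub_cancel_right,
      ← map_sub] at a1 a2
    have hle := hCn (φ i x - φ j x) e a1.le a2.le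
    have heq : φ (i : ℝ) x = φ ((i : ℝ) - j) (φ j x) := by rw [← hφ.map_add, sub_add_cancel]
    have hge := hsep (φ j x) ((i : ℝ) - j) (by
      have : (1 : ℤ) ≤ |(i : ℤ) - j| := Int.one_le_abs (by omega)
      exact_mod_cast this)
    rw [← heq] at hge
    have : C * e = ε / 2 := by rw [he]; field_simp
    linarith
  have hcard := Finset.card_le_card_of_injOn cell hmaps hinjOn
  rw [Finset.card_range, Finset.card_product] at hcard
  have hcard' : (M : ℝ) + 1 ≤ (2 * (R₁ / e) + 3) * (2 * (R₂ / e) + 3) := by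
    calc (M : ℝ) + 1 ≤ (((Finset.Icc (-⌈R₁ / e⌉) ⌈R₁ / e⌉).card
          * (Finset.Icc (-⌈R₂ / e⌉) ⌈R₂ / e⌉).card : ℕ) : ℝ) := by exact_mod_cast hcard
      _ = ((Finset.Icc (-⌈R₁ / e⌉) ⌈R₁ / e⌉).card : ℝ) * (Finset.Icc (-⌈R₂ / e⌉) ⌈R₂ / e⌉).card := by
        push_cast; rfl
      _ ≤ _ := mul_le_mul (card_Icc_ceil_le (by positivity)) (card_Icc_ceil_le (by positivity))
        (by positivity) (by positivity)
  have hR : ∀ R : ℝ, 0 ≤ R → 2 * (R / e) + 3 ≤ (2 / e + 3) * (R + 1) := fun R hR => by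
    have h3 : 2 * (R / e) = 2 / e * R := by ring
    have h4 : 0 < 2 / e := by positivity
    rw [h3]; nlinarith
  calc (M : ℝ) ≤ (2 * (R₁ / e) + 3) * (2 * (R₂ / e) + 3) := by linarith
    _ ≤ ((2 / e + 3) * (R₁ + 1)) * ((2 / e + 3) * (R₂ + 1)) :=
      mul_le_mul (hR R₁ hR₁) (hR R₂ hR₂) (by positivity) (by positivity)
    _ = _ := by ring

/-! ### Hyperbolic semiconjugacies and the expansion rate. -/

/-- A flow of the plane expanded by a homeomorphism `F`, with a semiconjugacy of `F`
to a hyperbolic linear map written in eigencoordinates `u` (expanding) and `s` (contracting). -/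
structure IsHyperbolicSemiconj (φ : ℝ → (Fin 2 → ℝ) → (Fin 2 → ℝ)) (F : (Fin 2 → ℝ) ≃ₜ (Fin 2 → ℝ))
    (l μ ν : ℝ) (u s : (Fin 2 → ℝ) →L[ℝ] ℝ) (Hu Hs : (Fin 2 → ℝ) → ℝ) (K : ℝ) : Prop where
  flow : IsPlaneFlow φ
  free : ∀ x t, φ t x = x → t = 0
  one_lt : 1 < l
  conj : ∀ t x, F (φ t x) = φ (l * t) (F x)
  one_lt_mu : 1 < |μ|
  nu_pos : 0 < |ν|
  nu_lt_one : |ν| < 1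
  inj : ∀ x y, u x = u y → s x = s y → x = y
  irrational : ∀ m, s (intVec m) = 0 → m = 0
  lattice : ∀ m, ∃ m', u (intVec m') = μ * u (intVec m) ∧ s (intVec m') = ν * s (intVec m)
  continuous_Hu : Continuous Hu
  continuous_Hs : Continuous Hs
  Hu_add : ∀ x m, Hu (x + intVec m) = Hu x + u (intVec m)
  Hs_add : ∀ x m, Hs (x + intVec m) = Hs x + s (intVec m)
  abs_Hu_sub_le : ∀ x, |Hu x - u x| ≤ K
  abs_Hs_sub_le : ∀ x, |Hs x - s x| ≤ K
  Hu_map : ∀ x, Hu (F x) = μ * Hu x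
  Hs_map : ∀ x, Hs (F x) = ν * Hs x

namespace IsHyperbolicSemiconj

variable {φ : ℝ → (Fin 2 → ℝ) → (Fin 2 → ℝ)} {F : (Fin 2 → ℝ) ≃ₜ (Fin 2 → ℝ)}
  {l μ ν : ℝ} {u s : (Fin 2 → ℝ) →L[ℝ] ℝ} {Hu Hs : (Fin 2 → ℝ) → ℝ} {K : ℝ}

theorem neg_u (h : IsHyperbolicSemiconj φ F l μ ν u s Hu Hs K) :
    IsHyperbolicSemiconj φ F l μ ν (-u) s (fun x => -Hu x) Hs K where
  flow := h.flow
  free := h.free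
  one_lt := h.one_lt
  conj := h.conj
  one_lt_mu := h.one_lt_mu
  nu_pos := h.nu_pos
  nu_lt_one := h.nu_lt_one
  inj x y hu hs := h.inj x y (by simpa using hu) hs
  irrational := h.irrational
  lattice m := by
    obtain ⟨m', h1, h2⟩ := h.lattice m
    exact ⟨m', by simp [h1], h2⟩
  continuous_Hu := h.continuous_Hu.neg
  continuous_Hs := h.continuous_Hs
  Hu_add x m := by simp [h.Hu_add]; ring
  Hs_add := h.Hs_add
  abs_Hu_sub_le x := by
    have := h.abs_Hu_sub_le x
    rwa [← abs_neg, show -(Hu x - u x) = -Hu x - (-u) x by simp; ring] at this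
  abs_Hs_sub_le := h.abs_Hs_sub_le
  Hu_map x := by simp [h.Hu_map]
  Hs_map := h.Hs_map

theorem K_nonneg (h : IsHyperbolicSemiconj φ F l μ ν u s Hu Hs K) : 0 ≤ K :=
  (abs_nonneg _).trans (h.abs_Hu_sub_le 0)

theorem iterate_flow (h : IsHyperbolicSemiconj φ F l μ ν u s Hu Hs K) (n : ℕ) (t : ℝ)
    (x : Fin 2 → ℝ) : F^[n] (φ t x) = φ (l ^ n * t) (F^[n] x) := by
  induction n with
  | zero => simp
  | succ n ih => rw [Function.iterate_succ_apply', ih, h.conj, Function.iterate_succ_apply']; ring_nf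

theorem iterate_flow_div (h : IsHyperbolicSemiconj φ F l μ ν u s Hu Hs K) (n : ℕ) (t : ℝ)
    (x : Fin 2 → ℝ) : φ t (F^[n] x) = F^[n] (φ (t / l ^ n) x) := by
  have := (zero_lt_one.trans h.one_lt).ne'
  rw [h.iterate_flow, mul_div_cancel₀ _ (pow_ne_zero n this)]

theorem Hu_iterate (h : IsHyperbolicSemiconj φ F l μ ν u s Hu Hs K) (n : ℕ) (x : Fin 2 → ℝ) :
    Hu (F^[n] x) = μ ^ n * Hu x := by
  induction n with
  | zero => simp
  | succ n ih => rw [Function.iterate_succ_apply', h.Hu_map, ih]; ring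

theorem Hs_iterate (h : IsHyperbolicSemiconj φ F l μ ν u s Hu Hs K) (n : ℕ) (x : Fin 2 → ℝ) :
    Hs (F^[n] x) = ν ^ n * Hs x := by
  induction n with
  | zero => simp
  | succ n ih => rw [Function.iterate_succ_apply', h.Hs_map, ih]; ring

theorem exists_iterate_eq (n : ℕ) (x : Fin 2 → ℝ) : ∃ y, F^[n] y = x :=
  F.surjective.iterate n x

theorem exists_growth_bound (h : IsHyperbolicSemiconj φ F l μ ν u s Hu Hs K) : ∃ B > 0, ∀ t x,
    |Hu (φ t x) - Hu x| ≤ B * (|t| + 1) ∧ |Hs (φ t x) - Hs x| ≤ B * (|t| + 1) := by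
  obtain ⟨V, hV, hVb⟩ := h.flow.exists_velocity_bound
  have hK := h.K_nonneg
  have key : ∀ (w : (Fin 2 → ℝ) →L[ℝ] ℝ) (H : (Fin 2 → ℝ) → ℝ), (∀ x, |H x - w x| ≤ K) → ∀ t x,
      |H (φ t x) - H x| ≤ ‖w‖ * V * |t| + 2 * K := fun w H hH t x => by
    have h1 : ‖φ t x - x‖ ≤ V * |t| := by
      have := h.flow.norm_sub_le hVb 0 t x
      rwa [h.flow.map_zero, sub_zero] at this
    have h2 : |w (φ t x) - w x| ≤ ‖w‖ * V * |t| := by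
      rw [← map_sub, ← Real.norm_eq_abs, mul_assoc]
      exact (w.le_opNorm _).trans (mul_le_mul_of_nonneg_left h1 (norm_nonneg _))
    have h3 := abs_le.1 (hH (φ t x))
    have h4 := abs_le.1 (hH x)
    have h5 := abs_le.1 h2
    exact abs_le.2 ⟨by linarith, by linarith⟩
  refine ⟨‖u‖ * V + ‖s‖ * V + 2 * K + 1, by positivity, fun t x => ⟨?_, ?_⟩⟩
  · refine (key u Hu h.abs_Hu_sub_le t x).trans ?_
    have : 0 ≤ ‖s‖ * V := by positivity
    have : 0 ≤ ‖u‖ * V := by positivity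
    nlinarith [abs_nonneg t]
  · refine (key s Hs h.abs_Hs_sub_le t x).trans ?_
    have : 0 ≤ ‖s‖ * V := by positivity
    have : 0 ≤ ‖u‖ * V := by positivity
    nlinarith [abs_nonneg t]

/-- The arc from `x` to `φ t x` is the image under `F^[n]` of an arc of duration `t / l ^ n`. The
variation of `Hs` on the latter is bounded uniformly in `n`, and `F^[n]` multiplies it by `ν ^ n`.
-/
theorem Hs_flow (h : IsHyperbolicSemiconj φ F l μ ν u s Hu Hs K) (t : ℝ) (x : Fin 2 → ℝ) :
    Hs (φ t x) = Hs x := by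
  obtain ⟨B, hB, hb⟩ := h.exists_growth_bound
  have hle : ∀ n : ℕ, |Hs (φ t x) - Hs x| ≤ |ν| ^ n * (B * (|t| + 1)) := fun n => by
    obtain ⟨y, rfl⟩ := exists_iterate_eq (F := F) n x
    rw [h.iterate_flow_div, h.Hs_iterate, h.Hs_iterate, ← mul_sub, abs_mul, abs_pow]
    refine mul_le_mul_of_nonneg_left ((hb _ _).2.trans ?_) (by positivity)
    have h1 : 1 ≤ l ^ n := one_le_pow₀ h.one_lt.le
    have : |t / l ^ n| ≤ |t| := by
      rw [abs_div, abs_of_pos (zero_lt_one.trans_le h1)]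
      exact div_le_self (abs_nonneg t) h1
    gcongr
  have hlim : Tendsto (fun n : ℕ => |ν| ^ n * (B * (|t| + 1))) atTop (𝓝 0) := by
    have := (tendsto_pow_atTop_nhds_zero_of_lt_one (abs_nonneg ν) h.nu_lt_one).mul_const
      (B * (|t| + 1))
    rwa [zero_mul] at this
  have := ge_of_tendsto' hlim hle
  exact sub_eq_zero.1 (abs_nonpos_iff.1 this)

/-- An orbit has constant `Hs`, so it stays in a strip of bounded width in the coordinate `s`, and
the packing bound becomes linear in the spread of `Hu` alone. -/
theorem exists_packing (h : IsHyperbolicSemiconj φ F l μ ν u s Hu Hs K) : ∃ B > 0,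
    ∀ (x : Fin 2 → ℝ) (M : ℕ) (R : ℝ), 0 ≤ R → (∀ j : ℕ, j ≤ M → |Hu (φ j x) - Hu x| ≤ R) →
      (M : ℝ) ≤ B * (R + 1) := by
  obtain ⟨B, hB, hb⟩ := h.flow.exists_packing_bound h.free h.inj
  have hK := h.K_nonneg
  refine ⟨B * (2 * K + 1) * (2 * K + 1), by positivity, fun x M R hR hj => ?_⟩
  refine (hb x M (R + 2 * K) (2 * K) (by positivity) (by positivity) (fun j hjM => ?_)
    (fun j hjM => ?_)).trans ?_
  · have h1 := abs_le.1 (hj j hjM)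
    have h2 := abs_le.1 (h.abs_Hu_sub_le (φ j x))
    have h3 := abs_le.1 (h.abs_Hu_sub_le x)
    exact abs_le.2 ⟨by linarith, by linarith⟩
  · have h1 := h.Hs_flow j x
    have h2 := abs_le.1 (h.abs_Hs_sub_le (φ j x))
    have h3 := abs_le.1 (h.abs_Hs_sub_le x)
    exact abs_le.2 ⟨by linarith, by linarith⟩
  · have : R + 2 * K + 1 ≤ (2 * K + 1) * (R + 1) := by nlinarith
    calc B * (R + 2 * K + 1) * (2 * K + 1) ≤ B * ((2 * K + 1) * (R + 1)) * (2 * K + 1) := by gcongr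
      _ = _ := by ring

theorem exists_Hu_ne (h : IsHyperbolicSemiconj φ F l μ ν u s Hu Hs K) (x : Fin 2 → ℝ) :
    ∃ t, 0 < t ∧ Hu (φ t x) ≠ Hu x := by
  by_contra! hcon
  obtain ⟨B, hB, hb⟩ := h.exists_packing
  obtain ⟨M, hM⟩ := exists_nat_gt B
  have := hb x M 0 le_rfl fun j _ => by
    rcases Nat.eq_zero_or_pos j with rfl | hj
    · simp [h.flow.map_zero]
    · rw [hcon j (by exact_mod_cast hj), sub_self, abs_zero]
  linarith

theorem exists_pow_gt_mul_pow {a b C : ℝ} (ha : 1 ≤ a) (hab : a < b) : ∃ n : ℕ, C * a ^ n < b ^ n := by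
  have h0 : 0 < a := by linarith
  obtain ⟨n, hn⟩ := pow_unbounded_of_one_lt C ((one_lt_div h0).2 hab)
  refine ⟨n, ?_⟩
  rwa [div_pow, lt_div_iff₀ (by positivity)] at hn

/-- The expanding eigenvalue has modulus `l`. -/
theorem abs_mu_eq (h : IsHyperbolicSemiconj φ F l μ ν u s Hu Hs K) : |μ| = l := by
  obtain ⟨B, hB, hb⟩ := h.exists_packing
  obtain ⟨G, hG, hg⟩ := h.exists_growth_bound
  have hl : 0 < l := zero_lt_one.trans h.one_lt
  apply le_antisymm
  -- If `l < |μ|`, increments of `Hu` of order `|μ| ^ n` would outgrow the linear bound in the time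
  -- `l ^ n`.
  · by_contra! hlt
    obtain ⟨t, ht, hne⟩ := h.exists_Hu_ne 0
    have hpos : 0 < |Hu (φ t 0) - Hu 0| := abs_pos.2 (sub_ne_zero.2 hne)
    obtain ⟨n, hn⟩ := exists_pow_gt_mul_pow (C := G * (t + 1) / |Hu (φ t 0) - Hu 0|) h.one_lt.le hlt
    rw [div_mul_eq_mul_div, div_lt_iff₀ hpos] at hn
    have h1 := (hg (l ^ n * t) (F^[n] 0)).1
    rw [← h.iterate_flow, h.Hu_iterate, h.Hu_iterate, ← mul_sub, abs_mul, abs_pow, abs_of_pos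
      (by positivity : 0 < l ^ n * t)] at h1
    have h2 : l ^ n * t + 1 ≤ (t + 1) * l ^ n := by
      nlinarith [one_le_pow₀ h.one_lt.le (n := n)]
    nlinarith
  -- If `|μ| < l`, an arc of duration `l ^ n` would have `Hu`-spread of order `|μ| ^ n`, too small
  -- for the packing bound.
  · by_contra! hlt
    obtain ⟨n, hn⟩ := exists_pow_gt_mul_pow (C := B * (2 * G + 1) + 1) h.one_lt_mu.le hlt
    have h1 := hb (F^[n] 0) ⌊l ^ n⌋₊ (|μ| ^ n * (2 * G)) (by positivity) fun j hj => by
      rw [h.iterate_flow_div, h.Hu_iterate, h.Hu_iterate, ← mul_sub, abs_mul, abs_pow]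
      refine mul_le_mul_of_nonneg_left ((hg _ _).1.trans ?_) (by positivity)
      have hj' : (j : ℝ) ≤ l ^ n := (Nat.le_floor_iff (by positivity)).1 hj
      have : |(j : ℝ) / l ^ n| ≤ 1 := by
        rw [abs_of_nonneg (by positivity)]
        exact div_le_one_of_le₀ hj' (by positivity)
      nlinarith
    have h2 := Nat.lt_floor_add_one (l ^ n)
    have h3 : 1 ≤ |μ| ^ n := one_le_pow₀ h.one_lt_mu.le
    nlinarith

theorem sq_mu_eq (h : IsHyperbolicSemiconj φ F l μ ν u s Hu Hs K) : μ ^ 2 = l ^ 2 := by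
  rw [← sq_abs, h.abs_mu_eq]

theorem Hu_iterate_sub (h : IsHyperbolicSemiconj φ F l μ ν u s Hu Hs K) (n : ℕ) (t : ℝ)
    (x : Fin 2 → ℝ) : Hu (φ ((l ^ 2) ^ n * t) (F^[2 * n] x)) - Hu (F^[2 * n] x)
      = (l ^ 2) ^ n * (Hu (φ t x) - Hu x) := by
  rw [← pow_mul, ← h.iterate_flow, h.Hu_iterate, h.Hu_iterate, pow_mul, h.sq_mu_eq, ← pow_mul]
  ring

theorem Hu_sub_add (h : IsHyperbolicSemiconj φ F l μ ν u s Hu Hs K) (t : ℝ) (x : Fin 2 → ℝ)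
    (m : Fin 2 → ℤ) : Hu (φ t (x + intVec m)) - Hu (x + intVec m) = Hu (φ t x) - Hu x := by
  rw [h.flow.equivariant, h.Hu_add, h.Hu_add]; ring

/-! ### Orbits of constant speed and their separation property. -/

/-- Points whose orbit moves in the expanding direction with constant speed `a`. -/
def uniformSet (φ : ℝ → (Fin 2 → ℝ) → (Fin 2 → ℝ)) (Hu : (Fin 2 → ℝ) → ℝ) (a : ℝ) :
    Set (Fin 2 → ℝ) :=
  {x | ∀ t, Hu (φ t x) = Hu x + a * t}

/-- Since `μ ^ 2 = l ^ 2`, the map `F^[2]` multiplies durations and increments of `Hu` by the same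
`N`, so the supremum of the mean speed over all durations is a maximum over `[1, N]`. Images of a
maximizing arc under even iterates of `F` are arbitrarily long maximizing arcs, and compactness
gives a whole orbit. -/
theorem exists_mem_uniformSet_of_pos (h : IsHyperbolicSemiconj φ F l μ ν u s Hu Hs K)
    {x₁ : Fin 2 → ℝ} {t₁ : ℝ} (ht₁ : 0 < t₁) (hpos : 0 < Hu (φ t₁ x₁) - Hu x₁) :
    ∃ a > 0, (uniformSet φ Hu a).Nonempty := by
  set N := l ^ 2 with hN
  have hN1 : 1 < N := one_lt_pow₀ h.one_lt two_ne_zero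
  have hN0 : 0 < N := by linarith
  have hgc : Continuous fun p : ℝ × (Fin 2 → ℝ) => Hu (φ p.1 p.2) - Hu p.2 :=
    (h.continuous_Hu.comp h.flow.continuous).sub (h.continuous_Hu.comp continuous_snd)
  obtain ⟨t₀, ht₀, x₀, hmax⟩ := exists_forall_le_of_periodic (isCompact_Icc (a := 1) (b := N))
    (nonempty_Icc.2 hN1.le) (g := fun t x => (Hu (φ t x) - Hu x) / t)
    (hgc.continuousOn.div continuous_fst.continuousOn fun p hp =>
      (zero_lt_one.trans_le hp.1.1).ne')
    (fun t x m => by simp only [h.Hu_sub_add])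
  have ht₀0 : 0 < t₀ := zero_lt_one.trans_le ht₀.1
  set a := (Hu (φ t₀ x₀) - Hu x₀) / t₀ with ha
  have hle1 : ∀ t ∈ Icc 1 N, ∀ x, Hu (φ t x) - Hu x ≤ a * t := fun t ht x => by
    have := hmax t ht x
    rwa [div_le_iff₀ (zero_lt_one.trans_le ht.1)] at this
  have hle : ∀ t, 0 < t → ∀ x, Hu (φ t x) - Hu x ≤ a * t := by
    intro t ht x
    obtain ⟨n, hn⟩ := exists_mem_Ico_zpow ht hN1
    obtain ⟨k, rfl | rfl⟩ := n.eq_nat_or_neg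
    · obtain ⟨y, rfl⟩ := exists_iterate_eq (F := F) (2 * k) x
      rw [zpow_natCast, zpow_add₀ hN0.ne', zpow_natCast, zpow_one] at hn
      have h1 := h.Hu_iterate_sub k (t / N ^ k) y
      rw [← hN, mul_div_cancel₀ _ (by positivity)] at h1
      have h2 := hle1 (t / N ^ k) ⟨(one_le_div (by positivity)).2 hn.1,
        (div_le_iff₀ (by positivity)).2 (by linarith [hn.2])⟩ y
      rw [h1]
      calc N ^ k * (Hu (φ (t / N ^ k) y) - Hu y) ≤ N ^ k * (a * (t / N ^ k)) := by gcongr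
        _ = a * t := by field_simp
    · rw [zpow_add₀ hN0.ne', zpow_neg, zpow_natCast, zpow_one] at hn
      have h1 := h.Hu_iterate_sub k t x
      have h2 := hle1 (N ^ k * t) ⟨by
        have := hn.1; rwa [inv_le_iff_one_le_mul₀' (by positivity)] at this, by
        have := hn.2.le
        rwa [← div_eq_inv_mul, le_div_iff₀ (by positivity), mul_comm] at this⟩ (F^[2 * k] x)
      rw [h1, ← hN] at h2
      have h3 : N ^ k * (Hu (φ t x) - Hu x) ≤ N ^ k * (a * t) := by linarith
      exact le_of_mul_le_mul_left h3 (by positivity)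
  have ha0 : 0 < a := by
    by_contra! hneg
    have := hle t₁ ht₁ x₁
    nlinarith
  refine ⟨a, ha0, ?_⟩
  let S : ℕ → Set (Fin 2 → ℝ) := fun n =>
    Icc 0 1 ∩ {x | ∀ t : ℝ, |t| ≤ n → Hu (φ t x) = Hu x + a * t}
  have hclosed : ∀ n, IsClosed {x | ∀ t : ℝ, |t| ≤ (n : ℕ) → Hu (φ t x) = Hu x + a * t} := fun n => by
    simp only [ofPred_forall]
    refine isClosed_iInter fun t => isClosed_iInter fun _ => isClosed_eq ?_ ?_
    · exact h.continuous_Hu.comp (h.flow.continuous_comp continuous_const continuous_id)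
    · exact h.continuous_Hu.add continuous_const
  have hne : ∀ n, (S n).Nonempty := fun n => by
    obtain ⟨k, hk⟩ := pow_unbounded_of_one_lt (2 * n : ℝ) hN1
    set T := N ^ k * t₀ with hT
    have hTn : 2 * n ≤ T := by nlinarith [ht₀.1, pow_pos hN0 k]
    have hT0 : 0 < T := by positivity
    set x' := F^[2 * k] x₀ with hx'
    have hTx : Hu (φ T x') - Hu x' = a * T := by
      rw [hx', hT, h.Hu_iterate_sub, ← hN, ha]; field_simp
    -- Splitting a maximizing arc at `r` gives two increments, each at most `a` times its duration,
    -- whose sum is `a * T`. Both are therefore equalities.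
    have hlin : ∀ r, 0 ≤ r → r ≤ T → Hu (φ r x') = Hu x' + a * r := by
      intro r hr hrT
      rcases hr.eq_or_lt with rfl | hr0
      · rw [h.flow.map_zero]; ring
      rcases hrT.eq_or_lt with rfl | hrT'
      · linarith
      have h1 := hle r hr0 x'
      have h2 := hle (T - r) (by linarith) (φ r x')
      rw [← h.flow.map_add, sub_add_cancel] at h2
      linarith
    -- Recentre at the midpoint: since `2 * n ≤ T`, the window `|t| ≤ n` stays inside the maximizing
    -- arc.
    obtain ⟨y, hy, m, hm⟩ := exists_mem_Icc_add_intVec (φ (T / 2) x')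
    refine ⟨y, hy, fun t ht => ?_⟩
    have h3 := h.Hu_sub_add t y m
    obtain ⟨ht1, ht2⟩ := abs_le.1 ht
    rw [← hm, ← h.flow.map_add, hlin _ (by linarith) (by linarith),
      hlin _ (by linarith) (by linarith)] at h3
    linarith
  obtain ⟨p, hp⟩ := IsCompact.nonempty_iInter_of_sequence_nonempty_isCompact_isClosed S
    (fun n => inter_subset_inter_right _ fun x hx t ht => hx t (ht.trans (by push_cast; linarith)))
    hne (isCompact_Icc.inter_right (hclosed 0)) (fun n => isClosed_Icc.inter (hclosed n))
  refine ⟨p, fun t => ?_⟩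
  obtain ⟨n, hn⟩ := exists_nat_ge |t|
  exact (mem_iInter.1 hp n).2 t hn

theorem exists_mem_uniformSet (h : IsHyperbolicSemiconj φ F l μ ν u s Hu Hs K) :
    ∃ a ≠ 0, (uniformSet φ Hu a).Nonempty := by
  obtain ⟨t, ht, hne⟩ := h.exists_Hu_ne 0
  rcases lt_or_gt_of_ne hne with hlt | hgt
  · obtain ⟨a, ha, p, hp⟩ := h.neg_u.exists_mem_uniformSet_of_pos ht (x₁ := 0) (by linarith)
    exact ⟨-a, (neg_neg_of_pos ha).ne, p, fun t => by linarith [hp t]⟩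
  · obtain ⟨a, ha, hp⟩ := h.exists_mem_uniformSet_of_pos ht (sub_pos.2 hgt)
    exact ⟨a, ha.ne', hp⟩

theorem isClosed_uniformSet (h : IsHyperbolicSemiconj φ F l μ ν u s Hu Hs K) (a : ℝ) :
    IsClosed (uniformSet φ Hu a) := by
  simp only [uniformSet, ofPred_forall]
  refine isClosed_iInter fun t => isClosed_eq ?_ ?_
  · exact h.continuous_Hu.comp (h.flow.continuous_comp continuous_const continuous_id)
  · exact h.continuous_Hu.add continuous_const

theorem add_mem_uniformSet (h : IsHyperbolicSemiconj φ F l μ ν u s Hu Hs K) {a : ℝ}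
    {p : Fin 2 → ℝ} (hp : p ∈ uniformSet φ Hu a) (m : Fin 2 → ℤ) :
    p + intVec m ∈ uniformSet φ Hu a := fun t => by
  have := h.Hu_sub_add t p m
  linarith [hp t]

theorem flow_mem_uniformSet (h : IsHyperbolicSemiconj φ F l μ ν u s Hu Hs K) {a : ℝ}
    {p : Fin 2 → ℝ} (hp : p ∈ uniformSet φ Hu a) (r : ℝ) :
    φ r p ∈ uniformSet φ Hu a := fun t => by
  rw [← h.flow.map_add, hp, hp]; ring

/-- An orbit of constant speed separates the points with larger from those with
smaller contracting coordinate. -/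
theorem exists_flow_eq_of_lt (h : IsHyperbolicSemiconj φ F l μ ν u s Hu Hs K) {a : ℝ} (ha : a ≠ 0)
    {p : Fin 2 → ℝ} (hp : p ∈ uniformSet φ Hu a) {C : ℝ → Fin 2 → ℝ} (hC : Continuous C)
    (h0 : Hs (C 0) < Hs p) (h1 : Hs p < Hs (C 1)) : ∃ t, ∃ τ ∈ Icc (0 : ℝ) 1, φ t p = C τ := by
  have hK := h.K_nonneg
  set δ := min (Hs p - Hs (C 0)) (Hs (C 1) - Hs p)
  have hδ : 0 < δ := lt_min (by linarith) (by linarith)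
  have hν : ν ≠ 0 := abs_pos.1 h.nu_pos
  have hμ : μ ≠ 0 := abs_pos.1 (zero_lt_one.trans h.one_lt_mu)
  -- Pulling back by `F^[2 * n]` enlarges the gaps in `Hs` beyond `2 * K`, so that they become gaps
  -- in the linear coordinate `s`, as `exists_crossing` requires. Even iterates keep the orientation
  -- of both coordinates.
  obtain ⟨n, hn⟩ : ∃ n : ℕ, (ν ^ 2) ^ n * (2 * K) < δ := by
    have hlim := (tendsto_pow_atTop_nhds_zero_of_lt_one (sq_nonneg ν)
      (by rw [← sq_abs]; exact pow_lt_one₀ (abs_nonneg _) h.nu_lt_one two_ne_zero)).mul_const (2 * K)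
    rw [zero_mul] at hlim
    exact (hlim.eventually (gt_mem_nhds hδ)).exists
  set N := (ν ^ 2) ^ n with hN
  have hN0 : 0 < N := by positivity
  set M := (μ ^ 2) ^ n with hM
  have hM0 : 0 < M := by positivity
  let B : (Fin 2 → ℝ) → (Fin 2 → ℝ) := F.symm^[2 * n]
  have hB : Continuous B := F.symm.continuous.iterate _
  have hFB : ∀ x, F^[2 * n] (B x) = x := (Function.RightInverse.iterate F.apply_symm_apply (2 * n))
  have hBs : ∀ x, N * Hs (B x) = Hs x := fun x => by
    rw [hN, ← pow_mul, ← h.Hs_iterate, hFB]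
  have hBu : ∀ x, M * Hu (B x) = Hu x := fun x => by
    rw [hM, ← pow_mul, ← h.Hu_iterate, hFB]
  have hgap : ∀ x y, δ ≤ Hs y - Hs x → s (B x) < s (B y) := fun x y hxy => by
    have e1 : N * (2 * K) < N * (Hs (B y) - Hs (B x)) := by
      rw [mul_sub, hBs, hBs]; linarith
    have e2 := lt_of_mul_lt_mul_left e1 hN0.le
    have e3 := abs_le.1 (h.abs_Hs_sub_le (B x))
    have e4 := abs_le.1 (h.abs_Hs_sub_le (B y))
    linarith
  have hline : ∀ t, Hu (B (φ (t / a) p)) = M⁻¹ * (Hu p + t) := fun t => by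
    rw [eq_inv_mul_iff_mul_eq₀ hM0.ne', hBu, hp, mul_div_cancel₀ _ ha]
  have hlb : ∀ t, M⁻¹ * (Hu p + t) - K ≤ u (B (φ (t / a) p)) := fun t => by
    have := abs_le.1 (h.abs_Hu_sub_le (B (φ (t / a) p)))
    rw [hline] at this; linarith
  have hub : ∀ t, u (B (φ (t / a) p)) ≤ M⁻¹ * (Hu p + t) + K := fun t => by
    have := abs_le.1 (h.abs_Hu_sub_le (B (φ (t / a) p)))
    rw [hline] at this; linarith
  obtain ⟨t, τ, hτ, heq⟩ := exists_crossing u.continuous s.continuous h.inj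
    (P := fun t => B (φ (t / a) p)) (C := fun τ => B (C τ))
    (hB.comp (h.flow.continuous_comp (by fun_prop) continuous_const)) (hB.comp hC)
    (fun t => hgap _ _ (by rw [h.Hs_flow]; exact min_le_left _ _))
    (fun t => hgap _ _ (by rw [h.Hs_flow]; exact min_le_right _ _))
    (tendsto_atTop_mono hlb (tendsto_atTop_add_const_right _ _
      ((tendsto_atTop_add_const_left _ _ tendsto_id).const_mul_atTop (inv_pos.2 hM0))))
    (tendsto_atBot_mono hub (tendsto_atBot_add_const_right _ _
      ((tendsto_atBot_add_const_left _ _ tendsto_id).const_mul_atBot (inv_pos.2 hM0))))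
  refine ⟨t / a, τ, hτ, ?_⟩
  have := congrArg F^[2 * n] heq
  rwa [hFB, hFB] at this

end IsHyperbolicSemiconj

/-! ### Lattice translates of constant-speed orbits. -/

theorem intVec_zsmul (n : ℤ) (m : Fin 2 → ℤ) : intVec (n • m) = (n : ℝ) • intVec m := by
  ext i; simp [intVec]

namespace IsHyperbolicSemiconj

variable {φ : ℝ → (Fin 2 → ℝ) → (Fin 2 → ℝ)} {F : (Fin 2 → ℝ) ≃ₜ (Fin 2 → ℝ)}
  {l μ ν : ℝ} {u s : (Fin 2 → ℝ) →L[ℝ] ℝ} {Hu Hs : (Fin 2 → ℝ) → ℝ} {K : ℝ}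

theorem lattice_iterate (h : IsHyperbolicSemiconj φ F l μ ν u s Hu Hs K) (n : ℕ) (m : Fin 2 → ℤ) :
    ∃ m', u (intVec m') = μ ^ n * u (intVec m) ∧ s (intVec m') = ν ^ n * s (intVec m) := by
  induction n with
  | zero => exact ⟨m, by simp, by simp⟩
  | succ n ih =>
    obtain ⟨m₁, h1, h2⟩ := ih
    obtain ⟨m₂, h3, h4⟩ := h.lattice m₁
    exact ⟨m₂, by rw [h3, h1]; ring, by rw [h4, h2]; ring⟩

theorem exists_lattice_cone (h : IsHyperbolicSemiconj φ F l μ ν u s Hu Hs K) {σ₁ σ₂ : ℝ}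
    (h1 : σ₁ ≠ 0) (h2 : σ₂ ≠ 0) :
    ∃ m, 0 < σ₁ * u (intVec m) ∧ 0 < σ₂ * s (intVec m) := by
  set R := ‖u‖ / |σ₁| + ‖s‖ / |σ₂| + 1 with hR
  have p1 : 0 < |σ₁| := abs_pos.2 h1
  have p2 : 0 < |σ₂| := abs_pos.2 h2
  obtain ⟨v, hv1, hv2⟩ := exists_eq_of_pair_injective h.inj (σ₁ * R) (σ₂ * R)
  have hm : ‖intVec (fun i => ⌊v i⌋) - v‖ ≤ 1 := by
    refine (pi_norm_le_iff_of_nonneg zero_le_one).2 fun i => ?_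
    rw [Pi.sub_apply, intVec, norm_sub_rev, Real.norm_eq_abs, ← Int.fract,
      abs_of_nonneg (Int.fract_nonneg _)]
    exact (Int.fract_lt_one _).le
  have key : ∀ (w : (Fin 2 → ℝ) →L[ℝ] ℝ) (σ : ℝ), 0 < |σ| → w v = σ * R → ‖w‖ / |σ| + 1 ≤ R →
      0 < σ * w (intVec fun i => ⌊v i⌋) := fun w σ hσ hwv hwR => by
    have e1 : |w (intVec fun i => ⌊v i⌋) - w v| ≤ ‖w‖ := by
      rw [← map_sub, ← Real.norm_eq_abs]
      exact (w.le_opNorm _).trans (mul_le_of_le_one_right (norm_nonneg _) hm)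
    have e2 : |σ * (w (intVec fun i => ⌊v i⌋) - w v)| ≤ |σ| * ‖w‖ := by
      rw [abs_mul]; gcongr
    have e3 := (abs_le.1 e2).1
    have e4 : |σ| ^ 2 * (‖w‖ / |σ| + 1) ≤ |σ| ^ 2 * R := by gcongr
    have e5 : |σ| ^ 2 * (‖w‖ / |σ| + 1) = |σ| * ‖w‖ + |σ| ^ 2 := by field_simp
    have e6 : 0 < |σ| ^ 2 := by positivity
    rw [mul_sub, hwv] at e3
    rw [e5] at e4
    rw [sq_abs] at e4 e6
    nlinarith
  have : 0 ≤ ‖u‖ / |σ₁| := by positivity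
  have : 0 ≤ ‖s‖ / |σ₂| := by positivity
  exact ⟨_, key u σ₁ p1 hv1 (by linarith), key s σ₂ p2 hv2 (by linarith)⟩

/-- Start from a lattice vector in the prescribed open quadrant and apply the hyperbolic matrix an
even number of times: `u` is stretched, `s` shrinks, and the signs persist. -/
theorem exists_lattice_thin (h : IsHyperbolicSemiconj φ F l μ ν u s Hu Hs K) {σ₁ σ₂ : ℝ}
    (h1 : σ₁ ≠ 0) (h2 : σ₂ ≠ 0) (R : ℝ) {ε : ℝ} (hε : 0 < ε) :
    ∃ m, R < σ₁ * u (intVec m) ∧ 0 < σ₂ * s (intVec m) ∧ σ₂ * s (intVec m) < ε := by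
  obtain ⟨m, hm1, hm2⟩ := h.exists_lattice_cone h1 h2
  have l1 : Tendsto (fun n : ℕ => (μ ^ 2) ^ n * (σ₁ * u (intVec m))) atTop atTop :=
    (tendsto_pow_atTop_atTop_of_one_lt (by
      rw [← sq_abs]; exact one_lt_pow₀ h.one_lt_mu two_ne_zero)).atTop_mul_const hm1
  have l2 : Tendsto (fun n : ℕ => (ν ^ 2) ^ n * (σ₂ * s (intVec m))) atTop (𝓝 0) := by
    have := (tendsto_pow_atTop_nhds_zero_of_lt_one (sq_nonneg ν)
      (by rw [← sq_abs]; exact pow_lt_one₀ (abs_nonneg _) h.nu_lt_one two_ne_zero)).mul_const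
      (σ₂ * s (intVec m))
    rwa [zero_mul] at this
  obtain ⟨n, hn1, hn2⟩ := ((l1.eventually (eventually_gt_atTop R)).and
    (l2.eventually (gt_mem_nhds hε))).exists
  obtain ⟨m', e1, e2⟩ := h.lattice_iterate (2 * n) m
  have hν : ν ≠ 0 := abs_pos.1 h.nu_pos
  rw [pow_mul] at e1 e2
  have f1 : σ₁ * u (intVec m') = (μ ^ 2) ^ n * (σ₁ * u (intVec m)) := by rw [e1]; ring
  have f2 : σ₂ * s (intVec m') = (ν ^ 2) ^ n * (σ₂ * s (intVec m)) := by rw [e2]; ring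
  exact ⟨m', by rwa [f1], by rw [f2]; positivity, by rwa [f2]⟩

/-- Multiples of a lattice vector whose `s`-coordinate is positive and below `β - α` step through
the line without jumping over the interval. -/
theorem exists_lattice_between (h : IsHyperbolicSemiconj φ F l μ ν u s Hu Hs K) {α β : ℝ}
    (hαβ : α < β) : ∃ m, α < s (intVec m) ∧ s (intVec m) < β := by
  obtain ⟨m, -, h1, h2⟩ := h.exists_lattice_thin one_ne_zero one_ne_zero 0 (sub_pos.2 hαβ)
  rw [one_mul] at h1 h2
  refine ⟨(⌊α / s (intVec m)⌋ + 1) • m, ?_, ?_⟩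
  · rw [intVec_zsmul, map_smul, smul_eq_mul]
    have := Int.lt_floor_add_one (α / s (intVec m))
    rw [div_lt_iff₀ h1] at this
    push_cast; linarith
  · rw [intVec_zsmul, map_smul, smul_eq_mul]
    have := Int.floor_le (α / s (intVec m))
    rw [le_div_iff₀ h1] at this
    push_cast; linarith

theorem exists_flow_mem_segment (h : IsHyperbolicSemiconj φ F l μ ν u s Hu Hs K) {a : ℝ}
    (ha : a ≠ 0) {p x y : Fin 2 → ℝ} (hp : p ∈ uniformSet φ Hu a) {m : Fin 2 → ℤ}
    (h1 : Hs x < Hs p + s (intVec m)) (h2 : Hs p + s (intVec m) < Hs y) :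
    ∃ t, φ t p + intVec m ∈ segment ℝ x y := by
  rw [← h.Hs_add] at h1 h2
  obtain ⟨t, τ, hτ, heq⟩ := h.exists_flow_eq_of_lt ha (h.add_mem_uniformSet hp m)
    (C := fun τ => AffineMap.lineMap x y τ) AffineMap.lineMap_continuous (by simpa using h1)
    (by simpa using h2)
  refine ⟨t, ?_⟩
  rw [← h.flow.equivariant, heq, segment_eq_image_lineMap]
  exact mem_image_of_mem _ hτ

/-- A point near which `Hs` takes other values moves with constant speed. -/
theorem mem_uniformSet_of_forall_exists (h : IsHyperbolicSemiconj φ F l μ ν u s Hu Hs K) {a : ℝ}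
    (ha : a ≠ 0) (hne : (uniformSet φ Hu a).Nonempty) {x : Fin 2 → ℝ}
    (hx : ∀ ε > 0, ∃ y ∈ Metric.ball x ε, Hs y ≠ Hs x) : x ∈ uniformSet φ Hu a := by
  obtain ⟨p, hp⟩ := hne
  rw [← (h.isClosed_uniformSet a).closure_eq]
  refine Metric.mem_closure_iff.2 fun ε hε => ?_
  obtain ⟨y, hy, hxy⟩ := hx ε hε
  -- The levels `Hs p + s (intVec m)` are dense, so some translate of the orbit of `p` has its level
  -- strictly between those of `x` and `y` and must meet the segment.
  obtain ⟨t, m, hseg⟩ : ∃ t m, φ t p + intVec m ∈ segment ℝ x y := by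
    rcases lt_or_gt_of_ne hxy with hlt | hlt
    · obtain ⟨m, h1, h2⟩ := h.exists_lattice_between (sub_lt_sub_right hlt (Hs p))
      obtain ⟨t, ht⟩ := h.exists_flow_mem_segment ha hp (x := y) (y := x) (m := m)
        (by linarith) (by linarith)
      exact ⟨t, m, by rwa [segment_symm]⟩
    · obtain ⟨m, h1, h2⟩ := h.exists_lattice_between (sub_lt_sub_right hlt (Hs p))
      obtain ⟨t, ht⟩ := h.exists_flow_mem_segment ha hp (x := x) (y := y) (m := m)
        (by linarith) (by linarith)
      exact ⟨t, m, ht⟩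
  refine ⟨_, h.add_mem_uniformSet (h.flow_mem_uniformSet hp t) m, ?_⟩
  have := (convex_ball x ε).segment_subset (Metric.mem_ball_self hε) hy hseg
  rwa [Metric.mem_ball, dist_comm] at this

theorem exists_Hs_lt (h : IsHyperbolicSemiconj φ F l μ ν u s Hu Hs K) (c : ℝ) :
    ∃ x, c < Hs x := by
  obtain ⟨v, -, hv⟩ := exists_eq_of_pair_injective h.inj 0 (c + K + 1)
  have := abs_le.1 (h.abs_Hs_sub_le v)
  exact ⟨v, by linarith⟩

theorem exists_Hs_gt (h : IsHyperbolicSemiconj φ F l μ ν u s Hu Hs K) (c : ℝ) :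
    ∃ x, Hs x < c := by
  obtain ⟨v, -, hv⟩ := exists_eq_of_pair_injective h.inj 0 (c - K - 1)
  have := abs_le.1 (h.abs_Hs_sub_le v)
  exact ⟨v, by linarith⟩

/-! ### Bijectivity when the level sets have empty interior. -/

theorem isClosed_orbit (h : IsHyperbolicSemiconj φ F l μ ν u s Hu Hs K) {a : ℝ} (ha : a ≠ 0)
    {x : Fin 2 → ℝ} (hx : x ∈ uniformSet φ Hu a) : IsClosed (range fun t => φ t x) := by
  have : range (fun t => φ t x) = {z | φ ((Hu z - Hu x) / a) x = z} := by
    ext z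
    constructor
    · rintro ⟨t, rfl⟩
      simp only [mem_ofPred_eq, hx t, add_sub_cancel_left, mul_div_cancel_left₀ t ha]
    · intro hz
      exact ⟨_, hz⟩
  rw [this]
  refine isClosed_eq (h.flow.continuous_comp ?_ continuous_const) continuous_id
  exact (h.continuous_Hu.sub continuous_const).div_const a

/-- `Hs` has no local maxima when its level sets have empty interior. -/
theorem exists_mem_ball_Hs_lt (h : IsHyperbolicSemiconj φ F l μ ν u s Hu Hs K) {a : ℝ} (ha : a ≠ 0)
    (hint : ∀ c, interior {x | Hs x = c} = ∅)
    {x : Fin 2 → ℝ} (hx : x ∈ uniformSet φ Hu a) {ε : ℝ} (hε : 0 < ε) :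
    ∃ y ∈ Metric.ball x ε, Hs x < Hs y := by
  set O := range fun t => φ t x with hO
  have hOc : IsClosed O := h.isClosed_orbit ha hx
  have hOflow : ∀ r z, z ∈ Oᶜ → φ r z ∈ Oᶜ := by
    rintro r z hz ⟨t, ht⟩
    refine hz ⟨-r + t, ?_⟩
    simp only at ht ⊢
    rw [h.flow.map_add, ht, h.flow.neg_apply]
  -- `Z` is the upper side of the orbit `O`. A path that avoids `O` cannot pass from below the level
  -- of `x` to above it, so `Hs` is at least `Hs x` on `Z`.
  let Z : Set (Fin 2 → ℝ) := {z | ∃ w, Hs x < Hs w ∧ JoinedIn Oᶜ z w}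
  have hZge : ∀ z ∈ Z, Hs x ≤ Hs z := by
    rintro z ⟨w, hw, γ, hγ⟩
    by_contra! hlt
    obtain ⟨t, τ, hτ, heq⟩ := h.exists_flow_eq_of_lt ha hx (C := γ.extend) γ.continuous_extend
      (by simpa using hlt) (by simpa using hw)
    rw [γ.extend_apply hτ] at heq
    exact hγ ⟨τ, hτ⟩ ⟨t, heq⟩
  have hnear : ∀ z ∈ Oᶜ, ∃ δ > 0, Metric.ball z δ ⊆ Oᶜ ∧ ∀ w ∈ Metric.ball z δ, JoinedIn Oᶜ z w := by
    intro z hz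
    obtain ⟨δ, hδ, hsub⟩ := Metric.isOpen_iff.1 hOc.isOpen_compl z hz
    exact ⟨δ, hδ, hsub, fun w hw => ((convex_ball z δ).isPathConnected
      ⟨z, Metric.mem_ball_self hδ⟩ |>.joinedIn z (Metric.mem_ball_self hδ) w hw).mono hsub⟩
  have hZopen : IsOpen Z := by
    rw [Metric.isOpen_iff]
    rintro z ⟨w, hw, hj⟩
    obtain ⟨δ, hδ, -, hδj⟩ := hnear z hj.source_mem
    exact ⟨δ, hδ, fun z' hz' => ⟨w, hw, (hδj z' hz').symm.trans hj⟩⟩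
  have hZcl : ∀ z ∈ closure Z, z ∈ Oᶜ → z ∈ Z := by
    intro z hz hzO
    obtain ⟨δ, hδ, -, hδj⟩ := hnear z hzO
    obtain ⟨z', ⟨w, hw, hj⟩, hz'⟩ := Metric.mem_closure_iff.1 hz δ hδ
    exact ⟨w, hw, (hδj z' (by rwa [Metric.mem_ball, dist_comm])).trans hj⟩
  have hZflow : ∀ r z, z ∈ Z → φ r z ∈ Z := by
    rintro r z ⟨w, hw, γ, hγ⟩
    have hc : Continuous (φ r) := h.flow.continuous_comp continuous_const continuous_id
    exact ⟨φ r w, by rwa [h.Hs_flow], γ.map hc, fun t => hOflow r _ (hγ t)⟩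
  -- `Z` is open, contains points of high level and none of low level, so it is not closed. Its new
  -- limit points lie on `O`, and invariance under the flow moves such a point to `x`.
  obtain ⟨z₀, hz₀, hz₀'⟩ : ∃ z ∈ closure Z, z ∉ Z := by
    by_contra! hcon
    have hclosed : IsClosed Z := closure_subset_iff_isClosed.1 hcon
    obtain ⟨w, hw⟩ := h.exists_Hs_lt (Hs x)
    have hwO : w ∈ Oᶜ := by
      rintro ⟨t, rfl⟩
      simp only [h.Hs_flow, lt_irrefl] at hw
    have huniv := IsClopen.eq_univ ⟨hclosed, hZopen⟩ ⟨w, w, hw, JoinedIn.refl hwO⟩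
    obtain ⟨w', hw'⟩ := h.exists_Hs_gt (Hs x)
    have := hZge w' (huniv ▸ mem_univ _)
    linarith
  have hz₀O : z₀ ∈ O := by
    by_contra hn
    exact hz₀' (hZcl z₀ hz₀ hn)
  obtain ⟨t₀, rfl⟩ := hz₀O
  have hxcl : x ∈ closure Z := by
    have hc : Continuous (φ (-t₀)) := h.flow.continuous_comp continuous_const continuous_id
    have := map_mem_closure hc hz₀ (fun z hz => hZflow (-t₀) z hz)
    simpa only [h.flow.neg_apply] using this
  by_contra! hcon
  obtain ⟨z, hzZ, hz⟩ := Metric.mem_closure_iff.1 hxcl ε hε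
  have hsub : Z ∩ Metric.ball x ε ⊆ interior {y | Hs y = Hs x} :=
    interior_maximal (fun y hy => le_antisymm (hcon y hy.2) (hZge y hy.1))
      (hZopen.inter Metric.isOpen_ball)
  rw [hint] at hsub
  exact hsub ⟨hzZ, by rwa [Metric.mem_ball, dist_comm]⟩

/-- Slightly above their common level, one lattice translate of the orbit of `x` passes arbitrarily
close to both `x` and `y`. The nearby points on it differ by the time `(Hu x' - Hu y') / a`, which
tends to `0` since `Hu x = Hu y`. -/
theorem pair_injective (h : IsHyperbolicSemiconj φ F l μ ν u s Hu Hs K) {a : ℝ} (ha : a ≠ 0)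
    (hint : ∀ c, interior {x | Hs x = c} = ∅) (huni : ∀ x, x ∈ uniformSet φ Hu a)
    {x y : Fin 2 → ℝ} (hu : Hu x = Hu y) (hs : Hs x = Hs y) : x = y := by
  have key : ∀ n : ℕ, ∃ x' y', dist x x' < 1 / ((n : ℝ) + 1) ∧ dist y y' < 1 / ((n : ℝ) + 1) ∧
      x' = φ ((Hu x' - Hu y') / a) y' := by
    intro n
    have hn : 0 < 1 / ((n : ℝ) + 1) := by positivity
    obtain ⟨x₁, hx₁, hx₁'⟩ := h.exists_mem_ball_Hs_lt ha hint (huni x) hn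
    obtain ⟨y₁, hy₁, hy₁'⟩ := h.exists_mem_ball_Hs_lt ha hint (huni y) hn
    rw [← hs] at hy₁'
    obtain ⟨m, h1, h2⟩ := h.exists_lattice_between
      (sub_lt_sub_right (lt_min hx₁' hy₁') (Hs x))
    have h3 := min_le_left (Hs x₁) (Hs y₁)
    have h4 := min_le_right (Hs x₁) (Hs y₁)
    obtain ⟨t, ht⟩ := h.exists_flow_mem_segment ha (huni x) (x := x) (y := x₁) (m := m)
      (by linarith) (by linarith)
    obtain ⟨t', ht'⟩ := h.exists_flow_mem_segment ha (huni x) (x := y) (y := y₁) (m := m)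
      (by linarith) (by linarith)
    have hb := (convex_ball x _).segment_subset (Metric.mem_ball_self hn) hx₁ ht
    have hb' := (convex_ball y _).segment_subset (Metric.mem_ball_self hn) hy₁ ht'
    rw [Metric.mem_ball, dist_comm] at hb hb'
    refine ⟨_, _, hb, hb', ?_⟩
    rw [h.Hu_add, h.Hu_add, huni x t, huni x t', h.flow.equivariant, ← h.flow.map_add]
    congr 2
    field_simp; ring
  choose x' y' hx' hy' heq using key
  have hlim := tendsto_one_div_add_atTop_nhds_zero_nat (𝕜 := ℝ)
  have lx : Tendsto x' atTop (𝓝 x) := tendsto_iff_dist_tendsto_zero.2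
    (squeeze_zero (fun _ => dist_nonneg) (fun n => by rw [dist_comm]; exact (hx' n).le) hlim)
  have ly : Tendsto y' atTop (𝓝 y) := tendsto_iff_dist_tendsto_zero.2
    (squeeze_zero (fun _ => dist_nonneg) (fun n => by rw [dist_comm]; exact (hy' n).le) hlim)
  have lt : Tendsto (fun n => (Hu (x' n) - Hu (y' n)) / a) atTop (𝓝 0) := by
    have := (((h.continuous_Hu.tendsto x).comp lx).sub
      ((h.continuous_Hu.tendsto y).comp ly)).div_const a
    rwa [hu, sub_self, zero_div] at this
  have l2 : Tendsto (fun n => φ ((Hu (x' n) - Hu (y' n)) / a) (y' n)) atTop (𝓝 (φ 0 y)) :=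
    (h.flow.continuous.tendsto (0, y)).comp (lt.prodMk_nhds ly)
  rw [h.flow.map_zero] at l2
  exact tendsto_nhds_unique lx (l2.congr fun n => (heq n).symm)

theorem pair_surjective (h : IsHyperbolicSemiconj φ F l μ ν u s Hu Hs K) {a : ℝ} (ha : a ≠ 0)
    (huni : ∀ x, x ∈ uniformSet φ Hu a) (α β : ℝ) : ∃ x, Hu x = α ∧ Hs x = β := by
  obtain ⟨x, hx⟩ := h.exists_Hs_lt β
  obtain ⟨y, hy⟩ := h.exists_Hs_gt β
  obtain ⟨z, -, hz⟩ := isPreconnected_univ.intermediate_value (mem_univ y) (mem_univ x)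
    h.continuous_Hs.continuousOn ⟨hy.le, hx.le⟩
  refine ⟨φ ((α - Hu z) / a) z, ?_, by rw [h.Hs_flow, hz]⟩
  rw [huni z, mul_div_cancel₀ _ ha]; ring

theorem forall_mem_uniformSet (h : IsHyperbolicSemiconj φ F l μ ν u s Hu Hs K) {a : ℝ} (ha : a ≠ 0)
    (hne : (uniformSet φ Hu a).Nonempty) (hint : ∀ c, interior {x | Hs x = c} = ∅)
    (x : Fin 2 → ℝ) : x ∈ uniformSet φ Hu a := by
  refine h.mem_uniformSet_of_forall_exists ha hne fun ε hε => ?_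
  by_contra! hcon
  have : x ∈ interior {y | Hs y = Hs x} :=
    mem_interior.2 ⟨_, hcon, Metric.isOpen_ball, Metric.mem_ball_self hε⟩
  rw [hint] at this
  exact this

end IsHyperbolicSemiconj

/-! ### Jacobians and contraction transverse to the flow. -/

/-- The area form of the plane. -/
def area2 (v w : Fin 2 → ℝ) : ℝ := v 0 * w 1 - v 1 * w 0

theorem abs_area2_le (v w : Fin 2 → ℝ) : |area2 v w| ≤ 2 * ‖v‖ * ‖w‖ := by
  have h : ∀ i j, |v i * w j| ≤ ‖v‖ * ‖w‖ := fun i j => by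
    rw [abs_mul]
    exact mul_le_mul (norm_le_pi_norm v i) (norm_le_pi_norm w j) (abs_nonneg _) (norm_nonneg _)
  have := abs_sub (v 0 * w 1) (v 1 * w 0)
  unfold area2
  linarith [h 0 1, h 1 0]

theorem area2_map (D : (Fin 2 → ℝ) →L[ℝ] (Fin 2 → ℝ)) (v w : Fin 2 → ℝ) :
    area2 (D v) (D w) = D.det * area2 v w := by
  have hdet : D.det = (LinearMap.toMatrix' D.toLinearMap).det := by
    rw [ContinuousLinearMap.det, LinearMap.det_toMatrix']
  have hD : ∀ x, D x = (LinearMap.toMatrix' D.toLinearMap).mulVec x := fun x => by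
    rw [LinearMap.toMatrix'_mulVec]; rfl
  rw [hdet, hD, hD, Matrix.det_fin_two]
  simp only [area2, Matrix.mulVec, dotProduct, Fin.sum_univ_two]
  ring

theorem dot2_mul_dot2_eq (v w : Fin 2 → ℝ) :
    dot2 v v * dot2 w w = area2 v w ^ 2 + dot2 v w ^ 2 := by
  simp only [dot2, area2]; ring

namespace IsPlaneFlow

variable {φ : ℝ → (Fin 2 → ℝ) → (Fin 2 → ℝ)}

theorem contDiff_apply (hφ : IsPlaneFlow φ) (t : ℝ) : ContDiff ℝ 2 (φ t) :=
  hφ.contDiff.comp (contDiff_const.prodMk contDiff_id)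

theorem hasFDerivAt_apply (hφ : IsPlaneFlow φ) (t : ℝ) (x : Fin 2 → ℝ) :
    HasFDerivAt (φ t) (fderiv ℝ (φ t) x) x :=
  ((hφ.contDiff_apply t).differentiable two_ne_zero x).hasFDerivAt

theorem fderiv_velocity (hφ : IsPlaneFlow φ) (t : ℝ) (x : Fin 2 → ℝ) :
    fderiv ℝ (φ t) x (velocity φ x) = velocity φ (φ t x) := by
  have h1 : HasFDerivAt (φ t) (fderiv ℝ (φ t) x) (φ 0 x) := by
    rw [hφ.map_zero]; exact hφ.hasFDerivAt_apply t x
  have h2 := h1.comp_hasDerivAt (0 : ℝ) (hφ.hasDerivAt_zero x)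
  have h3 := hφ.hasDerivAt_zero (φ t x)
  have heq : (φ t ∘ fun r => φ r x) = fun r => φ r (φ t x) := by
    funext r
    simp only [Function.comp_apply, ← hφ.map_add, add_comm]
  rw [heq] at h2
  exact h2.unique h3

theorem fderiv_add (hφ : IsPlaneFlow φ) (r t : ℝ) (x : Fin 2 → ℝ) :
    fderiv ℝ (φ (r + t)) x = (fderiv ℝ (φ r) (φ t x)).comp (fderiv ℝ (φ t) x) := by
  have h := (hφ.hasFDerivAt_apply r (φ t x)).comp x (hφ.hasFDerivAt_apply t x)
  have heq : φ r ∘ φ t = φ (r + t) := by funext y; simp [hφ.map_add]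
  rw [heq] at h
  exact h.fderiv

/-- The Jacobian of the flow. -/
def jac (φ : ℝ → (Fin 2 → ℝ) → (Fin 2 → ℝ)) (t : ℝ) (x : Fin 2 → ℝ) : ℝ := |(fderiv ℝ (φ t) x).det|

theorem jac_add (hφ : IsPlaneFlow φ) (r t : ℝ) (x : Fin 2 → ℝ) :
    jac φ (r + t) x = jac φ r (φ t x) * jac φ t x := by
  rw [jac, hφ.fderiv_add, ContinuousLinearMap.det, ContinuousLinearMap.toLinearMap_comp,
    LinearMap.det_comp, abs_mul]
  rfl

theorem jac_zero (hφ : IsPlaneFlow φ) (x : Fin 2 → ℝ) : jac φ 0 x = 1 := by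
  have : φ 0 = id := funext hφ.map_zero
  rw [jac, this, fderiv_id]
  simp [ContinuousLinearMap.det]

theorem jac_pos (hφ : IsPlaneFlow φ) (t : ℝ) (x : Fin 2 → ℝ) : 0 < jac φ t x := by
  refine (abs_nonneg _).lt_of_ne fun h => ?_
  have h1 := hφ.jac_add (-t) t x
  rw [neg_add_cancel, hφ.jac_zero, show jac φ t x = 0 from h.symm, mul_zero] at h1
  exact one_ne_zero h1

theorem continuous_jac (hφ : IsPlaneFlow φ) (t : ℝ) : Continuous (jac φ t) := by
  have h1 : Continuous (fderiv ℝ (φ t)) := (hφ.contDiff_apply t).continuous_fderiv two_ne_zero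
  exact (ContinuousLinearMap.continuous_det.comp h1).abs

theorem fderiv_add_intVec (hφ : IsPlaneFlow φ) (t : ℝ) (x : Fin 2 → ℝ) (m : Fin 2 → ℤ) :
    fderiv ℝ (φ t) (x + intVec m) = fderiv ℝ (φ t) x := by
  rw [← fderiv_comp_add_right, show (fun x => φ t (x + intVec m)) = fun x => φ t x + intVec m from
    funext fun x => hφ.equivariant t x m, fderiv_add_const]

theorem exists_jac_bound (hφ : IsPlaneFlow φ) : ∃ c > 0, ∀ x, c ≤ jac φ 1 x := by
  obtain ⟨x₀, h⟩ := exists_forall_le_of_periodic' (g := fun x => -jac φ 1 x)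
    (hφ.continuous_jac 1).neg (fun x m => by simp only [jac, hφ.fderiv_add_intVec])
  exact ⟨jac φ 1 x₀, hφ.jac_pos _ _, fun x => neg_le_neg_iff.1 (h x)⟩

theorem exists_velocity_lipschitz (hφ : IsPlaneFlow φ) : ∃ C, 0 < C ∧ ∀ x y,
    ‖velocity φ x - velocity φ y‖ ≤ C * ‖x - y‖ :=
  exists_lipschitz_of_periodic hφ.contDiff_velocity
    (fun m => ⟨0, fun x => by rw [hφ.velocity_add, add_zero]⟩)

theorem exists_dot2_velocity_bound (hφ : IsPlaneFlow φ) :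
    ∃ c > 0, ∀ x, c ≤ dot2 (velocity φ x) (velocity φ x) := by
  obtain ⟨x₀, h⟩ := exists_forall_le_of_periodic'
    (g := fun x => -dot2 (velocity φ x) (velocity φ x))
    (hφ.continuous_velocity.dot2 hφ.continuous_velocity).neg
    (fun x m => by simp only [hφ.velocity_add])
  exact ⟨_, dot2_self_pos (hφ.velocity_ne_zero x₀), fun x => neg_le_neg_iff.1 (h x)⟩

theorem exists_lipschitz (hφ : IsPlaneFlow φ) (t : ℝ) : ∃ C, 0 < C ∧ ∀ x y,
    ‖φ t x - φ t y‖ ≤ C * ‖x - y‖ :=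
  exists_lipschitz_of_periodic ((hφ.contDiff_apply t).of_le one_le_two)
    (fun m => ⟨intVec m, fun x => hφ.equivariant t x m⟩)

theorem exists_lipschitz_Icc (hφ : IsPlaneFlow φ) (T : ℝ) : ∃ C, 0 < C ∧ ∀ t ∈ Icc 0 T, ∀ x y,
    ‖φ t x - φ t y‖ ≤ C * ‖x - y‖ := by
  have hfd : ∀ (t : ℝ) x, fderiv ℝ (φ t) x = (fderiv ℝ (fun p : ℝ × (Fin 2 → ℝ) => φ p.1 p.2) (t, x)).comp
      (ContinuousLinearMap.inr ℝ ℝ (Fin 2 → ℝ)) := fun t x => by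
    have h1 : HasFDerivAt (fun p : ℝ × (Fin 2 → ℝ) => φ p.1 p.2) _ (t, x) :=
      ((hφ.contDiff.differentiable two_ne_zero) (t, x)).hasFDerivAt
    exact (h1.comp x (hasFDerivAt_prodMk_right t x)).fderiv
  obtain ⟨C, hC, h⟩ := exists_norm_le_of_periodic (T := Icc 0 T) isCompact_Icc
    (g := fun t x => fderiv ℝ (φ t) x) (by
      simp only [hfd]
      exact (hφ.contDiff.continuous_fderiv two_ne_zero).clm_comp continuous_const)
    (fun t => hφ.fderiv_add_intVec t)
  exact ⟨C, hC, fun t ht x y => convex_univ.norm_image_sub_le_of_norm_fderiv_le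
    (fun x _ => (hφ.hasFDerivAt_apply t x).differentiableAt) (fun x _ => h t ht x)
    (mem_univ y) (mem_univ x)⟩

theorem exists_quadratic_bound (hφ : IsPlaneFlow φ) (t : ℝ) : ∃ C, 0 < C ∧ ∀ x y,
    ‖φ t y - φ t x - fderiv ℝ (φ t) x (y - x)‖ ≤ C * ‖y - x‖ ^ 2 := by
  obtain ⟨C, hC, h⟩ := exists_lipschitz_of_periodic
    ((hφ.contDiff_apply t).fderiv_right (m := 1) (by norm_num))
    (fun m => ⟨0, fun x => by rw [hφ.fderiv_add_intVec, add_zero]⟩)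
  refine ⟨C, hC, fun x y => ?_⟩
  have := (convex_segment x y).norm_image_sub_le_of_norm_hasFDerivWithin_le' (f := φ t)
    (f' := fderiv ℝ (φ t)) (φ := fderiv ℝ (φ t) x) (C := C * ‖y - x‖)
    (fun z _ => (hφ.hasFDerivAt_apply t z).hasFDerivWithinAt) (fun z hz => by
      refine (h z x).trans (mul_le_mul_of_nonneg_left ?_ hC.le)
      have := norm_sub_le_of_mem_segment hz
      exact this) (left_mem_segment ℝ x y) (right_mem_segment ℝ x y)
  rw [sq, ← mul_assoc]
  exact this

theorem exists_flow_quadratic_bound (hφ : IsPlaneFlow φ) : ∃ C, 0 < C ∧ ∀ t x,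
    ‖φ t x - x - t • velocity φ x‖ ≤ C * t ^ 2 := by
  obtain ⟨V, hV, hVb⟩ := hφ.exists_velocity_bound
  obtain ⟨C, hC, h⟩ := hφ.exists_velocity_lipschitz
  refine ⟨C * V, by positivity, fun t x => ?_⟩
  have := (convex_uIcc 0 t).norm_image_sub_le_of_norm_hasDerivWithin_le
    (f := fun r => φ r x - r • velocity φ x)
    (f' := fun r => velocity φ (φ r x) - (1 : ℝ) • velocity φ x) (C := C * (V * |t|))
    (fun r _ => ((hφ.hasDerivAt x r).sub ((hasDerivAt_id r).smul_const _)).hasDerivWithinAt)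
    (fun r hr => by
      rw [one_smul]
      refine (h _ _).trans (mul_le_mul_of_nonneg_left ?_ hC.le)
      have h1 := hφ.norm_sub_le hVb 0 r x
      rw [hφ.map_zero] at h1
      refine h1.trans (mul_le_mul_of_nonneg_left ?_ hV.le)
      have := abs_sub_left_of_mem_uIcc hr
      simpa using this) left_mem_uIcc right_mem_uIcc
  simp only [hφ.map_zero, zero_smul, sub_zero] at this
  calc ‖φ t x - x - t • velocity φ x‖ = ‖φ t x - t • velocity φ x - x‖ := by congr 1; abel
    _ ≤ _ := this
    _ = C * V * t ^ 2 := by rw [Real.norm_eq_abs, ← sq_abs]; ring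

/-- A point close to `y` can be moved along its orbit so that its displacement from `y` is, to first
order, transverse to the flow. -/
theorem exists_transverse_correction (hφ : IsPlaneFlow φ) : ∃ c > 0, ∃ b > 0, ∃ R > 0, ∀ y w,
    ∃ σ, |σ| ≤ b * ‖w - y‖ ∧
      |area2 (velocity φ y) (φ σ w - y)| ≤ |area2 (velocity φ y) (w - y)| + R * ‖w - y‖ ^ 2 ∧
      ‖φ σ w - y‖ ≤ c * |area2 (velocity φ y) (w - y)| + R * ‖w - y‖ ^ 2 := by
  obtain ⟨V, hV, hVb⟩ := hφ.exists_velocity_bound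
  obtain ⟨CX, hCX, hX⟩ := hφ.exists_velocity_lipschitz
  obtain ⟨P, hP, hflow⟩ := hφ.exists_flow_quadratic_bound
  obtain ⟨μ, hμ, hdot⟩ := hφ.exists_dot2_velocity_bound
  set c := 1 + 1 / μ with hc
  have hc0 : 0 < c := by positivity
  have hcμ : 1 ≤ c ^ 2 * μ := by
    have : c ^ 2 * μ = μ + 2 + 1 / μ := by rw [hc]; field_simp; ring
    rw [this]; have : 0 < 1 / μ := by positivity
    linarith
  set b := 2 * V / μ with hb
  have hb0 : 0 < b := by positivity
  set R := P * b ^ 2 + b * CX with hR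
  have hR0 : 0 < R := by positivity
  refine ⟨c, hc0, b, hb0, (2 * V + 1) * R, by positivity, fun y w => ?_⟩
  set X := velocity φ y with hX'
  set h := w - y with hh
  have hμ' : μ ≤ dot2 X X := hdot _
  have hXX : 0 < dot2 X X := hμ.trans_le hμ'
  -- `α • X` is the component of the displacement along the velocity; flowing for time `-α` removes
  -- it up to a quadratic error.
  set α := dot2 h X / dot2 X X with hα
  have hαb : |α| ≤ b * ‖h‖ := by
    rw [hα, abs_div, abs_of_pos hXX, div_le_iff₀ hXX]
    calc |dot2 h X| ≤ 2 * ‖h‖ * ‖X‖ := abs_dot2_le _ _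
      _ ≤ 2 * ‖h‖ * V := by gcongr; exact hVb _
      _ = b * ‖h‖ * μ := by rw [hb]; field_simp
      _ ≤ b * ‖h‖ * dot2 X X := by gcongr
  obtain ⟨r, hr⟩ : ∃ r, r = φ (-α) w - y - (h - α • X) := ⟨_, rfl⟩
  have hrn : ‖r‖ ≤ R * ‖h‖ ^ 2 := by
    have e1 : r = (φ (-α) w - w - (-α) • velocity φ w) - α • (velocity φ w - X) := by
      rw [hr, hh, smul_sub, neg_smul]; abel
    have e2 := hflow (-α) w
    have e3 : ‖α • (velocity φ w - X)‖ ≤ |α| * (CX * ‖h‖) := by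
      rw [norm_smul, Real.norm_eq_abs]
      exact mul_le_mul_of_nonneg_left (hX _ _) (abs_nonneg _)
    have e4 : (-α) ^ 2 ≤ (b * ‖h‖) ^ 2 := by
      rw [neg_sq, ← sq_abs]; gcongr
    calc ‖r‖ ≤ P * (-α) ^ 2 + |α| * (CX * ‖h‖) := by
          rw [e1]; exact (_root_.norm_sub_le _ _).trans (add_le_add e2 e3)
      _ ≤ P * (b * ‖h‖) ^ 2 + (b * ‖h‖) * (CX * ‖h‖) := by gcongr
      _ = R * ‖h‖ ^ 2 := by rw [hR]; ring
  have hz' : φ (-α) w - y = h - α • X + r := by rw [hr]; abel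
  have hRV : R * ‖h‖ ^ 2 ≤ (2 * V + 1) * R * ‖h‖ ^ 2 := by
    have : 0 ≤ 2 * V * (R * ‖h‖ ^ 2) := by positivity
    linarith
  have hVR : 2 * V * (R * ‖h‖ ^ 2) ≤ (2 * V + 1) * R * ‖h‖ ^ 2 := by
    have : 0 ≤ R * ‖h‖ ^ 2 := by positivity
    linarith
  refine ⟨-α, by rwa [abs_neg], ?_, ?_⟩
  · have e1 : area2 X (φ (-α) w - y) = area2 X h + area2 X r := by
      rw [hz']; simp only [area2, Pi.sub_apply, Pi.add_apply, Pi.smul_apply, smul_eq_mul]; ring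
    have e2 : |area2 X r| ≤ 2 * V * (R * ‖h‖ ^ 2) := by
      calc _ ≤ 2 * ‖X‖ * ‖r‖ := abs_area2_le _ _
        _ ≤ _ := by gcongr; exact hVb _
    rw [e1]
    exact (abs_add_le _ _).trans (add_le_add le_rfl (e2.trans hVR))
  · obtain ⟨n, hn⟩ : ∃ n, n = h - α • X := ⟨_, rfl⟩
    have e1 : dot2 X n = 0 := by
      have : dot2 X n = dot2 h X - α * dot2 X X := by
        rw [hn]; simp only [dot2, Pi.sub_apply, Pi.smul_apply, smul_eq_mul]; ring
      rw [this, hα, div_mul_cancel₀ _ hXX.ne', sub_self]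
    have e2 : area2 X n = area2 X h := by
      rw [hn]; simp only [area2, Pi.sub_apply, Pi.smul_apply, smul_eq_mul]; ring
    have e3 := dot2_mul_dot2_eq X n
    rw [e1, e2] at e3
    have e4 : ‖n‖ ≤ c * |area2 X h| := by
      refine abs_le_of_sq_le_sq' ?_ (by positivity) |>.2
      have e6 : μ * ‖n‖ ^ 2 ≤ area2 X h ^ 2 := by
        calc μ * ‖n‖ ^ 2 ≤ dot2 X X * dot2 n n :=
              mul_le_mul hμ' (norm_sq_le_dot2 n) (by positivity) hXX.le
          _ = _ := by rw [e3]; ring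
      calc ‖n‖ ^ 2 ≤ (c ^ 2 * μ) * ‖n‖ ^ 2 := le_mul_of_one_le_left (by positivity) hcμ
        _ = c ^ 2 * (μ * ‖n‖ ^ 2) := by ring
        _ ≤ c ^ 2 * area2 X h ^ 2 := by gcongr
        _ = (c * |area2 X h|) ^ 2 := by rw [mul_pow, sq_abs]
    rw [hz', ← hn]
    exact (norm_add_le _ _).trans (add_le_add e4 (hrn.trans hRV))

/-- The derivative of `φ 1` carries velocity to velocity and scales the area form by its
determinant. So the transverse displacement is multiplied by the Jacobian, up to a quadratic Taylor
error that the C² hypothesis controls. -/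
theorem exists_area_bound (hφ : IsPlaneFlow φ) : ∃ G > 0, ∀ y z,
    |area2 (velocity φ (φ 1 y)) (φ 1 z - φ 1 y)|
      ≤ jac φ 1 y * |area2 (velocity φ y) (z - y)| + G * ‖z - y‖ ^ 2 := by
  obtain ⟨V, hV, hVb⟩ := hφ.exists_velocity_bound
  obtain ⟨Q, hQ, hquad⟩ := hφ.exists_quadratic_bound 1
  refine ⟨2 * V * Q, by positivity, fun y z => ?_⟩
  obtain ⟨w, hw⟩ : ∃ w, w = φ 1 z - φ 1 y - fderiv ℝ (φ 1) y (z - y) := ⟨_, rfl⟩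
  have e1 : φ 1 z - φ 1 y = fderiv ℝ (φ 1) y (z - y) + w := by rw [hw]; abel
  have e2 : ‖w‖ ≤ Q * ‖z - y‖ ^ 2 := hw ▸ hquad y z
  have e3 : |area2 (velocity φ (φ 1 y)) (fderiv ℝ (φ 1) y (z - y))|
      = jac φ 1 y * |area2 (velocity φ y) (z - y)| := by
    rw [← hφ.fderiv_velocity, area2_map, abs_mul, jac]
  have e5 : |area2 (velocity φ (φ 1 y)) w| ≤ 2 * V * Q * ‖z - y‖ ^ 2 := by
    calc _ ≤ 2 * ‖velocity φ (φ 1 y)‖ * ‖w‖ := abs_area2_le _ _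
      _ ≤ 2 * V * (Q * ‖z - y‖ ^ 2) := by
        gcongr
        exact hVb _
      _ = _ := by ring
  have e6 : area2 (velocity φ (φ 1 y)) (φ 1 z - φ 1 y)
      = area2 (velocity φ (φ 1 y)) (fderiv ℝ (φ 1) y (z - y))
        + area2 (velocity φ (φ 1 y)) w := by
    rw [e1]; simp only [area2, Pi.add_apply]; ring
  rw [e6]
  exact (abs_add_le _ _).trans (add_le_add e3.le e5)

/-- One step of the comparison of a nearby orbit with a given one: `a` bounds the transverse
displacement measured with the area form. -/
theorem exists_step (hφ : IsPlaneFlow φ) : ∃ C > 0, ∃ κ > 0, ∃ D > 0, ∀ y z a,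
    |area2 (velocity φ y) (z - y)| ≤ a → ‖z - y‖ ≤ C * a → a ≤ κ →
    ∃ σ, |σ| ≤ 1 / 2 ∧
      |area2 (velocity φ (φ 1 y)) (φ (1 + σ) z - φ 1 y)| ≤ jac φ 1 y * a * (1 + D * a) ∧
      ‖φ (1 + σ) z - φ 1 y‖ ≤ C * (jac φ 1 y * a * (1 + D * a)) := by
  obtain ⟨c, hc, b, hb, R, hR, hcorr⟩ := hφ.exists_transverse_correction
  obtain ⟨G, hG, harea⟩ := hφ.exists_area_bound
  obtain ⟨L, hL, hLip⟩ := hφ.exists_lipschitz 1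
  obtain ⟨j, hj, hjac⟩ := hφ.exists_jac_bound
  -- One `c` accounts for the transverse displacement, the other for the quadratic error, which is
  -- absorbed when `a ≤ c * j / E`. The second term of the threshold keeps `|σ| ≤ 1 / 2`.
  set C := 2 * c with hC
  have hC0 : 0 < C := by positivity
  set E := R * (L * C) ^ 2 with hE
  have hE0 : 0 < E := by positivity
  set D := (G * C ^ 2 + E) / j with hD
  have hD0 : 0 < D := by positivity
  refine ⟨C, hC0, min (c * j / E) (1 / (2 * (b * L * C))), by positivity, D, hD0,
    fun y z a h1 h2 h3 => ?_⟩
  have ha : 0 ≤ a := (abs_nonneg _).trans h1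
  obtain ⟨σ, hσ, s1, s2⟩ := hcorr (φ 1 y) (φ 1 z)
  have hd : ‖φ 1 z - φ 1 y‖ ≤ L * C * a := by
    calc _ ≤ L * ‖z - y‖ := hLip z y
      _ ≤ L * (C * a) := by gcongr
      _ = _ := by ring
  have hRd : R * ‖φ 1 z - φ 1 y‖ ^ 2 ≤ E * a ^ 2 := by
    calc _ ≤ R * (L * C * a) ^ 2 := by gcongr
      _ = _ := by rw [hE]; ring
  obtain ⟨J, hJ⟩ : ∃ J, J = jac φ 1 y := ⟨_, rfl⟩
  have hJj : j ≤ J := hJ ▸ hjac y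
  have har : |area2 (velocity φ (φ 1 y)) (φ 1 z - φ 1 y)| ≤ J * a + G * C ^ 2 * a ^ 2 := by
    refine (harea y z).trans ?_
    rw [← hJ]
    have hJ0 : 0 ≤ J := hj.le.trans hJj
    calc _ ≤ J * a + G * (C * a) ^ 2 := by gcongr
      _ = _ := by ring
  have hDj : G * C ^ 2 * a ^ 2 + E * a ^ 2 ≤ J * a * (D * a) := by
    have : G * C ^ 2 * a ^ 2 + E * a ^ 2 = j * a * (D * a) := by
      rw [hD]; field_simp
    rw [this]; gcongr
  have hE2 : 0 ≤ E * a ^ 2 := by positivity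
  have hflow : φ (1 + σ) z = φ σ (φ 1 z) := by rw [add_comm, hφ.map_add]
  refine ⟨σ, ?_⟩
  rw [hflow, ← hJ]
  refine ⟨?_, ?_, ?_⟩
  · have e1 : a ≤ 1 / (2 * (b * L * C)) := h3.trans (min_le_right _ _)
    rw [le_div_iff₀ (by positivity)] at e1
    calc |σ| ≤ b * (L * C * a) := hσ.trans (by gcongr)
      _ ≤ 1 / 2 := by linarith
  · rw [mul_add, mul_one]; linarith
  · have e5 : E * a ^ 2 ≤ c * (J * a * (1 + D * a)) := by
      have f1 : a ≤ c * j / E := h3.trans (min_le_left _ _)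
      rw [le_div_iff₀ hE0] at f1
      calc E * a ^ 2 = (a * E) * a := by ring
        _ ≤ (c * j) * a := by gcongr
        _ ≤ (c * J) * a := by gcongr
        _ ≤ c * (J * a * (1 + D * a)) := by
          have : 0 ≤ c * J * a * (D * a) := by
            have : 0 ≤ J := hj.le.trans hJj
            positivity
          linarith
    have e6 : c * |area2 (velocity φ (φ 1 y)) (φ 1 z - φ 1 y)| ≤ c * (J * a * (1 + D * a)) := by
      gcongr
      rw [mul_add, mul_one]; linarith
    rw [hC]; linarith

/-- If the Jacobians along the forward orbit of `x` are summable, then the orbits of all points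
near `x`, at a distance controlled by the sum, are asymptotic to the orbit of `x`. -/
theorem exists_contraction (hφ : IsPlaneFlow φ) : ∃ c > 0, ∃ C > 0, ∀ x S,
    (∀ n, ∑ j ∈ Finset.range n, jac φ j x ≤ S) → ∀ z, ‖z - x‖ * S ≤ c →
    ∃ t : ℕ → ℝ, t 0 = 0 ∧ (∀ j, |t (j + 1) - t j - 1| ≤ 1 / 2) ∧
      ∀ j : ℕ, ‖φ (t j) z - φ j x‖ ≤ C * jac φ j x * ‖z - x‖ := by
  obtain ⟨V, hV, hVb⟩ := hφ.exists_velocity_bound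
  obtain ⟨C, hC, κ, hκ, D, hD, hstep⟩ := hφ.exists_step
  set A := 2 * V + 1 / C with hA
  have hA0 : 0 < A := by positivity
  refine ⟨min (κ / (3 * A)) (1 / (3 * D * A)), by positivity, C * (3 * A), by positivity,
    fun x S hS z hz => ?_⟩
  set d := ‖z - x‖ with hd
  have hd0 : 0 ≤ d := norm_nonneg _
  have hz1 : d * S * (3 * A) ≤ κ := (le_div_iff₀ (by positivity)).1 (hz.trans (min_le_left _ _))
  have hz2 : d * S * (3 * D * A) ≤ 1 :=
    (le_div_iff₀ (by positivity)).1 (hz.trans (min_le_right _ _))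
  -- `a n` bounds the transverse displacement after `n` steps: it is `A * d` times the Jacobian
  -- times the product of the factors `1 + D * a i`. By strong induction that product is at most
  -- `exp 1 ≤ 3`, because the sum of the earlier `D * a i` is controlled by `d * S`.
  let a : ℕ → ℝ := fun n => Nat.rec (A * d) (fun j r => jac φ 1 (φ j x) * r * (1 + D * r)) n
  have ha0 : a 0 = A * d := rfl
  have hasucc : ∀ n : ℕ, a (n + 1) = jac φ 1 (φ n x) * a n * (1 + D * a n) := fun _ => rfl
  have hann : ∀ n, 0 ≤ a n := fun n => by
    induction n with
    | zero => rw [ha0]; positivity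
    | succ n ih =>
      rw [hasucc]
      have := (hφ.jac_pos 1 (φ n x)).le
      positivity
  have hjs : ∀ n : ℕ, jac φ 1 (φ n x) * jac φ n x = jac φ (n + 1 : ℕ) x := fun n => by
    rw [← hφ.jac_add]; push_cast; rw [add_comm]
  have hprod : ∀ n, a n ≤ jac φ n x * (A * d) * Real.exp (∑ i ∈ Finset.range n, D * a i) := by
    intro n
    induction n with
    | zero => simp [ha0, hφ.jac_zero]
    | succ n ih =>
      have h1 := hφ.jac_pos 1 (φ n x)
      have h2 : 1 + D * a n ≤ Real.exp (D * a n) := by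
        have := Real.add_one_le_exp (D * a n); linarith
      have h3 : 0 ≤ D * a n := mul_nonneg hD.le (hann n)
      rw [hasucc, Finset.sum_range_succ, Real.exp_add, ← hjs]
      calc jac φ 1 (φ n x) * a n * (1 + D * a n)
          ≤ jac φ 1 (φ n x) * (jac φ n x * (A * d) * Real.exp (∑ i ∈ Finset.range n, D * a i))
            * Real.exp (D * a n) := by
            have := (hann n).trans ih
            gcongr
        _ = _ := by ring
  have hbound : ∀ n, a n ≤ 3 * (jac φ n x * (A * d)) := by
    intro n
    induction n using Nat.strong_induction_on with
    | _ n ih =>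
      have h1 : ∑ i ∈ Finset.range n, D * a i ≤ 1 := by
        calc ∑ i ∈ Finset.range n, D * a i
            ≤ ∑ i ∈ Finset.range n, D * (3 * (jac φ i x * (A * d))) :=
              Finset.sum_le_sum fun i hi =>
                mul_le_mul_of_nonneg_left (ih i (Finset.mem_range.1 hi)) hD.le
          _ = (3 * D * A * d) * ∑ i ∈ Finset.range n, jac φ i x := by
            rw [Finset.mul_sum]; exact Finset.sum_congr rfl fun i _ => by ring
          _ ≤ (3 * D * A * d) * S := by gcongr; exact hS n
          _ ≤ 1 := by linarith
      have h2 : Real.exp (∑ i ∈ Finset.range n, D * a i) ≤ 3 :=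
        (Real.exp_le_exp.2 h1).trans (by linarith [Real.exp_one_lt_d9])
      have h3 : 0 ≤ jac φ n x * (A * d) := by
        have := (hφ.jac_pos n x).le; positivity
      have := hprod n
      nlinarith
  have haκ : ∀ n, a n ≤ κ := fun n => by
    have h1 : jac φ n x ≤ S := by
      refine le_trans ?_ (hS (n + 1))
      rw [Finset.sum_range_succ]
      have : 0 ≤ ∑ i ∈ Finset.range n, jac φ i x := Finset.sum_nonneg fun i _ => (hφ.jac_pos i x).le
      linarith
    calc a n ≤ 3 * (jac φ n x * (A * d)) := hbound n
      _ ≤ 3 * (S * (A * d)) := by gcongr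
      _ ≤ κ := by linarith
  let P : ℕ → ℝ → Prop := fun n t =>
    |area2 (velocity φ (φ n x)) (φ t z - φ n x)| ≤ a n ∧ ‖φ t z - φ n x‖ ≤ C * a n
  have hP0 : P 0 0 := by
    simp only [P, Nat.cast_zero, hφ.map_zero, ha0]
    constructor
    · calc _ ≤ 2 * ‖velocity φ x‖ * ‖z - x‖ := abs_area2_le _ _
        _ ≤ 2 * V * d := by gcongr; exact hVb _
        _ ≤ A * d := by gcongr; rw [hA]; linarith [show 0 < 1 / C by positivity]
    · have h1 : C * (1 / C) = 1 := by field_simp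
      have h2 : 1 ≤ C * A := by rw [hA, mul_add, h1]; linarith [show 0 < C * (2 * V) by positivity]
      rw [← mul_assoc]; nlinarith
  have hPs : ∀ n t, P n t → ∃ t', P (n + 1) t' ∧ |t' - t - 1| ≤ 1 / 2 := by
    rintro n t ⟨h1, h2⟩
    obtain ⟨σ, hσ, h3, h4⟩ := hstep (φ n x) (φ t z) (a n) h1 h2 (haκ n)
    have e1 : φ ((n + 1 : ℕ) : ℝ) x = φ 1 (φ n x) := by
      rw [← hφ.map_add]; push_cast; rw [add_comm]
    have e2 : φ (1 + σ + t) z = φ (1 + σ) (φ t z) := hφ.map_add _ _ _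
    refine ⟨1 + σ + t, ⟨?_, ?_⟩, by ring_nf; linarith⟩
    · rw [e1, e2, hasucc]; exact h3
    · rw [e1, e2, hasucc]; exact h4
  choose! f hf1 hf2 using hPs
  let t : ℕ → ℝ := fun n => Nat.rec 0 (fun j r => f j r) n
  have ht : ∀ n, P n (t n) := fun n => by
    induction n with
    | zero => exact hP0
    | succ n ih => exact hf1 n _ ih
  refine ⟨t, rfl, fun j => hf2 j _ (ht j), fun j => (ht j).2.trans ?_⟩
  calc C * a j ≤ C * (3 * (jac φ j x * (A * d))) := by gcongr; exact hbound j
    _ = _ := by ring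

end IsPlaneFlow

/-! ### Denjoy argument: level sets have empty interior. -/

section

open MeasureTheory

theorem intVec_sub (m n : Fin 2 → ℤ) : intVec (m - n) = intVec m - intVec n := by
  ext i; simp [intVec]

/-- A plane set disjoint from its integer translates has finite area. -/
theorem volume_lt_top_of_disjoint_translates {W : Set (Fin 2 → ℝ)} (hW : MeasurableSet W)
    (hdisj : ∀ m, ∀ x ∈ W, x + intVec m ∈ W → m = 0) : volume W < ⊤ := by
  by_contra! hcon
  have hfund := ZSpan.isAddFundamentalDomain' (Pi.basisFun ℝ (Fin 2)) volume
  have hint : ∀ z : (Submodule.span ℤ (range (Pi.basisFun ℝ (Fin 2)))).toAddSubgroup,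
      ∃ m, (z : Fin 2 → ℝ) = intVec m := fun z => by
    have := ((Pi.basisFun ℝ (Fin 2)).mem_span_iff_repr_mem ℤ _).1 z.2
    choose m hm using this
    exact ⟨m, funext fun i => by simpa [intVec] using (hm i).symm⟩
  have hcount : Countable (Submodule.span ℤ (range (Pi.basisFun ℝ (Fin 2)))).toAddSubgroup := by
    choose f hf using hint
    exact Function.Injective.countable (f := f) fun x y hxy => Subtype.ext (by rw [hf, hf, hxy])
  -- Blichfeldt's principle: a set of area larger than that of the unit square has two overlapping
  -- integer translates.
  obtain ⟨x, y, hne, hxy⟩ := exists_pair_mem_lattice_not_disjoint_vadd hfund hW.nullMeasurableSet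
    (lt_of_lt_of_le (by
      rw [ZSpan.fundamentalDomain_pi_basisFun, volume_pi, Measure.pi_pi]; simp) hcon)
  obtain ⟨m, hm⟩ := hint x
  obtain ⟨n, hn⟩ := hint y
  rw [Set.not_disjoint_iff] at hxy
  obtain ⟨_, ⟨a, ha, rfl⟩, b, hb, hab⟩ := hxy
  have hab' : intVec n + b = intVec m + a := by
    rw [← hm, ← hn]; exact hab
  have h0 := hdisj (m - n) a ha (by
    rwa [intVec_sub, show a + (intVec m - intVec n) = b by rw [add_sub, add_comm a, ← hab']; abel])
  apply hne
  apply Subtype.ext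
  rw [hm, hn, sub_eq_zero.1 h0]

theorem lintegral_inv_sub_eq_top {a b : ℝ} (hab : a < b) {κ : ℝ} (hκ : 0 < κ) :
    ∫⁻ x in Ioo a b, ENNReal.ofReal (κ / (b - x)) = ⊤ := by
  by_contra hne
  have hlt := lt_top_iff_ne_top.2 hne
  have hmeas : Measurable fun x : ℝ => κ / (b - x) := by fun_prop
  have hint : IntegrableOn (fun x : ℝ => κ / (b - x)) (Ioo a b) := by
    refine ⟨hmeas.aestronglyMeasurable, ?_⟩
    rw [hasFiniteIntegral_iff_norm]
    refine lt_of_le_of_lt (le_of_eq ?_) hlt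
    refine setLIntegral_congr_fun measurableSet_Ioo fun x hx => ?_
    rw [Real.norm_of_nonneg (div_nonneg hκ.le (sub_nonneg.2 hx.2.le))]
  have h2 : IntervalIntegrable (fun x => (x - b)⁻¹) volume a b := by
    rw [intervalIntegrable_iff_integrableOn_Ioo_of_le hab.le]
    refine IntegrableOn.congr_fun (hint.const_mul (-κ⁻¹)) (fun x hx => ?_) measurableSet_Ioo
    have : x - b ≠ 0 := (sub_neg.2 hx.2).ne
    have : b - x ≠ 0 := (sub_pos.2 hx.2).ne'
    field_simp
    ring
  rcases intervalIntegrable_sub_inv_iff.1 h2 with h | h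
  · exact hab.ne h
  · exact h right_mem_uIcc

namespace IsPlaneFlow

variable {φ : ℝ → (Fin 2 → ℝ) → (Fin 2 → ℝ)}

/-- The sum of the Jacobians along the forward orbit. -/
def jacSum (φ : ℝ → (Fin 2 → ℝ) → (Fin 2 → ℝ)) (x : Fin 2 → ℝ) : ENNReal :=
  ∑' j : ℕ, ENNReal.ofReal (jac φ j x)

theorem measurable_jacSum (hφ : IsPlaneFlow φ) : Measurable (jacSum φ) :=
  Measurable.tsum fun j => (hφ.continuous_jac j).measurable.ennreal_ofReal

/-- By the change of variables formula each term integrates to the area of `φ j '' B`. These images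
lie in `W` and are pairwise disjoint because `B` never returns to itself. -/
theorem lintegral_jacSum_le (hφ : IsPlaneFlow φ) {W B : Set (Fin 2 → ℝ)} (hB : MeasurableSet B)
    (hBW : ∀ (j : ℕ), ∀ x ∈ B, φ j x ∈ W)
    (hdisj : ∀ (j : ℕ), ∀ x ∈ B, φ j x ∈ B → j = 0) :
    ∫⁻ x in B, jacSum φ x ≤ volume W := by
  unfold jacSum
  rw [lintegral_tsum fun j : ℕ => (hφ.continuous_jac j).measurable.ennreal_ofReal.aemeasurable]
  have hinj : ∀ t : ℝ, Function.Injective (φ t) := fun t => hφ.injective t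
  have himg : ∀ j : ℕ, ∫⁻ x in B, ENNReal.ofReal (jac φ j x) = volume (φ j '' B) := fun j =>
    lintegral_abs_det_fderiv_eq_addHaar_image volume hB
      (fun x _ => (hφ.hasFDerivAt_apply j x).hasFDerivWithinAt) (hinj j).injOn
  simp only [himg]
  rw [← measure_iUnion]
  · exact measure_mono (iUnion_subset fun j => by rintro _ ⟨x, hx, rfl⟩; exact hBW j x hx)
  · have key : ∀ i j : ℕ, i < j → Disjoint (φ i '' B) (φ j '' B) := fun i j hij => by
      rw [Set.disjoint_left]
      rintro _ ⟨x, hx, rfl⟩ ⟨y, hy, hxy⟩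
      obtain ⟨k, rfl⟩ := Nat.exists_eq_add_of_lt hij
      have : φ ((k + 1 : ℕ) : ℝ) y = x := by
        apply hinj i
        rw [← hφ.map_add, ← hxy]
        congr 1
        push_cast; ring
      have := hdisj (k + 1) y hy (this ▸ hx)
      omega
    intro i j hij
    rcases lt_or_gt_of_ne hij with h | h
    · exact key i j h
    · exact (key j i h).symm
  · intro j
    exact hB.image_of_continuousOn_injOn (hφ.contDiff_apply j).continuous.continuousOn (hinj j).injOn

end IsPlaneFlow

namespace IsHyperbolicSemiconj

open IsPlaneFlow

variable {φ : ℝ → (Fin 2 → ℝ) → (Fin 2 → ℝ)} {F : (Fin 2 → ℝ) ≃ₜ (Fin 2 → ℝ)}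
  {l μ ν : ℝ} {u s : (Fin 2 → ℝ) →L[ℝ] ℝ} {Hu Hs : (Fin 2 → ℝ) → ℝ} {K : ℝ}

theorem flow_mem_interior (h : IsHyperbolicSemiconj φ F l μ ν u s Hu Hs K) {c : ℝ} (t : ℝ)
    {x : Fin 2 → ℝ} (hx : x ∈ interior {x | Hs x = c}) : φ t x ∈ interior {x | Hs x = c} := by
  refine mem_interior.2 ⟨φ (-t) ⁻¹' interior {x | Hs x = c}, fun y hy => ?_,
    isOpen_interior.preimage (h.flow.contDiff_apply (-t)).continuous, ?_⟩
  · have := interior_subset hy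
    rwa [mem_ofPred_eq, h.Hs_flow] at this
  · rwa [mem_preimage, h.flow.neg_apply]

theorem eq_zero_of_add_mem (h : IsHyperbolicSemiconj φ F l μ ν u s Hu Hs K) {c : ℝ}
    (m : Fin 2 → ℤ) (x : Fin 2 → ℝ) (hx : x ∈ interior {x | Hs x = c})
    (hm : x + intVec m ∈ interior {x | Hs x = c}) : m = 0 := by
  have h1 : Hs x = c := interior_subset (s := {x | Hs x = c}) hx
  have h2 : Hs (x + intVec m) = c := interior_subset (s := {x | Hs x = c}) hm
  rw [h.Hs_add, h1] at h2
  exact h.irrational m (by linarith)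

/-- Orbits do not return within `ε` at integer times, so the previous bound applies on balls of
radius `ε / 2`, and finitely many of these cover `Q`. The interior has finite area since it is
disjoint from its integer translates. -/
theorem lintegral_jacSum_lt_top (h : IsHyperbolicSemiconj φ F l μ ν u s Hu Hs K) {c : ℝ}
    {Q : Set (Fin 2 → ℝ)} (hQ : IsCompact Q) :
    ∫⁻ x in interior {x | Hs x = c} ∩ Q, jacSum φ x < ⊤ := by
  obtain ⟨ε, hε, hret⟩ := h.flow.exists_pos_le_norm_sub h.free one_pos
  have hfin := volume_lt_top_of_disjoint_translates
    (isOpen_interior (s := {x | Hs x = c})).measurableSet h.eq_zero_of_add_mem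
  refine hQ.induction_on (p := fun Q => ∫⁻ x in interior {x | Hs x = c} ∩ Q, jacSum φ x < ⊤)
    (by simp) (fun A B hAB hB => ?_) (fun A B hA hB => ?_) (fun x _ => ?_)
  · exact (lintegral_mono_set (inter_subset_inter_right _ hAB)).trans_lt hB
  · rw [inter_union_distrib_left]
    exact (lintegral_union_le _ _ _).trans_lt (ENNReal.add_lt_top.2 ⟨hA, hB⟩)
  · refine ⟨Metric.ball x (ε / 2), mem_nhdsWithin_of_mem_nhds (Metric.ball_mem_nhds x (by positivity)),
      (h.flow.lintegral_jacSum_le (isOpen_interior.inter Metric.isOpen_ball).measurableSet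
        (fun j y hy => h.flow_mem_interior j hy.1) (fun j y hy hj => ?_)).trans_lt hfin⟩
    by_contra hj0
    have h1 : (1 : ℝ) ≤ |(j : ℝ)| := by
      rw [Nat.abs_cast]; exact_mod_cast Nat.one_le_iff_ne_zero.2 hj0
    have h2 := hret y j h1
    have h3 := dist_triangle_right (φ j y) y x
    rw [dist_eq_norm] at h3
    have h4 := Metric.mem_ball.1 hj.2
    have h5 := Metric.mem_ball.1 hy.2
    linarith

/-- A thin lattice vector moves the orbit of `q` to a level between those of `q` and a nearby `y`,
so the translated orbit meets the short segment joining them. There `Hu` is within `1` of `Hu q`,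
hence `t` is within `1 / |a|` of `-a⁻¹ * u (intVec m)`, which was chosen large. -/
theorem exists_recurrence (h : IsHyperbolicSemiconj φ F l μ ν u s Hu Hs K) {a : ℝ} (ha : a ≠ 0)
    {q : Fin 2 → ℝ} (hq : q ∈ uniformSet φ Hu a)
    (hne : ∀ ε > 0, ∃ y ∈ Metric.ball q ε, Hs y ≠ Hs q) {ε : ℝ} (hε : 0 < ε) (T : ℝ) :
    ∃ t m, T ≤ t ∧ s (intVec m) ≠ 0 ∧ ‖φ t q + intVec m - q‖ < ε := by
  obtain ⟨δ, hδ, hδu⟩ := Metric.continuousAt_iff.1 (h.continuous_Hu.continuousAt (x := q)) 1 one_pos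
  obtain ⟨y, hy, hyq⟩ := hne (min δ ε) (lt_min hδ hε)
  have hseg : ∃ t m, T + 1 / |a| < -a⁻¹ * u (intVec m) ∧ s (intVec m) ≠ 0 ∧
      φ t q + intVec m ∈ segment ℝ q y := by
    have ha' : -a⁻¹ ≠ 0 := neg_ne_zero.2 (inv_ne_zero ha)
    rcases lt_or_gt_of_ne hyq with hlt | hlt
    · obtain ⟨m, h1, h2, h3⟩ := h.exists_lattice_thin ha' (neg_ne_zero.2 one_ne_zero)
        (T + 1 / |a|) (sub_pos.2 hlt)
      obtain ⟨t, ht⟩ := h.exists_flow_mem_segment ha hq (x := y) (y := q) (m := m)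
        (by linarith) (by linarith)
      exact ⟨t, m, h1, by intro h0; linarith, by rwa [segment_symm]⟩
    · obtain ⟨m, h1, h2, h3⟩ := h.exists_lattice_thin ha' one_ne_zero (T + 1 / |a|) (sub_pos.2 hlt)
      obtain ⟨t, ht⟩ := h.exists_flow_mem_segment ha hq (x := q) (y := y) (m := m)
        (by linarith) (by linarith)
      exact ⟨t, m, h1, by intro h0; linarith, ht⟩
  obtain ⟨t, m, hm, hs, ht⟩ := hseg
  have hball : φ t q + intVec m ∈ Metric.ball q (min δ ε) :=
    (convex_ball q _).segment_subset (Metric.mem_ball_self (lt_min hδ hε)) hy ht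
  rw [Metric.mem_ball, lt_min_iff] at hball
  refine ⟨t, m, ?_, hs, by rw [← dist_eq_norm]; exact hball.2⟩
  have h1 := hδu hball.1
  rw [h.Hu_add, hq, Real.dist_eq, show Hu q + a * t + u (intVec m) - Hu q
    = a * (t - -a⁻¹ * u (intVec m)) by field_simp; ring, abs_mul] at h1
  have h2 : |t - -a⁻¹ * u (intVec m)| < 1 / |a| := by
    rw [lt_div_iff₀ (abs_pos.2 ha)]; linarith
  have := (abs_lt.1 h2).1
  linarith

theorem compl_interior_nonempty (h : IsHyperbolicSemiconj φ F l μ ν u s Hu Hs K) (c : ℝ) :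
    (interior {x | Hs x = c})ᶜ.Nonempty := by
  obtain ⟨y, hy⟩ := h.exists_Hs_lt c
  exact ⟨y, fun hy' => hy.ne' (interior_subset (s := {x | Hs x = c}) hy')⟩

/-- Along an orbit with small sum of Jacobians, a neighbourhood reaching the boundary of a level
set would be mapped into itself by a flow map composed with a translation. -/
theorem exists_lt_infDist_mul (h : IsHyperbolicSemiconj φ F l μ ν u s Hu Hs K) {a : ℝ} (ha : a ≠ 0)
    (hne : (uniformSet φ Hu a).Nonempty) : ∃ κ > 0, ∀ c, ∀ x ∈ interior {x | Hs x = c}, ∀ S,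
    (∀ n, ∑ j ∈ Finset.range n, jac φ j x ≤ S) →
      κ < 2 * Metric.infDist x (interior {x | Hs x = c})ᶜ * S := by
  obtain ⟨κ, hκ, C, hC, hcontr⟩ := h.flow.exists_contraction
  obtain ⟨L, hL, hLip⟩ := h.flow.exists_lipschitz_Icc (3 / 2)
  refine ⟨κ, hκ, fun c x hx S hS => ?_⟩
  by_contra! hcon
  obtain ⟨W, hW⟩ : ∃ W, W = interior {x | Hs x = c} := ⟨_, rfl⟩
  rw [← hW] at hx hcon
  have hWo : IsOpen W := hW ▸ isOpen_interior
  have hWne : Wᶜ.Nonempty := hW ▸ h.compl_interior_nonempty c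
  have hS1 : 0 < S := by
    have := hS 1
    simp only [Finset.range_one, Finset.sum_singleton, Nat.cast_zero, h.flow.jac_zero] at this
    linarith
  obtain ⟨r, hr⟩ : ∃ r, r = Metric.infDist x Wᶜ := ⟨_, rfl⟩
  have hr0 : 0 < r := by
    rw [hr]
    exact (hWo.isClosed_compl.notMem_iff_infDist_pos hWne).1 (by simpa using hx)
  obtain ⟨q, hqW, hq⟩ := hWo.isClosed_compl.exists_infDist_eq_dist hWne x
  rw [← hr] at hcon hq
  have hqx : ‖q - x‖ = r := by rw [hq, dist_comm, dist_eq_norm]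
  -- `q` is a nearest point of the complement of `W`. Continuity puts it on the level `c`, while
  -- `Hs` is not constant near it, so it has constant speed and is recurrent modulo the lattice.
  have hqc : Hs q = c := by
    have h1 : Metric.ball x r ⊆ {x | Hs x = c} :=
      (hr ▸ Metric.ball_infDist_compl_subset).trans (hW ▸ interior_subset)
    have h2 : q ∈ closure (Metric.ball x r) := by
      rw [closure_ball x hr0.ne', Metric.mem_closedBall, dist_comm, hq]
    exact (closure_minimal h1 (isClosed_eq h.continuous_Hs continuous_const)) h2
  have hqn : ∀ ε > 0, ∃ y ∈ Metric.ball q ε, Hs y ≠ Hs q := by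
    intro ε hε
    by_contra! hall
    exact hqW (hW ▸ mem_interior.2 ⟨_, fun y hy => (hall y hy).trans hqc, Metric.isOpen_ball,
      Metric.mem_ball_self hε⟩)
  have hqu := h.mem_uniformSet_of_forall_exists ha hne hqn
  have hJ : Tendsto (fun j : ℕ => jac φ j x) atTop (𝓝 0) :=
    (summable_of_sum_range_le (fun j => (h.flow.jac_pos j x).le) hS).tendsto_atTop_zero
  have hsmall : ∀ᶠ j : ℕ in atTop, 3 * L * C * jac φ j x < 1 / 2 := by
    have := (hJ.const_mul (3 * L * C))
    rw [mul_zero] at this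
    exact this.eventually_lt_const (by norm_num)
  obtain ⟨N, hN⟩ := eventually_atTop.1 hsmall
  -- The shadowing times `tq` advance by at most `3 / 2` per step, so a return after time `3 / 2 *
  -- (N + 1)` happens after at least `N` steps, when the contraction is already strong.
  obtain ⟨t, m, htN, hm, htq⟩ := h.exists_recurrence ha hqu hqn (half_pos hr0) (3 / 2 * (N + 1))
  have hball : ∀ z ∈ Metric.closedBall x (2 * r), ‖z - x‖ * S ≤ κ := fun z hz => by
    rw [mem_closedBall_iff_norm] at hz
    exact (mul_le_mul_of_nonneg_right hz hS1.le).trans hcon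
  have hqball : q ∈ Metric.closedBall x (2 * r) := by
    rw [mem_closedBall_iff_norm]; linarith
  obtain ⟨tq, htq0, htq1, htq2⟩ := hcontr x S hS q (hball q hqball)
  have hstep : ∀ n, tq n ≤ 3 / 2 * n ∧ (1 / 2 : ℝ) * n ≤ tq n := by
    intro n
    induction n with
    | zero => simp [htq0]
    | succ n ih =>
      have := abs_le.1 (htq1 n)
      push_cast
      constructor <;> linarith
  obtain ⟨j, hj1, hj2⟩ : ∃ j, tq j ≤ t ∧ t < tq (j + 1) := by
    classical
    have hex : ∃ n, t < tq n := by
      obtain ⟨n, hn⟩ := exists_nat_gt (2 * t)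
      exact ⟨n, by linarith [(hstep n).2]⟩
    have h0 : Nat.find hex ≠ 0 := by
      intro h0
      have := Nat.find_spec hex
      rw [h0, htq0] at this
      have hN0 : (0 : ℝ) ≤ N := N.cast_nonneg
      linarith
    obtain ⟨j, hj⟩ := Nat.exists_eq_succ_of_ne_zero h0
    refine ⟨j, not_lt.1 (Nat.find_min hex (by omega)), ?_⟩
    have := Nat.find_spec hex
    rwa [hj] at this
  have hjN : N ≤ j := by
    have := (hstep (j + 1)).1
    have h2 : (N : ℝ) + 1 < ((j + 1 : ℕ) : ℝ) := by linarith
    push_cast at h2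
    exact_mod_cast (by linarith : (N : ℝ) ≤ j)
  have hθ : t - tq j ∈ Icc (0 : ℝ) (3 / 2) := by
    have := abs_le.1 (htq1 j)
    constructor <;> linarith
  -- The image is within `r / 2` of the returned point by contraction, that point is within `r / 2`
  -- of `q` by recurrence, and `q` is at distance `r` from `x`. The ball thus maps into itself with
  -- `Hs` shifted by a nonzero constant, contradicting the existence of a maximum and a minimum of
  -- `Hs` on it.
  have hmap : ∀ z ∈ Metric.closedBall x (2 * r), ∃ z' ∈ Metric.closedBall x (2 * r),
      Hs z' = Hs z + s (intVec m) := by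
    intro z hz
    obtain ⟨tz, -, -, htz⟩ := hcontr x S hS z (hball z hz)
    refine ⟨φ (t - tq j) (φ (tz j) z) + intVec m, ?_, by rw [h.Hs_add, h.Hs_flow, h.Hs_flow]⟩
    rw [mem_closedBall_iff_norm] at hz ⊢
    have e1 : ‖φ (tz j) z - φ (tq j) q‖ ≤ 3 * C * jac φ j x * r := by
      have := norm_sub_le_norm_sub_add_norm_sub (φ (tz j) z) (φ j x) (φ (tq j) q)
      have h1 := htz j
      have h2 := htq2 j
      rw [hqx] at h2
      rw [norm_sub_rev] at h2
      have h3 : C * jac φ j x * ‖z - x‖ ≤ C * jac φ j x * (2 * r) :=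
        mul_le_mul_of_nonneg_left hz (mul_nonneg hC.le (h.flow.jac_pos _ _).le)
      linarith
    have e2 := hLip _ hθ (φ (tz j) z) (φ (tq j) q)
    rw [← h.flow.map_add _ _ q, sub_add_cancel] at e2
    have e3 : L * ‖φ (tz j) z - φ (tq j) q‖ ≤ 1 / 2 * r := by
      calc L * ‖φ (tz j) z - φ (tq j) q‖ ≤ L * (3 * C * jac φ j x * r) :=
            mul_le_mul_of_nonneg_left e1 hL.le
        _ = (3 * L * C * jac φ j x) * r := by ring
        _ ≤ 1 / 2 * r := mul_le_mul_of_nonneg_right (hN j hjN).le hr0.le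
    calc ‖φ (t - tq j) (φ (tz j) z) + intVec m - x‖
        = ‖(φ (t - tq j) (φ (tz j) z) - φ t q) + (φ t q + intVec m - q) + (q - x)‖ := by
          congr 1; abel
      _ ≤ ‖φ (t - tq j) (φ (tz j) z) - φ t q‖ + ‖φ t q + intVec m - q‖ + ‖q - x‖ := norm_add₃_le
      _ ≤ 2 * r := by linarith
  have hcomp : IsCompact (Metric.closedBall x (2 * r)) := isCompact_closedBall _ _
  obtain ⟨z₁, hz₁, hmax⟩ := hcomp.exists_isMaxOn ⟨q, hqball⟩ h.continuous_Hs.continuousOn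
  obtain ⟨z₂, hz₂, hmin⟩ := hcomp.exists_isMinOn ⟨q, hqball⟩ h.continuous_Hs.continuousOn
  obtain ⟨z₃, hz₃, h3⟩ := hmap z₁ hz₁
  obtain ⟨z₄, hz₄, h4⟩ := hmap z₂ hz₂
  have h5 := isMaxOn_iff.1 hmax z₃ hz₃
  have h6 := isMinOn_iff.1 hmin z₄ hz₄
  exact hm (by linarith)

theorem exists_le_jacSum (h : IsHyperbolicSemiconj φ F l μ ν u s Hu Hs K) {a : ℝ} (ha : a ≠ 0)
    (hne : (uniformSet φ Hu a).Nonempty) : ∃ κ > 0, ∀ c, ∀ x ∈ interior {x | Hs x = c},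
    ENNReal.ofReal (κ / Metric.infDist x (interior {x | Hs x = c})ᶜ) ≤ jacSum φ x := by
  obtain ⟨κ, hκ, hb⟩ := h.exists_lt_infDist_mul ha hne
  refine ⟨κ / 2, by positivity, fun c x hx => ?_⟩
  by_contra! hlt
  have hr : 0 < Metric.infDist x (interior {x | Hs x = c})ᶜ :=
    (isOpen_interior.isClosed_compl.notMem_iff_infDist_pos (h.compl_interior_nonempty c)).1
      (by simpa using hx)
  have htop : jacSum φ x ≠ ⊤ := (hlt.trans ENNReal.ofReal_lt_top).ne
  have h1 := hb c x hx (jacSum φ x).toReal fun n => by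
    rw [← ENNReal.ofReal_le_iff_le_toReal htop,
      ENNReal.ofReal_sum_of_nonneg fun (j : ℕ) _ => (h.flow.jac_pos j x).le]
    exact ENNReal.sum_le_tsum _
  have h2 := (ENNReal.lt_ofReal_iff_toReal_lt htop).1 hlt
  rw [lt_div_iff₀ hr] at h2
  linarith

/-- The level sets of `Hs` have empty interior. -/
theorem interior_level_eq_empty (h : IsHyperbolicSemiconj φ F l μ ν u s Hu Hs K) {a : ℝ}
    (ha : a ≠ 0) (hne : (uniformSet φ Hu a).Nonempty) (c : ℝ) :
    interior {x | Hs x = c} = ∅ := by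
  obtain ⟨κ, hκ, hS⟩ := h.exists_le_jacSum ha hne
  have hS := hS c
  have hfin := fun Q => h.lintegral_jacSum_lt_top (c := c) (Q := Q)
  by_contra hW0
  obtain ⟨y, hy⟩ := nonempty_iff_ne_empty.2 hW0
  have hbd : ∀ x ∈ interior {x | Hs x = c}, |c - s x| ≤ K := fun x hx => by
    have h1 : Hs x = c := interior_subset (s := {x | Hs x = c}) hx
    rw [← h1]; exact h.abs_Hs_sub_le x
  have hWo : IsOpen (interior {x | Hs x = c}) := isOpen_interior
  generalize interior {x | Hs x = c} = W at *
  obtain ⟨δ, hδ, hball⟩ := Metric.isOpen_iff.1 hWo y hy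
  set e : Fin 2 → ℝ := intVec ![1, 0] with he
  have hse : 0 < |s e| := abs_pos.2 fun h0 => by
    have := congrFun (h.irrational _ h0) 0
    simp at this
  have hK := h.K_nonneg
  -- On `W` the coordinate `s` varies by at most `2 * K`, and `s e ≠ 0` by irrationality, so a
  -- horizontal displacement by `T` leaves `W`.
  obtain ⟨T, hT⟩ : ∃ T, T = 2 * K / |s e| + 1 := ⟨_, rfl⟩
  have hT0 : 0 < T := by rw [hT]; positivity
  have hexit : ∀ p ∈ W, p + T • e ∉ W := fun p hp hp' => by
    have h1 := abs_le.1 (hbd p hp)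
    have h2 := abs_le.1 (hbd _ hp')
    rw [s.map_add, s.map_smul, smul_eq_mul] at h2
    have h3 : |T * s e| ≤ 2 * K := abs_le.2 ⟨by linarith, by linarith⟩
    rw [abs_mul, abs_of_pos hT0, ← le_div_iff₀ hse] at h3
    linarith
  have hemem : ∀ x η τ : ℝ, ![x, η] + τ • e = ![x + τ, η] := fun x η τ => by
    ext i; fin_cases i <;> simp [he, intVec]
  have henorm : ‖e‖ ≤ 1 := (pi_norm_le_iff_of_nonneg zero_le_one).2 fun i => by
    fin_cases i <;> simp [he, intVec]
  set Q := Metric.closedBall y (δ + T) with hQ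
  have hlt := hfin Q (isCompact_closedBall _ _)
  rw [← lintegral_indicator (hWo.measurableSet.inter Metric.isClosed_closedBall.measurableSet)] at hlt
  have hmeas : Measurable ((W ∩ Q).indicator (jacSum φ)) :=
    h.flow.measurable_jacSum.indicator
      (hWo.measurableSet.inter Metric.isClosed_closedBall.measurableSet)
  rw [← (volume_preserving_finTwoArrow ℝ).symm.lintegral_comp hmeas, Measure.volume_eq_prod,
    lintegral_prod_symm' (fun p => (W ∩ Q).indicator (jacSum φ) (MeasurableEquiv.finTwoArrow.symm p))
      (hmeas.comp (MeasurableEquiv.measurable _))] at hlt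
  simp only [MeasurableEquiv.finTwoArrow_symm_apply] at hlt
  -- Let `b` be the first exit of the horizontal line from `W`. The distance from `![x, η]` to the
  -- complement is at most `b - x`, so the integrand dominates `κ / (b - x)`, whose integral up to
  -- `b` diverges.
  have hinner : ∀ η ∈ Ioo (y 1 - δ) (y 1 + δ),
      ∫⁻ x : ℝ, (W ∩ Q).indicator (jacSum φ) ![x, η] = ⊤ := by
    intro η hη
    have hp : ![y 0, η] ∈ Metric.ball y δ := by
      rw [mem_ball_iff_norm, pi_norm_lt_iff hδ]
      intro i
      fin_cases i
      · simpa using hδ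
      · simp only [Fin.mk_one, Pi.sub_apply, Matrix.cons_val_one,
          Real.norm_eq_abs, Matrix.cons_val_fin_one]
        exact abs_lt.2 ⟨by linarith [hη.1], by linarith [hη.2]⟩
    have hline : Continuous fun x : ℝ => (![x, η] : Fin 2 → ℝ) := by
      refine continuous_pi fun i => ?_
      fin_cases i
      · exact continuous_id
      · exact continuous_const
    set Z : Set ℝ := {x | y 0 ≤ x ∧ ![x, η] ∈ Wᶜ} with hZ
    have hZc : IsClosed Z := isClosed_Ici.inter (hWo.isClosed_compl.preimage hline)
    have hZT : y 0 + T ∈ Z := ⟨by linarith, by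
      have := hexit _ (hball hp)
      rwa [hemem] at this⟩
    have hZb : BddBelow Z := ⟨y 0, fun x hx => hx.1⟩
    obtain ⟨b, hb⟩ : ∃ b, b = sInf Z := ⟨_, rfl⟩
    have hbZ : b ∈ Z := hb ▸ hZc.csInf_mem ⟨_, hZT⟩ hZb
    have hbT : b ≤ y 0 + T := hb ▸ csInf_le hZb hZT
    have hyb : y 0 < b := hbZ.1.lt_of_ne fun h0 => hbZ.2 (h0 ▸ hball hp)
    have hin : ∀ x ∈ Ioo (y 0) b, ![x, η] ∈ W := fun x hx => by
      by_contra hx'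
      exact (not_le.2 hx.2) (hb ▸ csInf_le hZb ⟨hx.1.le, hx'⟩)
    rw [← top_le_iff, ← lintegral_inv_sub_eq_top hyb hκ, ← lintegral_indicator measurableSet_Ioo]
    refine lintegral_mono fun x => ?_
    by_cases hx : x ∈ Ioo (y 0) b
    · have hxQ : ![x, η] ∈ Q := by
        have h1 : ![x, η] - ![y 0, η] = (x - y 0) • e := by
          rw [sub_eq_iff_eq_add', hemem, add_sub_cancel]
        have h2 : ‖![x, η] - ![y 0, η]‖ ≤ T := by
          rw [h1, norm_smul, Real.norm_of_nonneg (sub_nonneg.2 hx.1.le)]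
          have : x - y 0 ≤ T := by linarith [hx.2]
          have h0 : 0 ≤ x - y 0 := sub_nonneg.2 hx.1.le
          nlinarith
        rw [hQ, mem_closedBall_iff_norm]
        have h3 := norm_sub_le_norm_sub_add_norm_sub ![x, η] ![y 0, η] y
        have h4 := mem_ball_iff_norm.1 hp
        linarith
      rw [indicator_of_mem hx, indicator_of_mem (show ![x, η] ∈ W ∩ Q from ⟨hin x hx, hxQ⟩)]
      refine le_trans (ENNReal.ofReal_le_ofReal ?_) (hS _ (hin x hx))
      have hr : 0 < Metric.infDist ![x, η] Wᶜ :=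
        (hWo.isClosed_compl.notMem_iff_infDist_pos ⟨_, hbZ.2⟩).1 (by simpa using hin x hx)
      refine div_le_div_of_nonneg_left hκ.le hr ((Metric.infDist_le_dist_of_mem hbZ.2).trans ?_)
      have h1 : ![b, η] - ![x, η] = (b - x) • e := by
        rw [sub_eq_iff_eq_add', hemem, add_sub_cancel]
      rw [dist_comm, dist_eq_norm, h1, norm_smul, Real.norm_of_nonneg (sub_nonneg.2 hx.2.le)]
      exact mul_le_of_le_one_right (sub_nonneg.2 hx.2.le) henorm
    · rw [indicator_of_notMem hx]; exact zero_le
  refine hlt.ne (top_le_iff.1 ?_)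
  calc (⊤ : ENNReal) = ∫⁻ η in Ioo (y 1 - δ) (y 1 + δ), ⊤ := by
        rw [setLIntegral_const, Real.volume_Ioo, ENNReal.top_mul]
        simpa using hδ
    _ = ∫⁻ η in Ioo (y 1 - δ) (y 1 + δ), ∫⁻ x : ℝ, (W ∩ Q).indicator (jacSum φ) ![x, η] :=
        setLIntegral_congr_fun measurableSet_Ioo fun η hη => (hinner η hη).symm
    _ ≤ _ := setLIntegral_le_lintegral _ _

/-- A hyperbolic semiconjugacy is bijective, and uniformly expands the flow. -/
theorem bijective_and_uniform (h : IsHyperbolicSemiconj φ F l μ ν u s Hu Hs K) :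
    ∃ a ≠ 0, (∀ t x, Hu (φ t x) = Hu x + a * t) ∧
      (∀ x y, Hu x = Hu y → Hs x = Hs y → x = y) ∧ ∀ α β, ∃ x, Hu x = α ∧ Hs x = β := by
  obtain ⟨a, ha, hne⟩ := h.exists_mem_uniformSet
  have hint := h.interior_level_eq_empty ha hne
  have huni := h.forall_mem_uniformSet ha hne hint
  exact ⟨a, ha, fun t x => huni x t, fun x y => h.pair_injective ha hint huni,
    h.pair_surjective ha huni⟩

end IsHyperbolicSemiconj

end

/-! ### Spectrum of integer matrices with determinant `±1`. -/

theorem linAct_intVec (A : Matrix (Fin 2) (Fin 2) ℤ) (m : Fin 2 → ℤ) :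
    linAct A (intVec m) = intVec (A.mulVec m) := by
  ext i
  simp [linAct, intVec, Matrix.mulVec, dotProduct]

theorem linAct_apply_zero (A : Matrix (Fin 2) (Fin 2) ℤ) (x : Fin 2 → ℝ) :
    linAct A x 0 = A 0 0 * x 0 + A 0 1 * x 1 := by
  simp [linAct, Matrix.mulVec, dotProduct]

theorem linAct_apply_one (A : Matrix (Fin 2) (Fin 2) ℤ) (x : Fin 2 → ℝ) :
    linAct A x 1 = A 1 0 * x 0 + A 1 1 * x 1 := by
  simp [linAct, Matrix.mulVec, dotProduct]

theorem linAct_add (A : Matrix (Fin 2) (Fin 2) ℤ) (x y : Fin 2 → ℝ) :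
    linAct A (x + y) = linAct A x + linAct A y := Matrix.mulVec_add _ _ _

theorem linAct_sub (A : Matrix (Fin 2) (Fin 2) ℤ) (x y : Fin 2 → ℝ) :
    linAct A (x - y) = linAct A x - linAct A y := Matrix.mulVec_sub _ _ _

theorem continuous_linAct (A : Matrix (Fin 2) (Fin 2) ℤ) : Continuous (linAct A) := by
  refine continuous_pi fun i => ?_
  simp only [linAct, Matrix.mulVec, dotProduct]
  fun_prop

theorem linAct_mul (A B : Matrix (Fin 2) (Fin 2) ℤ) (x : Fin 2 → ℝ) :
    linAct (A * B) x = linAct A (linAct B x) := by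
  rw [linAct, linAct, linAct, Matrix.mulVec_mulVec]
  congr 1
  exact Matrix.map_mul (f := Int.castRingHom ℝ)

theorem exists_norm_linAct_le (A : Matrix (Fin 2) (Fin 2) ℤ) :
    ∃ C > 0, ∀ x, ‖linAct A x‖ ≤ C * ‖x‖ := by
  obtain ⟨C, hC, h⟩ := (Matrix.toLin' (A.map (Int.cast : ℤ → ℝ))).toContinuousLinearMap.bound
  exact ⟨C, hC, fun x => h x⟩

/-- The eigenvalues `μ` (expanding) and `ν` (contracting) of `A`. -/
structure IsSpectralPair (A : Matrix (Fin 2) (Fin 2) ℤ) (μ ν : ℝ) : Prop where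
  add : μ + ν = A 0 0 + A 1 1
  mul : μ * ν = A 0 0 * A 1 1 - A 0 1 * A 1 0
  one_lt_mu : 1 < |μ|
  nu_pos : 0 < |ν|
  nu_lt_one : |ν| < 1

theorem exists_roots {t d Δ : ℝ} (hd : |d| = 1) (hΔ : t ^ 2 - 4 * d = Δ) (hpos : 0 ≤ Δ)
    (h : 2 < |t| + √Δ) : ∃ μ ν : ℝ, μ + ν = t ∧ μ * ν = d ∧ 1 < |μ| ∧ 0 < |ν| ∧ |ν| < 1 := by
  have hs := Real.sq_sqrt hpos
  have key : ∀ μ ν : ℝ, μ + ν = t → μ * ν = d → 1 < |μ| →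
      ∃ μ ν : ℝ, μ + ν = t ∧ μ * ν = d ∧ 1 < |μ| ∧ 0 < |ν| ∧ |ν| < 1 := by
    intro μ ν h1 h2 h3
    have h4 : |μ| * |ν| = 1 := by rw [← abs_mul, h2, hd]
    have h5 : 0 < |ν| := by
      refine (abs_nonneg _).lt_of_ne fun h0 => ?_
      rw [← h0, mul_zero] at h4
      exact zero_ne_one h4
    exact ⟨μ, ν, h1, h2, h3, h5, by nlinarith⟩
  rcases le_total 0 t with ht | ht
  · rw [abs_of_nonneg ht] at h
    refine key ((t + √Δ) / 2) ((t - √Δ) / 2) (by ring) (by linear_combination (-1 / 4 : ℝ) * hs + (1 / 4 : ℝ) * hΔ) ?_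
    exact lt_of_lt_of_le (by linarith) (le_abs_self _)
  · rw [abs_of_nonpos ht] at h
    refine key ((t - √Δ) / 2) ((t + √Δ) / 2) (by ring) (by linear_combination (-1 / 4 : ℝ) * hs + (1 / 4 : ℝ) * hΔ) ?_
    exact lt_of_lt_of_le (by linarith) (neg_le_abs _)

theorem mul_self_eq_trace_sub (A : Matrix (Fin 2) (Fin 2) ℤ) :
    A * A = (A 0 0 + A 1 1) • A - A.det • (1 : Matrix (Fin 2) (Fin 2) ℤ) := by
  ext i j
  fin_cases i <;> fin_cases j <;>
    simp [Matrix.mul_apply, Fin.sum_univ_two, Matrix.det_fin_two, -zsmul_eq_mul, -zsmul_one] <;> ring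

theorem pow_sub_one_mul_self {R : Type*} [Ring R] {N : R} (h : (N - 1) * (N - 1) = 0) (n : ℕ) :
    (N ^ n - 1) * (N ^ n - 1) = 0 := by
  nth_rw 1 [← geom_sum_mul]
  rw [← mul_geom_sum, mul_assoc, ← mul_assoc (N - 1), h, zero_mul, mul_zero]

/-- Trace and determinant decide. The nonhyperbolic traces are `|t| ≤ 2` for determinant `1` and `t
= 0` for determinant `-1`. By Cayley–Hamilton the matrix then has order dividing `12`, or it or its
square is unipotent. -/
theorem exists_isSpectralPair_or (A : Matrix.GeneralLinearGroup (Fin 2) ℤ) :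
    (∃ μ ν, IsSpectralPair A.val μ ν) ∨ (A.val ^ 12 - 1) * (A.val ^ 12 - 1) = 0 := by
  obtain ⟨M, hM⟩ : ∃ M, M = A.val := ⟨_, rfl⟩
  have hdet : M.det = 1 ∨ M.det = -1 := by
    rw [hM]; exact Int.isUnit_iff.1 ((Matrix.isUnit_iff_isUnit_det _).1 A.isUnit)
  rw [← hM]
  obtain ⟨t, ht⟩ : ∃ t, t = M 0 0 + M 1 1 := ⟨_, rfl⟩
  have hsq := mul_self_eq_trace_sub M
  rw [← ht] at hsq
  have htr : (t : ℝ) = M 0 0 + M 1 1 := by rw [ht]; push_cast; rfl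
  have hdr : ((M.det : ℤ) : ℝ) = M 0 0 * M 1 1 - M 0 1 * M 1 0 := by
    rw [Matrix.det_fin_two]; push_cast; rfl
  have good : ∀ Δ : ℝ, (t : ℝ) ^ 2 - 4 * (M.det : ℤ) = Δ → 0 ≤ Δ → 2 < |(t : ℝ)| + √Δ →
      ∃ μ ν, IsSpectralPair M μ ν := fun Δ h1 h2 h3 => by
    have hd : |((M.det : ℤ) : ℝ)| = 1 := by rcases hdet with h | h <;> simp [h]
    obtain ⟨μ, ν, e1, e2, e3, e4, e5⟩ := exists_roots hd h1 h2 h3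
    exact ⟨μ, ν, e1.trans htr, e2.trans hdr, e3, e4, e5⟩
  have per : ∀ k n : ℕ, M ^ k = 1 → k * n = 12 → (M ^ 12 - 1) * (M ^ 12 - 1) = 0 := by
    intro k n h1 h2
    rw [← h2, pow_mul, h1, one_pow, sub_self, zero_mul]
  rcases hdet with hd | hd
  · rw [hd, one_smul] at hsq
    by_cases h3 : 3 ≤ |t|
    · left
      have h3' : (3 : ℝ) ≤ |(t : ℝ)| := by exact_mod_cast h3
      refine good _ rfl ?_ ?_
      · rw [hd, ← sq_abs (t : ℝ)]; push_cast; nlinarith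
      · linarith [Real.sqrt_nonneg ((t : ℝ) ^ 2 - 4 * (M.det : ℤ))]
    · right
      have h2 : -2 ≤ t ∧ t ≤ 2 := abs_le.1 (by omega)
      obtain ⟨hl, hu⟩ := h2
      have hcases : t = -2 ∨ t = -1 ∨ t = 0 ∨ t = 1 ∨ t = 2 := by omega
      clear good ht htr
      rcases hcases with rfl | rfl | rfl | rfl | rfl
      · have h4 : (M ^ 2 - 1) * (M ^ 2 - 1) = 0 := by
          have h5 : M ^ 2 = (-2 : ℤ) • M - 1 := by rw [sq, hsq]
          have : (M ^ 2 - 1) * (M ^ 2 - 1) = 4 • (M * M) + 8 • M + 4 • (1 : Matrix (Fin 2) (Fin 2) ℤ) := by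
            rw [h5]; noncomm_ring
          rw [this, hsq]; noncomm_ring
        have := pow_sub_one_mul_self h4 6
        rwa [← pow_mul] at this
      · refine per 3 4 ?_ rfl
        have : M ^ 3 = M * M * M := by rw [pow_succ, sq]
        rw [this, hsq, sub_mul, smul_mul_assoc, hsq]; noncomm_ring
      · refine per 4 3 ?_ rfl
        rw [show 4 = 2 * 2 from rfl, pow_mul, sq M, hsq]; simp
      · refine per 6 2 ?_ rfl
        have : M ^ 3 = M * M * M := by rw [pow_succ, sq]
        rw [show 6 = 3 * 2 from rfl, pow_mul, this, hsq, sub_mul, smul_mul_assoc, hsq]; noncomm_ring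
      · refine pow_sub_one_mul_self ?_ 12
        have : (M - 1) * (M - 1) = M * M - 2 • M + 1 := by noncomm_ring
        rw [this, hsq]; noncomm_ring
  · by_cases h0 : t = 0
    · right
      refine per 2 6 ?_ rfl
      rw [sq, hsq, h0, hd]; simp
    · left
      have h1 : (1 : ℝ) ≤ |(t : ℝ)| := by exact_mod_cast Int.one_le_abs h0
      refine good _ rfl ?_ ?_
      · rw [hd]; push_cast; nlinarith [sq_nonneg (t : ℝ)]
      · have : (2 : ℝ) ≤ √((t : ℝ) ^ 2 - 4 * (M.det : ℤ)) := by
          refine Real.le_sqrt_of_sq_le ?_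
          rw [hd, ← sq_abs (t : ℝ)]; push_cast; nlinarith
        linarith

namespace IsSpectralPair

variable {A : Matrix (Fin 2) (Fin 2) ℤ} {μ ν : ℝ}

/-- The left eigenvector of `A` for the eigenvalue `μ`, as a functional. -/
def leftEigen (A : Matrix (Fin 2) (Fin 2) ℤ) (μ : ℝ) : (Fin 2 → ℝ) →L[ℝ] ℝ :=
  (A 1 0 : ℝ) • ContinuousLinearMap.proj 0 + (μ - A 0 0) • ContinuousLinearMap.proj 1

theorem leftEigen_apply (A : Matrix (Fin 2) (Fin 2) ℤ) (μ : ℝ) (x : Fin 2 → ℝ) :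
    leftEigen A μ x = A 1 0 * x 0 + (μ - A 0 0) * x 1 := by
  simp [leftEigen]

theorem leftEigen_linAct_of_root (hμ : (μ - A 0 0) * (μ - A 1 1) = A 0 1 * A 1 0) (x : Fin 2 → ℝ) :
    leftEigen A μ (linAct A x) = μ * leftEigen A μ x := by
  simp only [leftEigen_apply, linAct_apply_zero, linAct_apply_one]
  linear_combination -x 1 * hμ

theorem leftEigen_mu (h : IsSpectralPair A μ ν) (x : Fin 2 → ℝ) :
    leftEigen A μ (linAct A x) = μ * leftEigen A μ x :=
  leftEigen_linAct_of_root (by linear_combination μ * h.add - h.mul) x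

theorem leftEigen_nu (h : IsSpectralPair A μ ν) (x : Fin 2 → ℝ) :
    leftEigen A ν (linAct A x) = ν * leftEigen A ν x :=
  leftEigen_linAct_of_root (by linear_combination ν * h.add - h.mul) x

theorem mu_ne_nu (h : IsSpectralPair A μ ν) : μ ≠ ν := by
  rintro rfl
  exact absurd (h.one_lt_mu.trans h.nu_lt_one) (lt_irrefl _)

/-- With a zero entry the eigenvalues would be the integer diagonal entries, but `0 < |ν| < 1`.
Nonvanishing keeps the formula for `leftEigen` nondegenerate. -/
theorem apply_one_zero_ne (h : IsSpectralPair A μ ν) : A 1 0 ≠ 0 := by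
  intro h0
  have h1 : (μ - A 0 0) * (μ - A 1 1) = 0 := by
    have : ((A 1 0 : ℤ) : ℝ) = 0 := by rw [h0, Int.cast_zero]
    linear_combination μ * h.add - h.mul + A 0 1 * this
  have key : ∀ a b : ℤ, μ = a → ν = b → False := fun a b ha hb => by
    have h2 := h.nu_pos
    have h3 := h.nu_lt_one
    rw [hb] at h2 h3
    have h4 : |b| < 1 := by exact_mod_cast h3
    rw [Int.abs_lt_one_iff.1 h4] at h2
    simp at h2
  rcases mul_eq_zero.1 h1 with h2 | h2
  · exact key (A 0 0) (A 1 1) (by linarith) (by linarith [h.add])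
  · exact key (A 1 1) (A 0 0) (by linarith) (by linarith [h.add])

theorem inj (h : IsSpectralPair A μ ν) (x y : Fin 2 → ℝ) (hu : leftEigen A μ x = leftEigen A μ y)
    (hs : leftEigen A ν x = leftEigen A ν y) : x = y := by
  simp only [leftEigen_apply] at hu hs
  have h1 : (μ - ν) * (x 1 - y 1) = 0 := by linear_combination hu - hs
  have h2 : x 1 = y 1 := by
    have := (mul_eq_zero.1 h1).resolve_left (sub_ne_zero.2 h.mu_ne_nu)
    linarith
  have h3 : ((A 1 0 : ℤ) : ℝ) * (x 0 - y 0) = 0 := by rw [h2] at hu; linear_combination hu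
  have h4 : x 0 = y 0 := by
    have := (mul_eq_zero.1 h3).resolve_left (by exact_mod_cast h.apply_one_zero_ne)
    linarith
  ext i
  fin_cases i
  · exact h4
  · exact h2

theorem linAct_eq_smul (h : IsSpectralPair A μ ν) {v : Fin 2 → ℝ} (hv : leftEigen A ν v = 0) :
    linAct A v = μ • v :=
  h.inj _ _ (by rw [h.leftEigen_mu, map_smul, smul_eq_mul])
    (by rw [h.leftEigen_nu, map_smul, hv, mul_zero, smul_zero])

theorem mem_expandingSubspace_iff (h : IsSpectralPair A μ ν) {v : Fin 2 → ℝ} :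
    v ∈ expandingSubspace A ↔ leftEigen A ν v = 0 := by
  constructor
  · intro hv
    have hle : expandingSubspace A ≤ (leftEigen A ν).toLinearMap.ker := by
      refine iSup₂_le fun κ hκ w hw => ?_
      have h1 : linAct A w = κ • w := Module.End.mem_eigenspace_iff.1 hw
      have h2 := h.leftEigen_nu w
      rw [h1, map_smul, smul_eq_mul] at h2
      have h3 : (κ - ν) * leftEigen A ν w = 0 := by linear_combination h2
      refine (mul_eq_zero.1 h3).resolve_left (sub_ne_zero.2 ?_)
      rintro rfl
      exact lt_asymm h.nu_lt_one hκ
    exact hle hv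
  · intro hv
    refine Submodule.mem_iSup_of_mem μ (Submodule.mem_iSup_of_mem h.one_lt_mu ?_)
    exact Module.End.mem_eigenspace_iff.2 (h.linAct_eq_smul hv)

theorem isHyperbolicMatrix (h : IsSpectralPair A μ ν) : IsHyperbolicMatrix A := by
  intro z hz
  rw [Matrix.mem_spectrum_iff_isRoot_charpoly, Polynomial.IsRoot, Matrix.charpoly_fin_two] at hz
  simp only [Polynomial.eval_add, Polynomial.eval_sub, Polynomial.eval_pow, Polynomial.eval_X,
    Polynomial.eval_mul, Polynomial.eval_C, Matrix.trace_fin_two, Matrix.det_fin_two,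
    Matrix.map_apply] at hz
  have h1 : (μ : ℂ) + ν = A 0 0 + A 1 1 := by exact_mod_cast congrArg (Complex.ofReal) h.add
  have h2 : (μ : ℂ) * ν = A 0 0 * A 1 1 - A 0 1 * A 1 0 := by
    exact_mod_cast congrArg (Complex.ofReal) h.mul
  have h3 : (z - μ) * (z - ν) = 0 := by linear_combination hz - z * h1 + h2
  rcases mul_eq_zero.1 h3 with h4 | h4
  · rw [sub_eq_zero.1 h4, Complex.norm_real, Real.norm_eq_abs]; exact h.one_lt_mu.ne'
  · rw [sub_eq_zero.1 h4, Complex.norm_real, Real.norm_eq_abs]; exact h.nu_lt_one.ne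

/-- A lattice vector killed by the contracting functional lies on the expanding line. The inverse of
`A` shrinks it repeatedly while keeping it in the lattice and nonzero, which is impossible. -/
theorem irrational {A : Matrix.GeneralLinearGroup (Fin 2) ℤ} (h : IsSpectralPair A.val μ ν)
    (m : Fin 2 → ℤ) (hm : leftEigen A.val ν (intVec m) = 0) : m = 0 := by
  by_contra hne
  have hμ0 : μ ≠ 0 := fun h0 => by
    have := h.one_lt_mu
    rw [h0, abs_zero] at this
    linarith
  have hν0 : ν ≠ 0 := abs_pos.1 h.nu_pos
  have key : ∀ n : ℕ, ∃ k : Fin 2 → ℤ, k ≠ 0 ∧ leftEigen A.val ν (intVec k) = 0 ∧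
      leftEigen A.val μ (intVec k) = μ⁻¹ ^ n * leftEigen A.val μ (intVec m) := by
    intro n
    induction n with
    | zero => exact ⟨m, hne, hm, by simp⟩
    | succ n ih =>
      obtain ⟨k, hk, hk1, hk2⟩ := ih
      have hAk : A.val.mulVec ((A⁻¹).val.mulVec k) = k := by
        rw [Matrix.mulVec_mulVec, ← Units.val_mul, mul_inv_cancel, Units.val_one, Matrix.one_mulVec]
      have h1 := h.leftEigen_nu (intVec ((A⁻¹).val.mulVec k))
      have h2 := h.leftEigen_mu (intVec ((A⁻¹).val.mulVec k))
      rw [linAct_intVec, hAk] at h1 h2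
      refine ⟨(A⁻¹).val.mulVec k, fun h0 => hk ?_, ?_, ?_⟩
      · rw [← hAk, h0, Matrix.mulVec_zero]
      · rw [hk1] at h1
        exact (mul_eq_zero.1 h1.symm).resolve_left hν0
      · rw [pow_succ, mul_assoc, mul_comm μ⁻¹, ← mul_assoc, ← hk2, h2]
        field_simp
  obtain ⟨C, hC, hb⟩ := exists_norm_le_of_pair_injective h.inj
  have hlim : Tendsto (fun n : ℕ => C * (|μ⁻¹| ^ n * |leftEigen A.val μ (intVec m)|)) atTop (𝓝 0) := by
    have := ((tendsto_pow_atTop_nhds_zero_of_lt_one (abs_nonneg μ⁻¹) (by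
      rw [abs_inv]; exact inv_lt_one_of_one_lt₀ h.one_lt_mu)).mul_const
        |leftEigen A.val μ (intVec m)|).const_mul C
    rwa [zero_mul, mul_zero] at this
  obtain ⟨n, hn⟩ := (hlim.eventually_lt_const one_pos).exists
  obtain ⟨k, hk, hk1, hk2⟩ := key n
  have h1 := hb (intVec k) (|μ⁻¹| ^ n * |leftEigen A.val μ (intVec m)|)
    (by rw [hk2, abs_mul, abs_pow]) (by rw [hk1, abs_zero]; positivity)
  linarith [one_le_norm_intVec hk]

end IsSpectralPair

/-! ### Hyperbolicity of the action on homology. -/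

/-- A homeomorphism of the plane, lifting a torus map with matrix `A`, that rescales the
time of a free flow by `l`. -/
structure IsScaledFlow (φ : ℝ → (Fin 2 → ℝ) → (Fin 2 → ℝ)) (F : (Fin 2 → ℝ) ≃ₜ (Fin 2 → ℝ))
    (l : ℝ) (A : Matrix.GeneralLinearGroup (Fin 2) ℤ) : Prop where
  flow : IsPlaneFlow φ
  free : ∀ x t, φ t x = x → t = 0
  one_lt : 1 < l
  conj : ∀ t x, F (φ t x) = φ (l * t) (F x)
  map_add : ∀ x m, F (x + intVec m) = F x + intVec (A.val.mulVec m)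

/-- A perturbed unipotent recursion grows at most quadratically. -/
theorem norm_le_of_unipotent_recursion {N : (Fin 2 → ℝ) → (Fin 2 → ℝ)}
    (hadd : ∀ x y, N (x + y) = N x + N y) (hN : ∀ x, N (N x) = 0) {D C : ℝ} (hD : 0 ≤ D)
    (hC : 0 ≤ C) (hb : ∀ x, ‖N x‖ ≤ D * ‖x‖) {e : ℕ → Fin 2 → ℝ}
    (he : ∀ n, ‖e (n + 1) - (e n + N (e n))‖ ≤ C) (n : ℕ) :
    ‖e n‖ ≤ (‖e 0‖ * (1 + D) + C * (1 + D)) * (n + 1) ^ 2 := by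
  -- Since `N` squares to zero, `N (e n)` only accumulates the errors and grows linearly; summing
  -- once more gives quadratic growth of `e n`.
  have h1 : ∀ n : ℕ, ‖N (e n)‖ ≤ (‖e 0‖ + C) * D * (n + 1) := by
    intro n
    induction n with
    | zero => have := hb (e 0); simp; nlinarith [mul_nonneg hC hD]
    | succ n ih =>
      have h2 : N (e (n + 1)) = N (e n) + N (e (n + 1) - (e n + N (e n))) := by
        have : N (e (n + 1)) = N (e n + N (e n)) + N (e (n + 1) - (e n + N (e n))) := by
          rw [← hadd]; congr 1; abel
        rw [this, hadd, hN, add_zero]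
      have h3 := (hb _).trans (mul_le_mul_of_nonneg_left (he n) hD)
      rw [h2]
      refine (norm_add_le _ _).trans ?_
      push_cast
      nlinarith [mul_nonneg (norm_nonneg (e 0)) hD]
  induction n with
  | zero => simp; nlinarith [mul_nonneg (norm_nonneg (e 0)) hD, mul_nonneg hC hD]
  | succ n ih =>
    have h2 : ‖e (n + 1)‖ ≤ ‖e n‖ + ‖N (e n)‖ + C := by
      have := norm_le_norm_add_norm_sub' (e (n + 1)) (e n + N (e n))
      have h3 := norm_add_le (e n) (N (e n))
      have h4 := he n
      linarith
    have h3 := h1 n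
    have hn : (0 : ℝ) ≤ n := n.cast_nonneg
    have p1 := mul_nonneg (norm_nonneg (e 0)) hD
    have p2 := mul_nonneg hC hD
    push_cast
    nlinarith [norm_nonneg (e 0), mul_nonneg hC hn, mul_nonneg p1 hn, mul_nonneg p2 hn,
      mul_nonneg (norm_nonneg (e 0)) hn]

namespace IsScaledFlow

variable {φ : ℝ → (Fin 2 → ℝ) → (Fin 2 → ℝ)} {F : (Fin 2 → ℝ) ≃ₜ (Fin 2 → ℝ)} {l : ℝ}
  {A : Matrix.GeneralLinearGroup (Fin 2) ℤ}

theorem iterate_add (h : IsScaledFlow φ F l A) (n : ℕ) (x : Fin 2 → ℝ) (m : Fin 2 → ℤ) :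
    F^[n] (x + intVec m) = F^[n] x + intVec ((A.val ^ n).mulVec m) := by
  induction n with
  | zero => simp
  | succ n ih =>
    rw [Function.iterate_succ_apply', ih, h.map_add, Function.iterate_succ_apply',
      Matrix.mulVec_mulVec, pow_succ']

theorem iterate_flow (h : IsScaledFlow φ F l A) (n : ℕ) (t : ℝ) (x : Fin 2 → ℝ) :
    F^[n] (φ t x) = φ (l ^ n * t) (F^[n] x) := by
  induction n with
  | zero => simp
  | succ n ih =>
    rw [Function.iterate_succ_apply', ih, h.conj, Function.iterate_succ_apply', pow_succ']
    congr 1; ring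

theorem exists_iterate_sub_bound (h : IsScaledFlow φ F l A) (n : ℕ) : ∃ C > 0, ∀ x,
    ‖F^[n] x - linAct (A.val ^ n) x‖ ≤ C := by
  obtain ⟨C, hC, hb⟩ := exists_norm_le_of_periodic (T := {0}) isCompact_singleton
    (g := fun _ x => F^[n] x - linAct (A.val ^ n) x)
    (((F.continuous.iterate n).sub (continuous_linAct _)).comp continuous_snd) (fun _ x m => by
      rw [h.iterate_add, linAct_add, linAct_intVec]; abel)
  exact ⟨C, hC, hb 0 rfl⟩

/-- In the unipotent case differences of points under `F^[12]` grow at most quadratically. The image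
of an arc of unit duration after `n` steps fits in a box of side of order `n ^ 2` but has duration
`(l ^ 12) ^ n`, which violates packing. -/
theorem exists_isSpectralPair (h : IsScaledFlow φ F l A) : ∃ μ ν, IsSpectralPair A.val μ ν := by
  refine (exists_isSpectralPair_or A).resolve_right fun hnil => ?_
  have hl : 0 < l := zero_lt_one.trans h.one_lt
  obtain ⟨N, hN⟩ : ∃ N, N = A.val ^ 12 - 1 := ⟨_, rfl⟩
  rw [← hN] at hnil
  obtain ⟨D, hD, hDb⟩ := exists_norm_linAct_le N
  obtain ⟨C, hC, hCb⟩ := h.exists_iterate_sub_bound 12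
  obtain ⟨V, hV, hVb⟩ := h.flow.exists_velocity_bound
  obtain ⟨B, hB, hpack⟩ := h.flow.exists_packing_bound h.free
    (u := ContinuousLinearMap.proj 0) (s := ContinuousLinearMap.proj 1)
    (fun x y h0 h1 => by ext i; fin_cases i; exacts [h0, h1])
  have hrec : ∀ x y, ‖F^[12] x - F^[12] y - ((x - y) + linAct N (x - y))‖ ≤ 2 * C := fun x y => by
    have h1 : (x - y) + linAct N (x - y) = linAct (A.val ^ 12) x - linAct (A.val ^ 12) y := by
      have h2 : A.val ^ 12 = 1 + N := by rw [hN]; abel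
      have h3 : ∀ z, linAct (1 + N) z = z + linAct N z := fun z => by
        ext i; fin_cases i <;> simp [linAct_apply_zero, linAct_apply_one] <;> ring
      rw [h2, ← linAct_sub, h3]
    rw [h1, sub_sub_sub_comm]
    exact (norm_sub_le _ _).trans (by linarith [hCb x, hCb y])
  have hgrow : ∀ (n : ℕ) x y, ‖x - y‖ ≤ V →
      ‖(F^[12])^[n] x - (F^[12])^[n] y‖ ≤ ((V + 2 * C) * (1 + D)) * (n + 1) ^ 2 := by
    intro n x y hxy
    have := norm_le_of_unipotent_recursion (linAct_add N)
      (fun x => by rw [← linAct_mul, hnil]; ext i; fin_cases i <;> simp [linAct_apply_zero, linAct_apply_one])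
      hD.le (by positivity : 0 ≤ 2 * C) hDb (e := fun n => (F^[12])^[n] x - (F^[12])^[n] y)
      (fun n => by simp only [Function.iterate_succ_apply']; exact hrec _ _) n
    refine this.trans ?_
    simp only [Function.iterate_zero, id_eq]
    rw [← add_mul]
    gcongr
  have hle : ∀ n : ℕ, (l ^ 12) ^ n ≤ 1 + B * ((V + 2 * C) * (1 + D) + 1) ^ 2 * (n + 1) ^ 4 := by
    intro n
    obtain ⟨R, hR⟩ : ∃ R, R = ((V + 2 * C) * (1 + D)) * ((n : ℝ) + 1) ^ 2 := ⟨_, rfl⟩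
    have hR0 : 0 ≤ R := by rw [hR]; positivity
    have hp0 : 0 < (l ^ 12) ^ n := by positivity
    have hdisp : ∀ j : ℕ, j ≤ ⌊(l ^ 12) ^ n⌋₊ → ‖φ j ((F^[12])^[n] 0) - (F^[12])^[n] 0‖ ≤ R := by
      intro j hj
      have h1 : φ j ((F^[12])^[n] 0) = (F^[12])^[n] (φ (j / (l ^ 12) ^ n) 0) := by
        rw [← Function.iterate_mul, h.iterate_flow, pow_mul, mul_div_cancel₀ _ hp0.ne']
      rw [h1, hR]
      refine hgrow n _ _ ?_
      have h2 := h.flow.norm_sub_le hVb 0 (j / (l ^ 12) ^ n) 0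
      simp only [h.flow.map_zero, sub_zero] at h2
      rw [abs_of_nonneg (by positivity)] at h2
      rw [sub_zero]
      refine h2.trans (mul_le_of_le_one_right hV.le ((div_le_one hp0).2 ?_))
      exact (Nat.cast_le.2 hj).trans (Nat.floor_le hp0.le)
    have h1 := hpack _ _ R R hR0 hR0
      (fun j hj => (norm_le_pi_norm (φ j ((F^[12])^[n] 0) - (F^[12])^[n] 0) 0).trans (hdisp j hj))
      (fun j hj => (norm_le_pi_norm (φ j ((F^[12])^[n] 0) - (F^[12])^[n] 0) 1).trans (hdisp j hj))
    have h2 := Nat.lt_floor_add_one ((l ^ 12) ^ n)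
    have h3 : R + 1 ≤ ((V + 2 * C) * (1 + D) + 1) * ((n : ℝ) + 1) ^ 2 := by
      have : (1 : ℝ) ≤ ((n : ℝ) + 1) ^ 2 := one_le_pow₀ (by linarith [n.cast_nonneg (α := ℝ)])
      rw [hR]; linarith
    have h4 : B * (R + 1) * (R + 1) ≤ B * ((V + 2 * C) * (1 + D) + 1) ^ 2 * (n + 1) ^ 4 := by
      calc B * (R + 1) * (R + 1) ≤ B * (((V + 2 * C) * (1 + D) + 1) * ((n : ℝ) + 1) ^ 2)
            * (((V + 2 * C) * (1 + D) + 1) * ((n : ℝ) + 1) ^ 2) := by gcongr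
        _ = _ := by ring
    linarith
  have hlim : Tendsto (fun n : ℕ => ((n : ℝ) + 1) ^ 4 / (l ^ 12) ^ n) atTop (𝓝 0) := by
    have h1 : 1 < l ^ 12 := one_lt_pow₀ h.one_lt (by norm_num)
    have := ((tendsto_pow_const_div_const_pow_of_one_lt 4 h1).comp (tendsto_add_atTop_nat 1)).mul_const
      (l ^ 12)
    rw [zero_mul] at this
    refine this.congr fun n => ?_
    simp only [Function.comp_apply, Nat.cast_add, Nat.cast_one]
    rw [pow_succ (l ^ 12)]
    field_simp
  obtain ⟨κ, hκ⟩ : ∃ κ, κ = 1 + B * ((V + 2 * C) * (1 + D) + 1) ^ 2 := ⟨_, rfl⟩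
  have hκ0 : 0 < κ := by rw [hκ]; positivity
  obtain ⟨n, hn⟩ := (hlim.eventually_lt_const (inv_pos.2 hκ0)).exists
  have hp0 : 0 < (l ^ 12) ^ n := by positivity
  rw [div_lt_iff₀ hp0, inv_mul_eq_div, lt_div_iff₀ hκ0] at hn
  have h1 := hle n
  have h2 : (1 : ℝ) ≤ ((n : ℝ) + 1) ^ 4 := one_le_pow₀ (by linarith [n.cast_nonneg (α := ℝ)])
  rw [hκ] at hn
  nlinarith

end IsScaledFlow

/-! ### Lifting the torus action to the plane. -/

section

theorem torusProj_eq_iff {x y : Fin 2 → ℝ} :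
    torusProj x = torusProj y ↔ ∃ m, y = x + intVec m := by
  constructor
  · intro h
    have : ∀ i, ∃ n : ℤ, y i = x i + n := fun i => by
      have h1 : ((y i - x i : ℝ) : UnitAddCircle) = 0 := by
        rw [AddCircle.coe_sub, sub_eq_zero]; exact (congrFun h i).symm
      obtain ⟨n, hn⟩ := (AddCircle.coe_eq_zero_iff 1).1 h1
      exact ⟨n, by rw [zsmul_one] at hn; linarith⟩
    choose m hm using this
    exact ⟨m, funext hm⟩
  · rintro ⟨m, rfl⟩
    funext i
    simp [torusProj, intVec]

theorem torusProj_add_intVec (x : Fin 2 → ℝ) (m : Fin 2 → ℤ) :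
    torusProj (x + intVec m) = torusProj x := (torusProj_eq_iff.2 ⟨m, rfl⟩).symm

theorem continuous_torusProj : Continuous torusProj :=
  continuous_pi fun i => (AddCircle.continuous_mk' 1).comp (continuous_apply i)

theorem surjective_torusProj : Function.Surjective torusProj := fun z => by
  choose x hx using fun i => QuotientAddGroup.mk_surjective (z i)
  exact ⟨x, funext hx⟩

theorem isQuotientMap_torusProj : IsQuotientMap torusProj := by
  have h : IsOpenQuotientMap (Pi.map fun (_ : Fin 2) (x : ℝ) => (x : UnitAddCircle)) :=
    IsOpenQuotientMap.piMap fun _ => QuotientAddGroup.isOpenQuotientMap_mk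
  exact h.isQuotientMap

theorem torusProj_add (x y : Fin 2 → ℝ) : torusProj (x + y) = torusProj x + torusProj y := rfl

theorem torusProj_linAct (A : Matrix (Fin 2) (Fin 2) ℤ) (x : Fin 2 → ℝ) :
    torusProj (linAct A x) = torusLin A (torusProj x) := by
  funext i
  simp only [torusProj, torusLin, linAct, Matrix.mulVec, dotProduct, Fin.sum_univ_two,
    Matrix.map_apply, AddCircle.coe_add]
  simp only [← zsmul_eq_mul, AddCircle.coe_zsmul]

section Lifting

variable {X : Type*} [TopologicalSpace X]

theorem eq_of_torusProj_eq [PreconnectedSpace X] {f g : X → Fin 2 → ℝ} (hf : Continuous f)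
    (hg : Continuous g) (h : ∀ x, torusProj (f x) = torusProj (g x)) (x₀ : X) (h0 : f x₀ = g x₀) :
    f = g := by
  have key : ∀ i, (fun x => f x i) = fun x => g x i := fun i =>
    (AddCircle.isCoveringMap_coe (1 : ℝ)).eq_of_comp_eq ((continuous_apply i).comp hf)
      ((continuous_apply i).comp hg) (funext fun x => congrFun (h x) i) x₀ (congrFun h0 i)
  exact funext fun x => funext fun i => congrFun (key i) x

theorem exists_eq_add_intVec [PreconnectedSpace X] [Nonempty X] {f g : X → Fin 2 → ℝ}
    (hf : Continuous f) (hg : Continuous g) (h : ∀ x, torusProj (f x) = torusProj (g x)) :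
    ∃ m, ∀ x, g x = f x + intVec m := by
  obtain ⟨x₀⟩ := ‹Nonempty X›
  obtain ⟨m, hm⟩ := torusProj_eq_iff.1 (h x₀)
  have := eq_of_torusProj_eq (g := fun x => f x + intVec m) hg (hf.add continuous_const)
    (fun x => by rw [torusProj_add_intVec]; exact (h x).symm) x₀ hm
  exact ⟨m, congrFun this⟩

theorem exists_torus_lift [SimplyConnectedSpace X] [LocallyPathConnectedSpace X] {g : X → Torus2}
    (hg : Continuous g) (x₀ : X) (e₀ : Fin 2 → ℝ) (h0 : torusProj e₀ = g x₀) :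
    ∃ G : X → Fin 2 → ℝ, Continuous G ∧ G x₀ = e₀ ∧ ∀ x, torusProj (G x) = g x := by
  have key : ∀ i, ∃ G : X → ℝ, Continuous G ∧ G x₀ = e₀ i ∧ ∀ x, (G x : UnitAddCircle) = g x i := by
    intro i
    obtain ⟨G, ⟨h1, h2⟩, -⟩ := (AddCircle.isCoveringMap_coe (1 : ℝ)).existsUnique_continuousMap_lifts
      ⟨fun x => g x i, (continuous_apply i).comp hg⟩ x₀ (e₀ i) (congrFun h0 i)
    exact ⟨G, G.continuous, h1, congrFun h2⟩
  choose G h1 h2 h3 using key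
  exact ⟨fun x i => G i x, continuous_pi h1, funext h2, fun x => funext fun i => h3 i x⟩

end Lifting

theorem IsTorusContDiff.continuous {r : WithTop ℕ∞} {Φ : ℝ × Torus2 → Torus2}
    (h : IsTorusContDiff r Φ) :
    Continuous fun p : ℝ × (Fin 2 → ℝ) => Φ (p.1, torusProj p.2) := by
  refine continuous_iff_continuousAt.2 fun p => ?_
  obtain ⟨G, hG, heq⟩ := h p
  exact (continuous_torusProj.continuousAt.comp hG.continuousAt).congr heq

/-- A continuous lift differs from a local smooth lift by an integer vector. By continuity this
vector is locally constant, as nonzero integer vectors have norm at least `1`. -/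
theorem IsTorusContDiff.contDiff_lift {r : WithTop ℕ∞} {Φ : ℝ × Torus2 → Torus2}
    (h : IsTorusContDiff r Φ) {G : ℝ × (Fin 2 → ℝ) → Fin 2 → ℝ} (hG : Continuous G)
    (hlift : ∀ p, torusProj (G p) = Φ (p.1, torusProj p.2)) : ContDiff ℝ r G := by
  refine contDiff_iff_contDiffAt.2 fun p => ?_
  obtain ⟨G', hG', heq⟩ := h p
  have hcont : ContinuousAt (fun q => G q - G' q) p := hG.continuousAt.sub hG'.continuousAt
  have hnear := Metric.continuousAt_iff'.1 hcont 1 one_pos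
  have hint : ∀ q, torusProj (G' q) = Φ (q.1, torusProj q.2) → ∃ m, G q - G' q = intVec m :=
    fun q hq => by
      obtain ⟨m, hm⟩ := torusProj_eq_iff.1 (hq.trans (hlift q).symm)
      exact ⟨m, by rw [hm, add_sub_cancel_left]⟩
  obtain ⟨m, hm⟩ := hint p heq.self_of_nhds
  refine (hG'.add (contDiffAt_const (c := intVec m))).congr_of_eventuallyEq ?_
  filter_upwards [heq, hnear] with q hq hq'
  obtain ⟨k, hk⟩ := hint q hq
  rw [hk, hm, dist_eq_norm, ← intVec_sub] at hq'
  have : k - m = 0 := by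
    by_contra hne
    exact not_lt.2 (one_le_norm_intVec hne) hq'
  rw [← sub_eq_zero.1 this, ← hk]
  simp

variable {l : ℝ} [Fact (1 < l)] {r : WithTop ℕ∞} {ρ : AbelByCyclic l →* Equiv.Perm Torus2}

theorem IsContDiffAction.continuous_torusProj_comp (hρ : IsContDiffAction r ρ) (m : ℤ) (t : ℝ) :
    Continuous fun x : Fin 2 → ℝ => ρ ⟨m, t⟩ (torusProj x) :=
  (hρ m).continuous.comp (f := fun x : Fin 2 → ℝ => (t, x)) (by fun_prop)

theorem AbelByCyclic.apply_mul (g k : AbelByCyclic l) (z : Torus2) : ρ (g * k) z = ρ g (ρ k z) := by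
  rw [map_mul]; rfl

theorem exists_isTorusLift (hρ : IsContDiffAction r ρ) (m : ℤ) :
    ∃ F, IsTorusLift (ρ ⟨m, 0⟩) F := by
  obtain ⟨e₀, h0⟩ := surjective_torusProj (ρ ⟨m, 0⟩ (torusProj 0))
  obtain ⟨G, h1, -, h2⟩ := exists_torus_lift (hρ.continuous_torusProj_comp m 0) 0 e₀ h0
  exact ⟨G, h1, h2⟩

/-- A lift of the generator is a homeomorphism. -/
theorem IsTorusLift.exists_homeomorph (hρ : IsContDiffAction r ρ) {F : (Fin 2 → ℝ) → (Fin 2 → ℝ)}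
    (hF : IsTorusLift (ρ ⟨1, 0⟩) F) : ∃ Fh : (Fin 2 → ℝ) ≃ₜ (Fin 2 → ℝ), ⇑Fh = F ∧
      ∀ x, torusProj (Fh.symm x) = ρ ⟨-1, 0⟩ (torusProj x) := by
  have e1 : ∀ z, ρ ⟨-1, 0⟩ (ρ ⟨1, 0⟩ z) = z := fun z => by
    rw [← AbelByCyclic.apply_mul, show (⟨-1, 0⟩ * ⟨1, 0⟩ : AbelByCyclic l) = 1 by
      ext <;> simp [AbelByCyclic.mul_def, AbelByCyclic.one_def], map_one]; rfl
  have e2 : ∀ z, ρ ⟨1, 0⟩ (ρ ⟨-1, 0⟩ z) = z := fun z => by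
    rw [← AbelByCyclic.apply_mul, show (⟨1, 0⟩ * ⟨-1, 0⟩ : AbelByCyclic l) = 1 by
      ext <;> simp [AbelByCyclic.mul_def, AbelByCyclic.one_def], map_one]; rfl
  obtain ⟨F', h1, h2, h3⟩ := exists_torus_lift (hρ.continuous_torusProj_comp (-1) 0) (F 0) 0
    (by rw [hF.2, e1])
  have h4 : (fun x => F' (F x)) = id := eq_of_torusProj_eq (h1.comp hF.1) continuous_id
    (fun x => by rw [h3, hF.2, e1]; rfl) 0 h2
  have h5 : (fun x => F (F' x)) = id := eq_of_torusProj_eq (hF.1.comp h1) continuous_id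
    (fun x => by rw [hF.2, h3, e2]; rfl) (F 0) (by simp only [h2, id_eq])
  exact ⟨⟨⟨F, F', congrFun h4, congrFun h5⟩, hF.1, h1⟩, rfl, h3⟩

/-- A lift of a torus map acts on deck translations through an integer matrix. -/
theorem exists_homology_matrix {F : (Fin 2 → ℝ) → (Fin 2 → ℝ)} (hF : Continuous F)
    (hper : ∀ x m, torusProj (F (x + intVec m)) = torusProj (F x)) :
    ∃ A : Matrix (Fin 2) (Fin 2) ℤ, ∀ x m, F (x + intVec m) = F x + intVec (A.mulVec m) := by
  have hk : ∀ m, ∃ k, ∀ x, F (x + intVec m) = F x + intVec k := fun m =>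
    exists_eq_add_intVec hF (hF.comp (continuous_id.add continuous_const)) fun x => (hper x m).symm
  choose k hk using hk
  let κ : (Fin 2 → ℤ) →+ (Fin 2 → ℤ) := AddMonoidHom.mk' k fun m n => by
    apply intVec_injective
    have := hk (m + n) 0
    rw [intVec_add, ← add_assoc, hk n, hk m, add_assoc, add_left_cancel_iff] at this
    rw [← this, intVec_add]
  refine ⟨LinearMap.toMatrix' κ.toIntLinearMap, fun x m => ?_⟩
  rw [LinearMap.toMatrix'_mulVec]
  exact hk m x

theorem exists_generalLinear_matrix (hρ : IsContDiffAction r ρ) :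
    ∃ A : Matrix.GeneralLinearGroup (Fin 2) ℤ, ∀ F, IsTorusLift (ρ ⟨1, 0⟩) F →
      ∀ x m, F (x + intVec m) = F x + intVec (A.val.mulVec m) := by
  obtain ⟨F₀, hF₀⟩ := exists_isTorusLift hρ 1
  obtain ⟨Fh, rfl, hinv⟩ := hF₀.exists_homeomorph hρ
  obtain ⟨A, hA⟩ := exists_homology_matrix Fh.continuous
    (fun x m => by rw [hF₀.2, hF₀.2, torusProj_add_intVec])
  obtain ⟨B, hB⟩ := exists_homology_matrix Fh.symm.continuous
    (fun x m => by rw [hinv, hinv, torusProj_add_intVec])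
  have hext : ∀ M : Matrix (Fin 2) (Fin 2) ℤ, (∀ m, M.mulVec m = m) → M = 1 := fun M hM =>
    Matrix.ext_of_mulVec_single fun i => by rw [hM, Matrix.one_mulVec]
  have hAB : A * B = 1 := hext _ fun m => by
    apply intVec_injective
    have h1 := hB (Fh 0) m
    rw [Fh.symm_apply_apply, Fh.symm_apply_eq, hA, Matrix.mulVec_mulVec, add_left_cancel_iff] at h1
    exact h1.symm
  have hBA : B * A = 1 := hext _ fun m => by
    apply intVec_injective
    have h1 := hB (Fh 0) (A.mulVec m)
    rw [← hA, Fh.symm_apply_apply, Fh.symm_apply_apply, Matrix.mulVec_mulVec,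
      add_left_cancel_iff] at h1
    exact h1.symm
  refine ⟨⟨A, B, hAB, hBA⟩, fun F hF x m => ?_⟩
  obtain ⟨k, hk⟩ := exists_eq_add_intVec Fh.continuous hF.1 (fun x => by rw [hF.2, hF₀.2])
  rw [hk, hk, hA, add_right_comm]

/-- Otherwise `t ↦ (0, t)` would be a nonconstant continuous map from the line into a discrete
stabilizer. -/
theorem exists_flow_ne (hfree : IsLocallyFree ρ) (z : Torus2) : ∃ t : ℝ, ρ ⟨0, t⟩ z ≠ z := by
  by_contra! hcon
  have := hfree z
  let f : ℝ → {g : AbelByCyclic l | ρ g z = z} := fun t => ⟨⟨0, t⟩, hcon t⟩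
  have hf : Continuous f := by
    refine Continuous.subtype_mk ?_ _
    exact continuous_induced_rng.2 (continuous_const.prodMk continuous_id)
  have h1 : f 0 = f 1 := PreconnectedSpace.constant inferInstance hf
  have h2 : (0 : ℝ) = 1 := congrArg (fun g => g.1.t) h1
  exact zero_ne_one h2

/-- The flow of the action lifts to a flow of the plane. -/
theorem exists_isPlaneFlow (hr : 2 ≤ r) (hρ : IsContDiffAction r ρ) (hfree : IsLocallyFree ρ) :
    ∃ φ, IsPlaneFlow φ ∧ ∀ t x, torusProj (φ t x) = ρ ⟨0, t⟩ (torusProj x) := by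
  have e0 : ∀ z, ρ ⟨0, 0⟩ z = z := fun z => by
    rw [show (⟨0, 0⟩ : AbelByCyclic l) = 1 from rfl, map_one]; rfl
  obtain ⟨Ψ, hc, h0, hΨ'⟩ := exists_torus_lift (hρ 0).continuous (0, 0) 0 (by simp only [e0])
  have hcd : ContDiff ℝ 2 Ψ := ((hρ 0).contDiff_lift hc hΨ').of_le hr
  have hΨ : ∀ t x, torusProj (Ψ (t, x)) = ρ ⟨0, t⟩ (torusProj x) := fun t x => hΨ' (t, x)
  have hcx : ∀ t, Continuous fun x => Ψ (t, x) := fun t => hc.comp (by fun_prop)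
  have hct : ∀ x, Continuous fun t => Ψ (t, x) := fun x => hc.comp (by fun_prop)
  have hzero : ∀ x, Ψ (0, x) = x := congrFun <|
    eq_of_torusProj_eq (hcx 0) continuous_id (fun x => by rw [hΨ, e0]) 0 h0
  have hadd : ∀ t₁ t₂ x, Ψ (t₁ + t₂, x) = Ψ (t₁, Ψ (t₂, x)) := fun t₁ t₂ x => by
    refine congrFun (eq_of_torusProj_eq (f := fun t₁ => Ψ (t₁ + t₂, x))
      (g := fun t₁ => Ψ (t₁, Ψ (t₂, x))) ((hct x).comp (by fun_prop)) (hct _) (fun t => ?_) 0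
        (by simp only [zero_add, hzero])) t₁
    rw [hΨ, hΨ, hΨ, ← AbelByCyclic.apply_mul]
    congr 2
    ext <;> simp [AbelByCyclic.mul_def, add_comm]
  have hequi : ∀ t x m, Ψ (t, x + intVec m) = Ψ (t, x) + intVec m := fun t x m => by
    refine congrFun (eq_of_torusProj_eq (f := fun t => Ψ (t, x + intVec m))
      (g := fun t => Ψ (t, x) + intVec m) (hct _) ((hct _).add continuous_const) (fun t => ?_) 0
        (by simp only [hzero])) t
    rw [torusProj_add_intVec, hΨ, hΨ, torusProj_add_intVec]
  refine ⟨fun t x => Ψ (t, x), ⟨hcd, hzero, hadd, hequi, fun x hx => ?_⟩, hΨ⟩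
  have hdiff : ∀ y, HasDerivAt (fun t => Ψ (t, y)) (deriv (fun t => Ψ (t, y)) 0) 0 := fun y =>
    (((hcd.comp (contDiff_id.prodMk contDiff_const)).differentiable two_ne_zero) 0).hasDerivAt
  -- Differentiating the group law propagates a zero velocity from time `0` to all times, so `x`
  -- would be stationary.
  have hderiv : ∀ t, HasDerivAt (fun t => Ψ (t, x)) 0 t := fun t => by
    have h1 := hdiff x
    rw [hx] at h1
    have h2 : HasFDerivAt (fun y => Ψ (t, y)) (fderiv ℝ (fun y => Ψ (t, y)) x) (Ψ (0, x)) := by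
      rw [hzero]
      exact (((hcd.comp (contDiff_const.prodMk contDiff_id)).differentiable two_ne_zero) x).hasFDerivAt
    have h3 := h2.comp_hasDerivAt (0 : ℝ) h1
    rw [map_zero] at h3
    have h4 : ((fun y => Ψ (t, y)) ∘ fun t => Ψ (t, x)) = fun a => Ψ (t + a, x) := by
      funext a; simp only [Function.comp_apply, hadd]
    rw [h4] at h3
    have h5 := HasDerivAt.comp_sub_const (f := fun a => Ψ (t + a, x)) t t (by rwa [sub_self])
    simpa using h5
  obtain ⟨t, ht⟩ := exists_flow_ne hfree (torusProj x)
  apply ht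
  have hconst : Ψ (t, x) = Ψ (0, x) :=
    is_const_of_deriv_eq_zero (fun t => (hderiv t).differentiableAt) (fun t => (hderiv t).deriv) t 0
  have := hΨ t x
  rw [hconst, hzero] at this
  exact this.symm

/-- The lifted flow has no periodic points, and a lift of the generator rescales its time. -/
theorem IsTorusLift.exists_isScaledFlow (hρ : IsContDiffAction r ρ)
    {φ : ℝ → (Fin 2 → ℝ) → (Fin 2 → ℝ)} (hφ : IsPlaneFlow φ)
    (hlift : ∀ t x, torusProj (φ t x) = ρ ⟨0, t⟩ (torusProj x))
    {A : Matrix.GeneralLinearGroup (Fin 2) ℤ} {F : (Fin 2 → ℝ) → (Fin 2 → ℝ)}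
    (hF : IsTorusLift (ρ ⟨1, 0⟩) F)
    (hA : ∀ x m, F (x + intVec m) = F x + intVec (A.val.mulVec m)) :
    ∃ Fh : (Fin 2 → ℝ) ≃ₜ (Fin 2 → ℝ), ⇑Fh = F ∧ IsScaledFlow φ Fh l A := by
  have hl : 1 < l := Fact.out
  have hl0 : 0 < l := zero_lt_one.trans hl
  obtain ⟨Fh, rfl, -⟩ := hF.exists_homeomorph hρ
  have hct : ∀ x, Continuous fun t => φ t x := fun x =>
    hφ.continuous_comp continuous_id continuous_const
  have hconj : ∀ t x, Fh (φ t x) = φ (l * t) (Fh x) := fun t x => by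
    refine congrFun (eq_of_torusProj_eq (f := fun t => Fh (φ t x)) (g := fun t => φ (l * t) (Fh x))
      (Fh.continuous.comp (hct x)) ((hct _).comp (by fun_prop)) (fun t => ?_) 0
      (by simp only [mul_zero, hφ.map_zero])) t
    rw [hF.2, hlift, hlift, hF.2, ← AbelByCyclic.apply_mul, ← AbelByCyclic.apply_mul]
    congr 2
    ext <;> simp [AbelByCyclic.mul_def]
  refine ⟨Fh, rfl, hφ, fun x t hx => ?_, hl, hconj, hA⟩
  -- Pulling a periodic point back by `F` divides its period by `l`; small nonzero periods are ruled
  -- out by `exists_strictMonoOn`.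
  have hper : ∀ n : ℕ, ∃ y, φ (t / l ^ n) y = y := by
    intro n
    induction n with
    | zero => exact ⟨x, by simpa using hx⟩
    | succ n ih =>
      obtain ⟨y, hy⟩ := ih
      refine ⟨Fh.symm y, Fh.injective ?_⟩
      rw [hconj, Fh.apply_symm_apply, pow_succ, show l * (t / (l ^ n * l)) = t / l ^ n by
        field_simp, hy]
  obtain ⟨a, ha, -, hmono⟩ := hφ.exists_strictMonoOn one_pos
  have hlim : Tendsto (fun n : ℕ => t / l ^ n) atTop (𝓝 0) :=
    tendsto_const_nhds.div_atTop (tendsto_pow_atTop_atTop_of_one_lt hl)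
  obtain ⟨n, hn⟩ := (hlim.eventually (Icc_mem_nhds (neg_neg_of_pos ha) ha)).exists
  obtain ⟨y, hy⟩ := hper n
  have h1 := (hmono y).injOn hn ⟨(neg_neg_of_pos ha).le, ha.le⟩ (by
    simp only [hy, hφ.map_zero])
  exact (div_eq_zero_iff.1 h1).resolve_right (pow_ne_zero _ hl0.ne')

end

/-! ### Existence of the semiconjugacy and descent to the torus. -/

section

/-- The bounded solution of a twisted cohomological equation over a map of the torus. -/
theorem exists_periodic_solution {G : (Fin 2 → ℝ) → (Fin 2 → ℝ)} (hG : Continuous G)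
    (hGper : ∀ m, ∃ m', ∀ x, G (x + intVec m) = G x + intVec m') {g : (Fin 2 → ℝ) → ℝ}
    (hg : Continuous g) (hper : ∀ x m, g (x + intVec m) = g x) {κ : ℝ} (hκ : |κ| < 1) :
    ∃ w : (Fin 2 → ℝ) → ℝ, Continuous w ∧ (∀ x m, w (x + intVec m) = w x) ∧
      (∃ K, ∀ x, |w x| ≤ K) ∧ ∀ x, w x = κ * w (G x) + g x := by
  obtain ⟨C, hC, hb⟩ := exists_norm_le_of_periodic (T := {0}) isCompact_singleton
    (g := fun _ => g) (hg.comp continuous_snd) (fun _ => hper)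
  have hb := hb 0 rfl
  have hbn : ∀ (n : ℕ) x, ‖κ ^ n * g (G^[n] x)‖ ≤ |κ| ^ n * C := fun n x => by
    rw [norm_mul, norm_pow, Real.norm_eq_abs]
    gcongr
    exact hb _
  have hs : Summable fun n : ℕ => |κ| ^ n * C :=
    (summable_geometric_of_lt_one (abs_nonneg κ) hκ).mul_right C
  have hiter : ∀ n : ℕ, ∀ m, ∃ m', ∀ x, G^[n] (x + intVec m) = G^[n] x + intVec m' := by
    intro n
    induction n with
    | zero => exact fun m => ⟨m, fun x => rfl⟩
    | succ n ih =>
      intro m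
      obtain ⟨m₁, h1⟩ := ih m
      obtain ⟨m₂, h2⟩ := hGper m₁
      exact ⟨m₂, fun x => by rw [Function.iterate_succ_apply', h1, h2, Function.iterate_succ_apply']⟩
  refine ⟨fun x => ∑' n : ℕ, κ ^ n * g (G^[n] x),
    continuous_tsum (fun n => continuous_const.mul (hg.comp (hG.iterate n))) hs hbn,
    fun x m => tsum_congr fun n => ?_,
    ⟨∑' n : ℕ, |κ| ^ n * C, fun x => tsum_of_norm_bounded hs.hasSum fun n => hbn n x⟩, fun x => ?_⟩
  · obtain ⟨m', h⟩ := hiter n m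
    rw [h, hper]
  · have h1 : Summable fun n : ℕ => κ ^ n * g (G^[n] x) := .of_norm_bounded hs fun n => hbn n x
    beta_reduce
    rw [h1.tsum_eq_zero_add, ← tsum_mul_left, add_comm]
    simp only [pow_zero, one_mul, Function.iterate_zero, id_eq, Function.iterate_succ_apply,
      pow_succ', mul_assoc]

open IsSpectralPair

namespace IsScaledFlow

variable {φ : ℝ → (Fin 2 → ℝ) → (Fin 2 → ℝ)} {F : (Fin 2 → ℝ) ≃ₜ (Fin 2 → ℝ)} {l : ℝ}
  {A : Matrix.GeneralLinearGroup (Fin 2) ℤ} {μ ν : ℝ}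

theorem symm_add (h : IsScaledFlow φ F l A) (x : Fin 2 → ℝ) (m : Fin 2 → ℤ) :
    F.symm (x + intVec m) = F.symm x + intVec ((A⁻¹).val.mulVec m) := by
  rw [F.symm_apply_eq, h.map_add, F.apply_symm_apply, Matrix.mulVec_mulVec, ← Units.val_mul,
    mul_inv_cancel, Units.val_one, Matrix.one_mulVec]

theorem leftEigen_mulVec_of {κ : ℝ}
    (hκ : ∀ x, leftEigen A.val κ (linAct A.val x) = κ * leftEigen A.val κ x) (m : Fin 2 → ℤ) :
    leftEigen A.val κ (intVec (A.val.mulVec m)) = κ * leftEigen A.val κ (intVec m) := by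
  rw [← linAct_intVec, hκ]

theorem isHyperbolicSemiconj (h : IsScaledFlow φ F l A) (hA : IsSpectralPair A.val μ ν)
    {Hu Hs : (Fin 2 → ℝ) → ℝ} {K : ℝ} (hu : Continuous Hu) (hs : Continuous Hs)
    (hu_add : ∀ x m, Hu (x + intVec m) = Hu x + leftEigen A.val μ (intVec m))
    (hs_add : ∀ x m, Hs (x + intVec m) = Hs x + leftEigen A.val ν (intVec m))
    (hu_sub : ∀ x, |Hu x - leftEigen A.val μ x| ≤ K)
    (hs_sub : ∀ x, |Hs x - leftEigen A.val ν x| ≤ K)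
    (hu_map : ∀ x, Hu (F x) = μ * Hu x) (hs_map : ∀ x, Hs (F x) = ν * Hs x) :
    IsHyperbolicSemiconj φ F l μ ν (leftEigen A.val μ) (leftEigen A.val ν) Hu Hs K where
  flow := h.flow
  free := h.free
  one_lt := h.one_lt
  conj := h.conj
  one_lt_mu := hA.one_lt_mu
  nu_pos := hA.nu_pos
  nu_lt_one := hA.nu_lt_one
  inj := hA.inj
  irrational := hA.irrational
  lattice := fun m => ⟨A.val.mulVec m, leftEigen_mulVec_of hA.leftEigen_mu m,
    leftEigen_mulVec_of hA.leftEigen_nu m⟩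
  continuous_Hu := hu
  continuous_Hs := hs
  Hu_add := hu_add
  Hs_add := hs_add
  abs_Hu_sub_le := hu_sub
  abs_Hs_sub_le := hs_sub
  Hu_map := hu_map
  Hs_map := hs_map

theorem isHyperbolicSemiconj_comp (h : IsScaledFlow φ F l A) (hA : IsSpectralPair A.val μ ν)
    {H : (Fin 2 → ℝ) → (Fin 2 → ℝ)} (hH : IsFranksSemiconj F A.val H) :
    ∃ K, IsHyperbolicSemiconj φ F l μ ν (leftEigen A.val μ) (leftEigen A.val ν)
      (fun x => leftEigen A.val μ (H x)) (fun x => leftEigen A.val ν (H x)) K := by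
  obtain ⟨K, hK⟩ := hH.bounded
  have hK0 : 0 ≤ K := (norm_nonneg _).trans (hK 0).le
  refine ⟨(‖leftEigen A.val μ‖ + ‖leftEigen A.val ν‖) * K, h.isHyperbolicSemiconj hA
    ((leftEigen A.val μ).continuous.comp hH.continuous)
    ((leftEigen A.val ν).continuous.comp hH.continuous)
    (fun x m => by rw [hH.equivariant, _root_.map_add])
    (fun x m => by rw [hH.equivariant, _root_.map_add])
    (fun x => ?_) (fun x => ?_)
    (fun x => by rw [hH.semiconj, hA.leftEigen_mu])
    (fun x => by rw [hH.semiconj, hA.leftEigen_nu])⟩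
  · rw [← _root_.map_sub, ← Real.norm_eq_abs]
    refine ((leftEigen A.val μ).le_opNorm _).trans ?_
    have := norm_nonneg (leftEigen A.val ν)
    gcongr
    · linarith
    · exact (hK x).le
  · rw [← _root_.map_sub, ← Real.norm_eq_abs]
    refine ((leftEigen A.val ν).le_opNorm _).trans ?_
    have := norm_nonneg (leftEigen A.val μ)
    gcongr
    · linarith
    · exact (hK x).le

/-- Existence of a Franks semiconjugacy. -/
theorem exists_isFranksSemiconj (h : IsScaledFlow φ F l A) (hA : IsSpectralPair A.val μ ν) :
    ∃ H, IsFranksSemiconj F A.val H := by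
  obtain ⟨u, hu⟩ : ∃ u, u = leftEigen A.val μ := ⟨_, rfl⟩
  obtain ⟨s, hs⟩ : ∃ s, s = leftEigen A.val ν := ⟨_, rfl⟩
  have hμ0 : μ ≠ 0 := abs_pos.1 (zero_lt_one.trans hA.one_lt_mu)
  have hul : ∀ x, u (linAct A.val x) = μ * u x := fun x => by rw [hu, hA.leftEigen_mu]
  have hsl : ∀ x, s (linAct A.val x) = ν * s x := fun x => by rw [hs, hA.leftEigen_nu]
  -- `w` and `v` correct `u` and `s` to exact eigenfunctions of composition with `F`. The expanding
  -- equation converges along forward iterates with factor `μ⁻¹`, the contracting one along backward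
  -- iterates with factor `ν`.
  obtain ⟨w, hw1, hw2, ⟨K₁, hK₁⟩, hw3⟩ := exists_periodic_solution F.continuous
    (fun m => ⟨_, fun x => h.map_add x m⟩) (g := fun x => μ⁻¹ * (u (F x) - μ * u x))
    (continuous_const.mul ((u.continuous.comp F.continuous).sub
      (continuous_const.mul u.continuous)))
    (fun x m => by
      rw [h.map_add, u.map_add, u.map_add, ← linAct_intVec, hul]; ring) (κ := μ⁻¹)
    (by rw [abs_inv]; exact inv_lt_one_of_one_lt₀ hA.one_lt_mu)
  obtain ⟨v, hv1, hv2, ⟨K₂, hK₂⟩, hv3⟩ := exists_periodic_solution F.symm.continuous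
    (fun m => ⟨_, fun x => h.symm_add x m⟩) (g := fun x => ν * s (F.symm x) - s x)
    ((continuous_const.mul (s.continuous.comp F.symm.continuous)).sub s.continuous)
    (fun x m => by
      rw [h.symm_add, s.map_add, s.map_add, mul_add,
        ← hsl (intVec _), linAct_intVec, Matrix.mulVec_mulVec,
        ← Units.val_mul, mul_inv_cancel, Units.val_one, Matrix.one_mulVec]
      ring) (κ := ν) hA.nu_lt_one
  have hu_map : ∀ x, u (F x) + w (F x) = μ * (u x + w x) := fun x => by
    rw [hw3 x]; field_simp; ring
  have hs_map : ∀ x, s (F x) + v (F x) = ν * (s x + v x) := fun x => by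
    rw [hv3 (F x), F.symm_apply_apply]; ring
  have hyp := h.isHyperbolicSemiconj hA (Hu := fun x => u x + w x) (Hs := fun x => s x + v x)
    (K := max K₁ K₂) (u.continuous.add hw1) (s.continuous.add hv1)
    (fun x m => by rw [hw2, u.map_add, ← hu]; ring) (fun x m => by rw [hv2, s.map_add, ← hs]; ring)
    (fun x => by rw [← hu, add_sub_cancel_left]; exact (hK₁ x).trans (le_max_left _ _))
    (fun x => by rw [← hs, add_sub_cancel_left]; exact (hK₂ x).trans (le_max_right _ _))
    hu_map hs_map
  have hinj : ∀ x y, u x = u y → s x = s y → x = y := by rw [hu, hs]; exact hA.inj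
  obtain ⟨e₁, h11, h12⟩ := exists_eq_of_pair_injective hinj 1 0
  obtain ⟨e₂, h21, h22⟩ := exists_eq_of_pair_injective hinj 0 1
  obtain ⟨H, hH⟩ : ∃ H : (Fin 2 → ℝ) → (Fin 2 → ℝ),
      H = fun x => (u x + w x) • e₁ + (s x + v x) • e₂ := ⟨_, rfl⟩
  have hHu : ∀ x, u (H x) = u x + w x := fun x => by simp [hH, h11, h21]
  have hHs : ∀ x, s (H x) = s x + v x := fun x => by simp [hH, h12, h22]
  obtain ⟨C, hC, hCb⟩ := exists_norm_le_of_pair_injective hinj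
  refine ⟨H, ⟨?_, fun y => ?_, fun x m => hinj _ _ ?_ ?_, ⟨C * max K₁ K₂ + 1, fun x => ?_⟩,
    fun x => hinj _ _ ?_ ?_⟩⟩
  · rw [hH]
    exact ((u.continuous.add hw1).smul continuous_const).add
      ((s.continuous.add hv1).smul continuous_const)
  -- The corrected pair is already a hyperbolic semiconjugacy, so its surjectivity comes from the
  -- dynamics.
  · obtain ⟨-, -, -, -, hsurj⟩ := hyp.bijective_and_uniform
    obtain ⟨x, hx1, hx2⟩ := hsurj (u y) (s y)
    exact ⟨x, hinj _ _ ((hHu x).trans hx1) ((hHs x).trans hx2)⟩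
  · rw [u.map_add, hHu, hHu, hw2, u.map_add]; ring
  · rw [s.map_add, hHs, hHs, hv2, s.map_add]; ring
  · refine lt_of_le_of_lt (hCb _ (max K₁ K₂) ?_ ?_) (lt_add_one _)
    · rw [u.map_sub, hHu, add_sub_cancel_left]; exact (hK₁ x).trans (le_max_left _ _)
    · rw [s.map_sub, hHs, add_sub_cancel_left]; exact (hK₂ x).trans (le_max_right _ _)
  · rw [hHu, hul, hHu, hu_map]
  · rw [hHs, hsl, hHs, hs_map]

end IsScaledFlow

/-- A bijective map of the plane commuting with integer translations induces a homeomorphism of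
the torus. -/
theorem exists_torus_homeomorph {H : (Fin 2 → ℝ) → (Fin 2 → ℝ)} (hc : Continuous H)
    (hH : Function.Bijective H) (heq : ∀ x m, H (x + intVec m) = H x + intVec m) :
    ∃ h : Torus2 ≃ₜ Torus2, ∀ x, h (torusProj x) = torusProj (H x) := by
  let f : Torus2 → Torus2 := fun z => torusProj (H (Function.surjInv surjective_torusProj z))
  have hf : ∀ x, f (torusProj x) = torusProj (H x) := fun x => by
    obtain ⟨m, hm⟩ := torusProj_eq_iff.1
      (Function.surjInv_eq surjective_torusProj (torusProj x)).symm
    simp only [f, hm, heq, torusProj_add_intVec]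
  have hfc : Continuous f := isQuotientMap_torusProj.continuous_iff.2
    ((continuous_torusProj.comp hc).congr fun x => (hf x).symm)
  have hfb : Function.Bijective f := by
    constructor
    · intro z₁ z₂ h12
      obtain ⟨x, rfl⟩ := surjective_torusProj z₁
      obtain ⟨y, rfl⟩ := surjective_torusProj z₂
      rw [hf, hf] at h12
      obtain ⟨m, hm⟩ := torusProj_eq_iff.1 h12
      rw [← heq] at hm
      rw [hH.1 hm, torusProj_add_intVec]
    · intro z
      obtain ⟨y, rfl⟩ := surjective_torusProj z
      obtain ⟨x, rfl⟩ := hH.2 y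
      exact ⟨torusProj x, hf x⟩
  exact ⟨Continuous.homeoOfEquivCompactToT2 (f := Equiv.ofBijective f hfb) hfc, hf⟩

end

end

/-! ### Main theorem. -/

theorem mainTheorem2 (l : ℝ) [Fact (1 < l)] (r : WithTop ℕ∞) (hr : 2 ≤ r)
    (ρ : AbelByCyclic l →* Equiv.Perm Torus2)
    (hρ : IsContDiffAction r ρ) (hfree : IsLocallyFree ρ) :
    ∃ A : Matrix.GeneralLinearGroup (Fin 2) ℤ,
      IsHomologyMatrix (ρ ⟨1, 0⟩) A.val ∧
      IsHyperbolicMatrix A.val ∧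
      ∀ F : (Fin 2 → ℝ) → (Fin 2 → ℝ), IsTorusLift (ρ ⟨1, 0⟩) F →
        (∃ H, IsFranksSemiconj F A.val H) ∧
        ∀ H, IsFranksSemiconj F A.val H →
          ∃ h : Torus2 ≃ₜ Torus2,
            (∀ x, h (torusProj x) = torusProj (H x)) ∧
            (∀ z, h (ρ ⟨1, 0⟩ z) = torusLin A.val (h z)) ∧
            (∀ z, h '' flowOrbit ρ z = expandingLeaf A.val (h z)) := by
  obtain ⟨A, hA⟩ := exists_generalLinear_matrix hρ
  obtain ⟨φ, hφ, hlift⟩ := exists_isPlaneFlow hr hρ hfree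
  obtain ⟨F₀, hF₀⟩ := exists_isTorusLift hρ 1
  obtain ⟨Fh₀, -, hscal₀⟩ := hF₀.exists_isScaledFlow hρ hφ hlift (hA F₀ hF₀)
  obtain ⟨μ, ν, hsp⟩ := hscal₀.exists_isSpectralPair
  refine ⟨A, ⟨F₀, hF₀, hA F₀ hF₀⟩, hsp.isHyperbolicMatrix, fun F hF => ?_⟩
  obtain ⟨Fh, rfl, hscal⟩ := hF.exists_isScaledFlow hρ hφ hlift (hA F hF)
  refine ⟨hscal.exists_isFranksSemiconj hsp, fun H hH => ?_⟩
  obtain ⟨K, hyp⟩ := hscal.isHyperbolicSemiconj_comp hsp hH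
  obtain ⟨a, ha, huni, hinj, -⟩ := hyp.bijective_and_uniform
  have hbij : Function.Bijective H :=
    ⟨fun x y hxy => hinj x y (by simp only [hxy]) (by simp only [hxy]), hH.surjective⟩
  obtain ⟨h, hh⟩ := exists_torus_homeomorph hH.continuous hbij hH.equivariant
  refine ⟨h, hh, fun z => ?_, fun z => ?_⟩
  · obtain ⟨x, rfl⟩ := surjective_torusProj z
    rw [← hF.2, hh, hh, hH.semiconj, torusProj_linAct]
  · obtain ⟨x, rfl⟩ := surjective_torusProj z
    obtain ⟨v, hv1, hv2⟩ := exists_eq_of_pair_injective hsp.inj 1 0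
    -- `v` is the expanding eigenvector normalized by the functional for `μ`. Orbits become
    -- parametrized lines in its direction, and `a ≠ 0` ensures that the whole line is covered.
    have hflow : ∀ t, H (φ t x) = H x + (a * t) • v := fun t => by
      refine hsp.inj _ _ ?_ ?_
      · rw [huni, map_add, map_smul, hv1, smul_eq_mul, mul_one]
      · rw [hyp.Hs_flow, map_add, map_smul, hv2, smul_zero, add_zero]
    have horb : ∀ t, h (ρ ⟨0, t⟩ (torusProj x)) = h (torusProj x) + torusProj ((a * t) • v) :=
      fun t => by rw [← hlift, hh, hflow, hh, torusProj_add]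
    ext y
    constructor
    · rintro ⟨_, ⟨t, rfl⟩, rfl⟩
      refine ⟨(a * t) • v, ?_, (horb t).symm⟩
      exact hsp.mem_expandingSubspace_iff.2 (by rw [map_smul, hv2, smul_zero])
    · rintro ⟨w, hw, rfl⟩
      have hw' := hsp.mem_expandingSubspace_iff.1 hw
      refine ⟨_, ⟨IsSpectralPair.leftEigen A.val μ w / a, rfl⟩, ?_⟩
      simp only [horb]
      have hwv : w = (a * (IsSpectralPair.leftEigen A.val μ w / a)) • v := by
        rw [mul_div_cancel₀ _ ha]
        exact hsp.inj _ _ (by rw [map_smul, hv1, smul_eq_mul, mul_one])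
          (by rw [map_smul, hv2, smul_zero, hw'])
      rw [← hwv]
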